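/- **Definitions.** For a measure $\mu$ on $\mathbb R$ with all moments $m_n(\mu)=\int t^n\,\mu(dt)$, the free cumulants $\kappa_n(\mu)$, $n\ge 1$, are defined recursively by $m_n(\mu)=\sum_{\pi\in NC(n)}\prod_{B\in\pi}\kappa_{|B|}(\mu)$, where $NC(n)$ is the set of non-crossing partitions of $\{1,\dots,n\}$. A non-commutative $*$-probability space is a unital complex $*$-algebra $A$ with a linear functional $\tau$ such that $\tau(1)=1$, $\tau(a^*)=\overline{\tau(a)}$ and $\tau(aa^*)\ge 0$. Elements $X,Y\in A$ are free if the expectation of every nonempty product whose factors are alternately polynomials in $X$ and polynomials in $Y$, each of expectation zero, vanishes. A self-adjoint $X$ is bounded if $\lim_k|\tau(X^{2k})|^{1/(2k)}<\infty$, and has distribution $\mu$ (a compactly supported probability measure on $\mathbb R$) if $\tau(X^n)=m_n(\mu)$ for all $n\ge0$. The free convolution $\mu\boxplus\nu$ is the distribution of $X+Y$, where $X,Y$ are free bounded self-adjoint elements with distributions $\mu,\nu$; $\mu^{\boxplus k}$ is the $k$-fold iterate. Put $G_\mu(z)=\int\frac{\mu(dt)}{z-t}$ and $V_\mu(w)=\frac1w+\sum_{n\ge0}\kappa_{n+1}(\mu)w^n$.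 **Theorem (free Poisson limit theorem).** Let $\lambda,\alpha>0$ and, for integers $N\ge\lambda$, let $\mu_N=(1-\frac{\lambda}{N})\delta_0+\frac{\lambda}{N}\delta_\alpha$. Put $I=[\alpha(1-\sqrt\lambda)^2,\alpha(1+\sqrt\lambda)^2]$, $$m(t)=\frac{1}{2\pi\alpha t}\sqrt{4\lambda\alpha^2-(t-\alpha(1+\lambda))^2}\ \ (t\in I),\qquad m(t)=0\ \ (t\notin I),$$ $$\mu(dt)=\begin{cases}(1-\lambda)\delta_0+m(t)\,dt,&\lambda\le 1,\\ m(t)\,dt,&\lambda>1.\end{cases}$$ 1. For every $N\ge\lambda$, $\mu_N$ is a compactly supported probability measure with $m_n(\mu_N)=\frac{\lambda}{N}\alpha^n$ for $n\ge1$. All iterates $\mu_N^{\boxplus k}$, $k\ge 1$, exist and do not depend on the free random variables that realize them. The measure $\mu_N^{\boxplus N}$ is a compactly supported probability measure and $\kappa_n(\mu_N^{\boxplus N})=N\kappa_n(\mu_N)$ for $n\ge1$. 2. For every $n\ge1$, as $N\to\infty$: $\kappa_n(\mu_N)=\frac{\lambda}{N}\alpha^n+O(N^{-2})$, $\kappa_n(\mu_N^{\boxplus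 N})=\lambda\alpha^n+O(N^{-1})$, and hence $\kappa_n(\mu_N^{\boxplus N})\to\lambda\alpha^n$. 3. The Marchenko–Pastur law $\mu$ is a compactly supported probability measure with $\kappa_n(\mu)=\lambda\alpha^n$ for all $n\ge1$, and it is the only one. 4. $\mu_N^{\boxplus N}$ converges to $\mu$ weakly and in all moments. 5. For $0<|w|<1/\alpha$ the series $V_\mu(w)$ converges and $V_\mu(w)=\frac1w+\frac{\lambda\alpha}{1-\alpha w}$; and $V_\mu(G_\mu(z))=z$ for all sufficiently large $|z|$. 6. For $z\in\mathbb C\setminus(I\cup\{0\})$ one has $G_\mu(z)\ne0$, $1-\alpha G_\mu(z)\neq 0$, $$\frac1{G_\mu(z)}+\frac{\lambda\alpha}{1-\alpha G_\mu(z)}=z,\qquad G_\mu(z)=\frac{z+\alpha(1-\lambda)-\sqrt{(z-\alpha(1+\lambda))^2-4\lambda\alpha^2}}{2\alpha z},$$ where the square root is the branch $s$ that is holomorphic on $\mathbb C\setminus I$ with $s(z)/z\to1$ as $|z|\to\infty$; moreover $zG_\mu(z)\to1$ as $|z|\to\infty$. 7. (Stieltjes inversion) $-\frac1\pi\lim_{\varepsilon\downarrow0}\operatorname{Im}G_\mu(t+i\varepsilon)=m(t)$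 for every real $t\ne0$. -/

import Mathlib

open MeasureTheory Filter Topology

/-! Free cumulants -/

/-- A partition of `{0, …, n-1}` is non-crossing if there are no `i < j < k < l` with `i, k` in one
block and `j, l` in another block. -/
def IsNonCrossing {n : ℕ} (π : Finpartition (Finset.univ : Finset (Fin n))) : Prop :=
  ∀ B ∈ π.parts, ∀ C ∈ π.parts, B ≠ C →
    ¬ ∃ i j k l : Fin n, i < j ∧ j < k ∧ k < l ∧ i ∈ B ∧ k ∈ B ∧ j ∈ C ∧ l ∈ C

open Classical in
/-- The set `NC(n)` of non-crossing partitions of an `n`-element chain. -/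
noncomputable def nonCrossingPartitions (n : ℕ) :
    Finset (Finpartition (Finset.univ : Finset (Fin n))) :=
  Finset.univ.filter IsNonCrossing

/-- The free cumulants of a moment sequence `m`, defined by the recursion
`κ_n = m_n - ∑_{π ∈ NC(n), π has ≥ 2 blocks} ∏_{B ∈ π} κ_{|B|}`.  A block `B` of a partition with
at least two blocks has `|B| < n`; the test in the product only makes this visible to the
recursion (see `moment_eq_sum_freeCumulant`).  Only `n ≥ 1` is meaningful. -/
noncomputable def freeCumulant (m : ℕ → ℝ) (n : ℕ) : ℝ :=
  m n - ∑ π ∈ (nonCrossingPartitions n).filter (fun π => 2 ≤ π.parts.card),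
    ∏ B ∈ π.parts, if _h : B.card < n then freeCumulant m B.card else 0
termination_by n

/-- The `n`-th moment of a measure on the line. -/
noncomputable def measureMoment (μ : Measure ℝ) (n : ℕ) : ℝ := ∫ t, t ^ n ∂μ

/-- The `n`-th free cumulant of a measure on the line. -/
noncomputable def measureFreeCumulant (μ : Measure ℝ) (n : ℕ) : ℝ :=
  freeCumulant (measureMoment μ) n

/-- The free moment-cumulant formula `m_n = ∑_{π ∈ NC(n)} ∏_{B ∈ π} κ_{|B|}`. -/
theorem moment_eq_sum_freeCumulant (m : ℕ → ℝ) (n : ℕ) (hn : 1 ≤ n) :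
    m n = ∑ π ∈ nonCrossingPartitions n, ∏ B ∈ π.parts, freeCumulant m B.card := by
  classical
  have hne : (Finset.univ : Finset (Fin n)) ≠ ⊥ := by
    intro h
    have : (⟨0, hn⟩ : Fin n) ∈ (Finset.univ : Finset (Fin n)) := Finset.mem_univ _
    rw [h] at this
    simp at this
  have hpos : ∀ π : Finpartition (Finset.univ : Finset (Fin n)), 1 ≤ π.parts.card := by
    intro π
    exact Finset.card_pos.2 (π.parts_nonempty hne)
  have htop : ∀ π : Finpartition (Finset.univ : Finset (Fin n)),
      ¬ 2 ≤ π.parts.card ↔ π.parts = {Finset.univ} := by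
    intro π
    constructor
    · intro h
      have h1 : π.parts.card = 1 := by have := hpos π; omega
      obtain ⟨B, hB⟩ := Finset.card_eq_one.1 h1
      have hs := π.sup_parts
      rw [hB] at hs ⊢
      simpa using hs
    · intro h
      rw [h]
      simp
  rw [← Finset.sum_filter_add_sum_filter_not _ (fun π => 2 ≤ π.parts.card)]
  have h1 : ∑ π ∈ (nonCrossingPartitions n).filter (fun π => ¬ 2 ≤ π.parts.card),
      ∏ B ∈ π.parts, freeCumulant m B.card = freeCumulant m n := by
    have : (nonCrossingPartitions n).filter (fun π => ¬ 2 ≤ π.parts.card)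
        = {Finpartition.indiscrete hne} := by
      ext π
      simp only [Finset.mem_filter, Finset.mem_singleton, htop, nonCrossingPartitions,
        Finset.mem_univ, true_and]
      constructor
      · rintro ⟨_, h⟩
        exact Finpartition.ext h
      · rintro rfl
        refine ⟨?_, rfl⟩
        intro B hB C hC hBC
        simp only [Finpartition.indiscrete_parts, Finset.mem_singleton] at hB hC
        exact absurd (hB.trans hC.symm) hBC
    rw [this]
    simp
  have h2 : ∑ π ∈ (nonCrossingPartitions n).filter (fun π => 2 ≤ π.parts.card),
      ∏ B ∈ π.parts, freeCumulant m B.card =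
      ∑ π ∈ (nonCrossingPartitions n).filter (fun π => 2 ≤ π.parts.card),
      ∏ B ∈ π.parts, if _h : B.card < n then freeCumulant m B.card else 0 := by
    refine Finset.sum_congr rfl fun π hπ => Finset.prod_congr rfl fun B hB => ?_
    have h2 := (Finset.mem_filter.1 hπ).2
    have hlt : B.card < n := by
      by_contra hcon
      have hBu : B = Finset.univ := by
        apply Finset.eq_univ_of_card
        have := Finset.card_le_univ B
        simp only [Fintype.card_fin] at this ⊢
        omega
      subst hBu
      apply absurd h2
      rw [htop]
      ext C
      constructor
      · intro hC
        rw [Finset.mem_singleton]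
        by_contra hCu
        have hd : Disjoint C Finset.univ := π.disjoint hC hB hCu
        have hC0 : C = ⊥ := by simpa [Finset.disjoint_iff_inter_eq_empty] using hd
        exact π.bot_notMem (hC0 ▸ hC)
      · intro hC
        rw [Finset.mem_singleton] at hC
        exact hC ▸ hB
    simp [hlt]
  rw [h1, h2, freeCumulant]
  ring

/-! Non-commutative probability and free convolution -/

/-- `(A, τ)` is a non-commutative `*`-probability space with non-negative expectation.
(By `map_star` the number `τ (a * star a)` is real.) -/
structure IsStarExpectation {A : Type*} [Ring A] [StarRing A] [Algebra ℂ A]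
    (τ : A →ₗ[ℂ] ℂ) : Prop where
  map_one : τ 1 = 1
  map_star : ∀ a : A, τ (star a) = star (τ a)
  nonneg : ∀ a : A, 0 ≤ (τ (a * star a)).re

/-- Voiculescu's free independence of `X` and `Y`: the expectation of every nonempty product of
polynomials in `X` and polynomials in `Y` vanishes if the factors alternate between `X` and `Y`
and each of them has expectation zero. -/
def FreelyIndependent {A : Type*} [Ring A] [Algebra ℂ A] (τ : A →ₗ[ℂ] ℂ) (X Y : A) : Prop :=
  ∀ w : List (Bool × Polynomial ℂ), w ≠ [] → w.IsChain (fun p q => p.1 ≠ q.1) →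
    (∀ p ∈ w, τ (Polynomial.aeval (if p.1 then X else Y) p.2) = 0) →
    τ (w.map (fun p => Polynomial.aeval (if p.1 then X else Y) p.2)).prod = 0

/-- The spectral radius `lim_k |τ(X^{2k})|^{1/(2k)}` of a self-adjoint random variable. -/
noncomputable def ncSpectralRadius {A : Type*} [Ring A] [Algebra ℂ A] (τ : A →ₗ[ℂ] ℂ)
    (X : A) : ENNReal :=
  limsup (fun k : ℕ => ‖τ (X ^ (2 * k))‖ₑ ^ (1 / (2 * k : ℝ))) atTop

/-- A compactly supported probability measure on the line. -/
structure IsCompactProbability (μ : Measure ℝ) : Prop where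
  prob : IsProbabilityMeasure μ
  compact : IsCompact μ.support

/-- `X` is a bounded self-adjoint random variable with distribution `μ`, a compactly supported
probability measure. -/
structure HasDistribution {A : Type*} [Ring A] [StarRing A] [Algebra ℂ A]
    (τ : A →ₗ[ℂ] ℂ) (X : A) (μ : Measure ℝ) : Prop where
  selfAdjoint : IsSelfAdjoint X
  bounded : ncSpectralRadius τ X < ⊤
  measure : IsCompactProbability μ
  moments : ∀ n : ℕ, τ (X ^ n) = ((measureMoment μ n : ℝ) : ℂ)

/-- `ρ` is the distribution of `X + Y` for some freely independent bounded self-adjoint random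
variables `X`, `Y` with distributions `μ`, `ν`. -/
def IsFreeConvolution (μ ν ρ : Measure ℝ) : Prop :=
  ∃ (A : Type) (_ : Ring A) (_ : StarRing A) (_ : Algebra ℂ A) (_ : StarModule ℂ A)
    (τ : A →ₗ[ℂ] ℂ) (X Y : A),
    IsStarExpectation τ ∧ HasDistribution τ X μ ∧ HasDistribution τ Y ν ∧
      FreelyIndependent τ X Y ∧ HasDistribution τ (X + Y) ρ

open Classical in
/-- The additive free convolution `μ ⊞ ν`. -/
noncomputable def freeConv (μ ν : Measure ℝ) : Measure ℝ :=
  if h : ∃ ρ, IsFreeConvolution μ ν ρ then h.choose else 0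

/-- The iterated free convolution `μ ⊞ ⋯ ⊞ μ` with `n` terms (the unit `δ_0` for `n = 0`). -/
noncomputable def freeConvPow (μ : Measure ℝ) : ℕ → Measure ℝ
  | 0 => Measure.dirac 0
  | 1 => μ
  | n + 2 => freeConv (freeConvPow μ (n + 1)) μ

/-! Transforms -/

/-- The Cauchy transform `G_μ(z) = ∫ 1/(z-t) μ(dt)`. -/
noncomputable def cauchyTransform (μ : Measure ℝ) (z : ℂ) : ℂ := ∫ t : ℝ, 1 / (z - (t : ℂ)) ∂μ

/-- The Voiculescu transform `V_μ(w) = 1/w + ∑_{n ≥ 0} κ_{n+1}(μ) w^n`. -/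
noncomputable def voiculescuTransform (μ : Measure ℝ) (w : ℂ) : ℂ :=
  1 / w + ∑' n : ℕ, (measureFreeCumulant μ (n + 1) : ℂ) * w ^ n

/-! The measures in the free Poisson limit theorem -/

/-- The measure `μ_N = (1 - lam/N) δ_0 + (lam/N) δ_α`, a probability measure for `N ≥ lam`. -/
noncomputable def rareEventMeasure (lam α : ℝ) (N : ℕ) : Measure ℝ :=
  ENNReal.ofReal (1 - lam / N) • Measure.dirac 0 + ENNReal.ofReal (lam / N) • Measure.dirac α

/-- The interval `[α (1 - √lam)², α (1 + √lam)²]`, where `4 lam α² - (t - α (1 + lam))² ≥ 0`. -/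
def mpInterval (lam α : ℝ) : Set ℝ :=
  Set.Icc (α * (1 - √lam) ^ 2) (α * (1 + √lam) ^ 2)

/-- The function `m(t) = √(4 lam α² - (t - α (1 + lam))²) / (2 π α t)` on `mpInterval lam α`,
extended by zero. -/
noncomputable def mpDensity (lam α : ℝ) : ℝ → ℝ :=
  (mpInterval lam α).indicator fun t =>
    1 / (2 * Real.pi * α * t) * √(4 * lam * α ^ 2 - (t - α * (1 + lam)) ^ 2)

/-- The Marchenko–Pastur distribution of rate `lam` and jump size `α`. -/
noncomputable def marchenkoPastur (lam α : ℝ) : Measure ℝ :=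
  if lam ≤ 1 then
    ENNReal.ofReal (1 - lam) • Measure.dirac 0 +
      volume.withDensity (fun t => ENNReal.ofReal (mpDensity lam α t))
  else
    volume.withDensity (fun t => ENNReal.ofReal (mpDensity lam α t))

/-!
The proof rests on three facts.

*Free cumulants are additive under free independence.*  Cutting a non-crossing partition at the
successor of its least element (`ncSum_Ico`) gives the functional equation `M(z) = C(z M(z))` of the
moment series `M` and the cumulant series `C = 1 + ∑ κ_n wⁿ` (`momentSeries_eq_subst`).  Under the
substitution `w = z M(z)` it says that the formal resolvent `(C(w) - w x)⁻¹` has expectation `1`, and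
this property determines `C`.  For free `X` and `Y` the resolvent of `X + Y` with the denominator
`C_X(w) + C_Y(w) - 1 - w (X + Y)` is `1` plus a sum of alternating products of centered elements
(`FreelyIndependent.mapLinear_resolventSeries_add`), so it has expectation `1` as well, and
`C_{X+Y} = C_X + C_Y - 1`.

*Free convolutions exist and are unique.*  Compactly supported measures are determined by their
moments (`tendsto_integral_of_tendsto_moments`, through polynomial approximation), hence by their
free cumulants, which yields uniqueness.  For existence, the measures are realized by the
multiplication operators on their `L²` spaces; these act on the free product Hilbert space, whose
orthonormal basis consists of the reduced words in two pointed orthonormal bases, and they are free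
in the vacuum state (`freelyIndependent_freeRep`).  The distribution of the sum is the spectral
measure of a bounded self-adjoint operator.

*The Marchenko–Pastur law has the free cumulants `lam αⁿ`.*  With `t = α (1 + lam + 2 √lam cos θ)` its
Cauchy transform is an integral of `sin² θ / (1 - 2 ω cos θ + ω²)`, which gives
`z G(z) = 1 + √lam ω` for the point `ω` of the unit disk with `α √lam (ω + 1/ω) = z - α (1 + lam)`
(`cauchyTransform_marchenkoPastur`).  The algebraic equation for `G`, its explicit form and Stieltjes
inversion follow, and the expansion of `G` at infinity turns the algebraic equation into the
functional equation `M(z) = C(z M(z))` with `C = 1 + ∑ lam αⁿ wⁿ`.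

The moments of the measure of rare events are `lam αⁿ / N`, and in its cumulants every partition
with at least two blocks contributes `O(N⁻²)`.  Additivity multiplies the cumulants by `N`; they
converge to `lam αⁿ`, hence so do all the moments, and the method of moments gives weak convergence.
-/

/-! ### Non-crossing partitions and the recursion of the moment–cumulant formula -/

/-- `P` is the set of blocks of a non-crossing partition of the finite set `s ⊆ ℕ`.  Partitions are
kept as plain sets of blocks, so that those of different ground sets can be cut and glued. -/
structure IsNCBlocks (s : Finset ℕ) (P : Finset (Finset ℕ)) : Prop where
  nonempty : ∀ B ∈ P, B.Nonempty
  subset : ∀ B ∈ P, B ⊆ s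
  cover : ∀ x ∈ s, ∃ B ∈ P, x ∈ B
  eq_of_mem : ∀ B ∈ P, ∀ C ∈ P, ∀ x, x ∈ B → x ∈ C → B = C
  noncrossing : ∀ B ∈ P, ∀ C ∈ P, B ≠ C → ∀ i j k l, i < j → j < k → k < l →
    i ∈ B → k ∈ B → j ∈ C → l ∈ C → False

open Classical in
/-- The non-crossing partitions of `s`. -/
noncomputable def ncBlocks (s : Finset ℕ) : Finset (Finset (Finset ℕ)) :=
  s.powerset.powerset.filter (IsNCBlocks s)

lemma mem_ncBlocks {s : Finset ℕ} {P : Finset (Finset ℕ)} : P ∈ ncBlocks s ↔ IsNCBlocks s P := by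
  simp only [ncBlocks, Finset.mem_filter, Finset.mem_powerset, and_iff_right_iff_imp]
  intro h B hB
  exact Finset.mem_powerset.2 (h.subset B hB)

/-- The sum over the non-crossing partitions of `s` of the products of the weights of the blocks. -/
noncomputable def ncSum {R : Type*} [CommSemiring R] (s : Finset ℕ) (f : Finset ℕ → R) : R :=
  ∑ P ∈ ncBlocks s, ∏ B ∈ P, f B

lemma ncSum_congr {R : Type*} [CommSemiring R] {s : Finset ℕ} {f g : Finset ℕ → R}
    (h : ∀ B ⊆ s, f B = g B) : ncSum s f = ncSum s g :=
  Finset.sum_congr rfl fun _ hP => Finset.prod_congr rfl fun B hB =>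
    h B ((mem_ncBlocks.1 hP).subset B hB)

lemma ncSum_empty {R : Type*} [CommSemiring R] (f : Finset ℕ → R) : ncSum ∅ f = 1 := by
  have : ncBlocks ∅ = {∅} := by
    ext P
    rw [mem_ncBlocks, Finset.mem_singleton]
    constructor
    · intro h
      refine Finset.eq_empty_of_forall_notMem fun B hB => ?_
      obtain ⟨x, hx⟩ := h.nonempty B hB
      exact absurd (h.subset B hB hx) (by simp)
    · rintro rfl
      constructor <;> simp
  simp [ncSum, this]

/-- `j` is the successor of `a` in the block of `a`. -/
def IsNextInBlock (a j : ℕ) (P : Finset (Finset ℕ)) : Prop :=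
  ∃ B ∈ P, a ∈ B ∧ j ∈ B ∧ a < j ∧ ∀ x ∈ B, x ≠ a → j ≤ x

/-- If `j` is the successor of `a` in its block, then no block can cross the pair `(a, j)`: up to the
point `a`, every block lies in `(a, j)` or in `[j, b)`. -/
lemma IsNextInBlock.subset_or {a b j : ℕ} {P : Finset (Finset ℕ)} (hP : IsNCBlocks (Finset.Ico a b) P)
    (hj : IsNextInBlock a j P) {B : Finset ℕ} (hB : B ∈ P) :
    (B ⊆ Finset.Ico (a + 1) j ∧ a ∉ B) ∨ (B.erase a ⊆ Finset.Ico j b ∧ (a ∈ B ↔ j ∈ B) ∧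
      ¬ B ⊆ Finset.Ico (a + 1) j) := by
  obtain ⟨B0, hB0, ha, hjB, haj, hmin⟩ := hj
  by_cases hBB : B = B0
  · subst hBB
    right
    refine ⟨?_, by simp [ha, hjB], fun h => by simpa using h ha⟩
    intro x hx
    have h1 := hmin x (Finset.mem_of_mem_erase hx) (Finset.ne_of_mem_erase hx)
    have h2 := hP.subset B hB (Finset.mem_of_mem_erase hx)
    simp only [Finset.mem_Ico] at h2 ⊢
    omega
  · have haB : a ∉ B := fun h => hBB (hP.eq_of_mem B hB B0 hB0 a h ha)
    have hjnB : j ∉ B := fun h => hBB (hP.eq_of_mem B hB B0 hB0 j h hjB)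
    have key : ∀ x ∈ B, ∀ y ∈ B, x < j → j ≤ y → False := by
      intro x hx y hy hxj hjy
      have h2 := hP.subset B hB hx
      simp only [Finset.mem_Ico] at h2
      refine hP.noncrossing B0 hB0 B hB (Ne.symm hBB) a x j y ?_ hxj ?_ ha hjB hx hy
      · exact lt_of_le_of_ne h2.1 (fun h => haB (h ▸ hx))
      · exact lt_of_le_of_ne hjy (fun h => hjnB (h ▸ hy))
    obtain ⟨y, hy⟩ := hP.nonempty B hB
    by_cases hyj : y < j
    · left
      refine ⟨fun x hx => ?_, haB⟩
      have h2 := hP.subset B hB hx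
      have h3 : ¬ j ≤ x := fun h => key y hy x hx hyj h
      have : x ≠ a := fun h => haB (h ▸ hx)
      simp only [Finset.mem_Ico] at h2 ⊢
      omega
    · right
      refine ⟨fun x hx => ?_, by simp [haB, hjnB], fun h => ?_⟩
      · have hx := Finset.mem_of_mem_erase hx
        have h2 := hP.subset B hB hx
        have h3 : ¬ x < j := fun hxj => key x hx y hy hxj (by omega)
        simp only [Finset.mem_Ico] at h2 ⊢
        omega
      · have := h hy
        simp only [Finset.mem_Ico] at this
        omega

/-- Adds `a` to the block that contains `j`. -/
def attach (a j : ℕ) (B : Finset ℕ) : Finset ℕ := if j ∈ B then insert a B else B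

lemma mem_attach {a j x : ℕ} {B : Finset ℕ} : x ∈ attach a j B ↔ x ∈ B ∨ (j ∈ B ∧ x = a) := by
  unfold attach
  split_ifs with h <;> simp [h, or_comm]

lemma erase_attach {a j : ℕ} {B : Finset ℕ} (h : a ∉ B) : (attach a j B).erase a = B := by
  unfold attach
  split_ifs with hj
  · exact Finset.erase_insert h
  · exact Finset.erase_eq_of_notMem h

lemma attach_erase {a j : ℕ} {B : Finset ℕ} (haj : a ≠ j) (h : a ∈ B ↔ j ∈ B) :
    attach a j (B.erase a) = B := by
  ext x
  rw [mem_attach]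
  by_cases hx : x = a
  · subst hx; simp [h, haj.symm]
  · simp [hx]

/-- Non-crossing partitions of `(a, j)` and of `[j, b)` combine to one of `[a, b)` in which `j` is the
successor of `a`. -/
lemma glue_isNCBlocks {a b j : ℕ} (haj : a < j) (hjb : j < b) {P₁ P₂ : Finset (Finset ℕ)}
    (h₁ : IsNCBlocks (Finset.Ico (a + 1) j) P₁) (h₂ : IsNCBlocks (Finset.Ico j b) P₂) :
    IsNCBlocks (Finset.Ico a b) (P₁ ∪ P₂.image (attach a j)) := by
  have e₁ : ∀ B ∈ P₁, ∀ x ∈ B, a < x ∧ x < j := fun B hB x hx => by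
    have := h₁.subset B hB hx; simp only [Finset.mem_Ico] at this; omega
  have e₂ : ∀ B ∈ P₂, ∀ x ∈ B, j ≤ x ∧ x < b := fun B hB x hx => by
    have := h₂.subset B hB hx; simpa only [Finset.mem_Ico] using this
  have hmem : ∀ B, B ∈ P₁ ∪ P₂.image (attach a j) ↔ B ∈ P₁ ∨ ∃ C ∈ P₂, attach a j C = B := by
    simp
  constructor
  · intro B hB
    rcases (hmem B).1 hB with hB | ⟨C, hC, rfl⟩
    · exact h₁.nonempty B hB
    · obtain ⟨x, hx⟩ := h₂.nonempty C hC
      exact ⟨x, mem_attach.2 (Or.inl hx)⟩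
  · intro B hB x hx
    rw [Finset.mem_Ico]
    rcases (hmem B).1 hB with hB | ⟨C, hC, rfl⟩
    · have := e₁ B hB x hx; omega
    · rcases mem_attach.1 hx with hx | ⟨_, rfl⟩
      · have := e₂ C hC x hx; omega
      · omega
  · intro x hx
    rw [Finset.mem_Ico] at hx
    rcases lt_trichotomy x a with h | h | h
    · omega
    · subst h
      obtain ⟨B, hB, hjB⟩ := h₂.cover j (by simp; omega)
      exact ⟨_, (hmem _).2 (Or.inr ⟨B, hB, rfl⟩), mem_attach.2 (Or.inr ⟨hjB, rfl⟩)⟩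
    · by_cases hxj : x < j
      · obtain ⟨B, hB, hxB⟩ := h₁.cover x (by simp; omega)
        exact ⟨_, (hmem _).2 (Or.inl hB), hxB⟩
      · obtain ⟨B, hB, hxB⟩ := h₂.cover x (by simp; omega)
        exact ⟨_, (hmem _).2 (Or.inr ⟨B, hB, rfl⟩), mem_attach.2 (Or.inl hxB)⟩
  · intro B hB C hC x hxB hxC
    rw [hmem] at hB hC
    rcases hB with hB | ⟨B, hB, rfl⟩ <;> rcases hC with hC | ⟨C, hC, rfl⟩
    · exact h₁.eq_of_mem B hB C hC x hxB hxC
    · have := e₁ B hB x hxB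
      rcases mem_attach.1 hxC with hx | ⟨_, rfl⟩
      · have := e₂ C hC x hx; omega
      · omega
    · have := e₁ C hC x hxC
      rcases mem_attach.1 hxB with hx | ⟨_, rfl⟩
      · have := e₂ B hB x hx; omega
      · omega
    · rcases mem_attach.1 hxB with hx | ⟨hj, rfl⟩ <;> rcases mem_attach.1 hxC with hy | ⟨hj', hy⟩
      · rw [h₂.eq_of_mem B hB C hC x hx hy]
      · have := e₂ B hB x hx; omega
      · have := e₂ C hC x hy; omega
      · rw [h₂.eq_of_mem B hB C hC j hj hj']
  · intro B hB C hC hBC i₁ i₂ i₃ i₄ h12 h23 h34 hi₁ hi₃ hi₂ hi₄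
    rw [hmem] at hB hC
    rcases hB with hB | ⟨B, hB, rfl⟩ <;> rcases hC with hC | ⟨C, hC, rfl⟩
    · exact h₁.noncrossing B hB C hC hBC i₁ i₂ i₃ i₄ h12 h23 h34 hi₁ hi₃ hi₂ hi₄
    · have := e₁ B hB i₁ hi₁
      have := e₁ B hB i₃ hi₃
      rcases mem_attach.1 hi₂ with h | ⟨_, h⟩
      · have := e₂ C hC i₂ h; omega
      · omega
    · have := e₁ C hC i₂ hi₂
      have := e₁ C hC i₄ hi₄
      rcases mem_attach.1 hi₃ with h | ⟨_, h⟩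
      · have := e₂ B hB i₃ h; omega
      · omega
    · have h3 : i₃ ∈ B := by
        rcases mem_attach.1 hi₃ with h | ⟨_, h⟩
        · exact h
        · rcases mem_attach.1 hi₂ with h' | ⟨_, h'⟩
          · have := e₂ C hC i₂ h'; omega
          · omega
      have h4 : i₄ ∈ C := by
        rcases mem_attach.1 hi₄ with h | ⟨_, h⟩
        · exact h
        · have := e₂ B hB i₃ h3; omega
      have h2 : i₂ ∈ C := by
        rcases mem_attach.1 hi₂ with h | ⟨_, h⟩
        · exact h
        · rcases mem_attach.1 hi₁ with h' | ⟨_, h'⟩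
          · have := e₂ B hB i₁ h'; omega
          · omega
      have hne : B ≠ C := fun h => hBC (by rw [h])
      rcases mem_attach.1 hi₁ with h1 | ⟨hjB, rfl⟩
      · exact h₂.noncrossing B hB C hC hne i₁ i₂ i₃ i₄ h12 h23 h34 h1 h3 h2 h4
      -- the block `B` was enlarged by the point `a`, so that `j ∈ B` takes the place of `i₁`
      · have h5 := (e₂ C hC i₂ h2).1
        have h6 : j ≠ i₂ := fun h => hne (h₂.eq_of_mem B hB C hC j hjB (h ▸ h2))
        exact h₂.noncrossing B hB C hC hne j i₂ i₃ i₄ (by omega) h23 h34 hjB h3 h2 h4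

/-- The inverse of the construction in `glue_isNCBlocks`. -/
lemma cut_isNCBlocks {a b j : ℕ} {P : Finset (Finset ℕ)} (hP : IsNCBlocks (Finset.Ico a b) P)
    (hj : IsNextInBlock a j P) :
    IsNCBlocks (Finset.Ico (a + 1) j) (P.filter (· ⊆ Finset.Ico (a + 1) j)) ∧
      IsNCBlocks (Finset.Ico j b)
        ((P.filter (¬ · ⊆ Finset.Ico (a + 1) j)).image (fun B => B.erase a)) := by
  have haj : a < j := by obtain ⟨B, _, _, _, h, _⟩ := hj; exact h
  have hjb : j < b := by
    obtain ⟨B, hB, _, h, _, _⟩ := hj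
    have := hP.subset B hB h; simp only [Finset.mem_Ico] at this; omega
  have hmem : ∀ B, B ∈ (P.filter (¬ · ⊆ Finset.Ico (a + 1) j)).image (fun B => B.erase a) ↔
      ∃ C ∈ P, ¬ C ⊆ Finset.Ico (a + 1) j ∧ C.erase a = B := by
    simp [and_assoc]
  have hs : ∀ C ∈ P, ¬ C ⊆ Finset.Ico (a + 1) j →
      C.erase a ⊆ Finset.Ico j b ∧ (a ∈ C ↔ j ∈ C) := by
    intro C hC hn
    rcases hj.subset_or hP hC with h | h
    · exact absurd h.1 hn
    · exact ⟨h.1, h.2.1⟩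
  constructor
  · constructor
    · intro B hB; exact hP.nonempty B (Finset.mem_filter.1 hB).1
    · intro B hB; exact (Finset.mem_filter.1 hB).2
    · intro x hx
      rw [Finset.mem_Ico] at hx
      obtain ⟨B, hB, hxB⟩ := hP.cover x (by simp; omega)
      refine ⟨B, Finset.mem_filter.2 ⟨hB, ?_⟩, hxB⟩
      rcases hj.subset_or hP hB with h | h
      · exact h.1
      · have := h.1 (Finset.mem_erase.2 ⟨by omega, hxB⟩)
        simp only [Finset.mem_Ico] at this; omega
    · intro B hB C hC
      exact hP.eq_of_mem B (Finset.mem_filter.1 hB).1 C (Finset.mem_filter.1 hC).1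
    · intro B hB C hC
      exact hP.noncrossing B (Finset.mem_filter.1 hB).1 C (Finset.mem_filter.1 hC).1
  · constructor
    · intro B hB
      obtain ⟨C, hC, hn, rfl⟩ := (hmem B).1 hB
      by_cases haC : a ∈ C
      · exact ⟨j, Finset.mem_erase.2 ⟨by omega, (hs C hC hn).2.1 haC⟩⟩
      · rw [Finset.erase_eq_of_notMem haC]; exact hP.nonempty C hC
    · intro B hB
      obtain ⟨C, hC, hn, rfl⟩ := (hmem B).1 hB
      exact (hs C hC hn).1
    · intro x hx
      rw [Finset.mem_Ico] at hx
      obtain ⟨B, hB, hxB⟩ := hP.cover x (by simp; omega)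
      refine ⟨B.erase a, (hmem _).2 ⟨B, hB, ?_, rfl⟩, Finset.mem_erase.2 ⟨by omega, hxB⟩⟩
      intro h
      have := h hxB
      simp only [Finset.mem_Ico] at this; omega
    · intro B hB C hC x hxB hxC
      rw [hmem] at hB hC
      obtain ⟨B, hB, hn, rfl⟩ := hB
      obtain ⟨C, hC, hn', rfl⟩ := hC
      rw [hP.eq_of_mem B hB C hC x (Finset.mem_of_mem_erase hxB) (Finset.mem_of_mem_erase hxC)]
    · intro B hB C hC hne i₁ i₂ i₃ i₄ h12 h23 h34 hi₁ hi₃ hi₂ hi₄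
      rw [hmem] at hB hC
      obtain ⟨B, hB, hn, rfl⟩ := hB
      obtain ⟨C, hC, hn', rfl⟩ := hC
      exact hP.noncrossing B hB C hC (fun h => hne (by rw [h])) i₁ i₂ i₃ i₄ h12 h23 h34
        (Finset.mem_of_mem_erase hi₁) (Finset.mem_of_mem_erase hi₃) (Finset.mem_of_mem_erase hi₂)
        (Finset.mem_of_mem_erase hi₄)

open Classical in
lemma sum_isNextInBlock {R : Type*} [CommSemiring R] {a b j : ℕ} (haj : a < j) (hjb : j < b)
    (f : Finset ℕ → R) :
    ∑ P ∈ (ncBlocks (Finset.Ico a b)).filter (IsNextInBlock a j), ∏ B ∈ P, f B =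
      ncSum (Finset.Ico (a + 1) j) f * ncSum (Finset.Ico j b) (fun B => f (attach a j B)) := by
  rw [ncSum, ncSum, Finset.sum_mul_sum, ← Finset.sum_product']
  symm
  have nota : ∀ P₂, IsNCBlocks (Finset.Ico j b) P₂ → ∀ B ∈ P₂, a ∉ B := by
    intro P₂ h₂ B hB ha
    have := h₂.subset B hB ha
    simp only [Finset.mem_Ico] at this; omega
  have inj : ∀ P₂, IsNCBlocks (Finset.Ico j b) P₂ → Set.InjOn (attach a j) P₂ := by
    intro P₂ h₂ B hB C hC h
    rw [← erase_attach (nota P₂ h₂ B hB), h, erase_attach (nota P₂ h₂ C hC)]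
  have notsub : ∀ P₂, IsNCBlocks (Finset.Ico j b) P₂ → ∀ B ∈ P₂,
      ¬ attach a j B ⊆ Finset.Ico (a + 1) j := by
    intro P₂ h₂ B hB h
    obtain ⟨x, hx⟩ := h₂.nonempty B hB
    have h1 := h (mem_attach.2 (Or.inl hx))
    have h3 := h₂.subset B hB hx
    simp only [Finset.mem_Ico] at h1 h3; omega
  refine Finset.sum_bij' (fun p _ => p.1 ∪ p.2.image (attach a j))
    (fun P _ => (P.filter (· ⊆ Finset.Ico (a + 1) j),
      (P.filter (¬ · ⊆ Finset.Ico (a + 1) j)).image (fun B => B.erase a))) ?_ ?_ ?_ ?_ ?_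
  · rintro ⟨P₁, P₂⟩ h
    rw [Finset.mem_product, mem_ncBlocks, mem_ncBlocks] at h
    refine Finset.mem_filter.2 ⟨mem_ncBlocks.2 (glue_isNCBlocks haj hjb h.1 h.2), ?_⟩
    obtain ⟨B, hB, hjB⟩ := h.2.cover j (by simp; omega)
    refine ⟨attach a j B, Finset.mem_union_right _ (Finset.mem_image_of_mem _ hB),
      mem_attach.2 (Or.inr ⟨hjB, rfl⟩), mem_attach.2 (Or.inl hjB), haj, ?_⟩
    intro x hx hxa
    rcases mem_attach.1 hx with hx | hx
    · have := h.2.subset B hB hx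
      simp only [Finset.mem_Ico] at this; omega
    · exact absurd hx.2 hxa
  · intro P hP
    rw [Finset.mem_filter, mem_ncBlocks] at hP
    have := cut_isNCBlocks hP.1 hP.2
    exact Finset.mem_product.2 ⟨mem_ncBlocks.2 this.1, mem_ncBlocks.2 this.2⟩
  · rintro ⟨P₁, P₂⟩ h
    rw [Finset.mem_product, mem_ncBlocks, mem_ncBlocks] at h
    obtain ⟨h₁, h₂⟩ := h
    have e1 : (P₂.image (attach a j)).filter (· ⊆ Finset.Ico (a + 1) j) = ∅ := by
      rw [Finset.filter_eq_empty_iff]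
      intro B hB
      obtain ⟨C, hC, rfl⟩ := Finset.mem_image.1 hB
      exact notsub P₂ h₂ C hC
    have e2 : (P₂.image (attach a j)).filter (¬ · ⊆ Finset.Ico (a + 1) j) =
        P₂.image (attach a j) := by
      rw [Finset.filter_eq_self]
      intro B hB
      obtain ⟨C, hC, rfl⟩ := Finset.mem_image.1 hB
      exact notsub P₂ h₂ C hC
    have e3 : P₁.filter (· ⊆ Finset.Ico (a + 1) j) = P₁ :=
      Finset.filter_eq_self.2 fun B hB => h₁.subset B hB
    have e4 : P₁.filter (¬ · ⊆ Finset.Ico (a + 1) j) = ∅ :=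
      Finset.filter_eq_empty_iff.2 fun B hB => not_not.2 (h₁.subset B hB)
    simp only [Finset.filter_union, e1, e2, e3, e4, Finset.union_empty, Finset.empty_union,
      Finset.image_image, Prod.mk.injEq, true_and]
    conv_rhs => rw [← Finset.image_id (s := P₂)]
    exact Finset.image_congr fun B hB => erase_attach (nota P₂ h₂ B hB)
  · intro P hP
    rw [Finset.mem_filter, mem_ncBlocks] at hP
    obtain ⟨hP, hj⟩ := hP
    dsimp only
    rw [Finset.image_image]
    have : (P.filter (¬ · ⊆ Finset.Ico (a + 1) j)).image (attach a j ∘ fun B => B.erase a) =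
        P.filter (¬ · ⊆ Finset.Ico (a + 1) j) := by
      conv_rhs => rw [← Finset.image_id (s := P.filter (¬ · ⊆ Finset.Ico (a + 1) j))]
      refine Finset.image_congr fun B hB => ?_
      rw [Finset.mem_coe, Finset.mem_filter] at hB
      rcases hj.subset_or hP hB.1 with h | h
      · exact absurd h.1 hB.2
      · exact attach_erase haj.ne h.2.1
    rw [this, Finset.filter_union_filter_not_eq]
  · rintro ⟨P₁, P₂⟩ h
    rw [Finset.mem_product, mem_ncBlocks, mem_ncBlocks] at h
    obtain ⟨h₁, h₂⟩ := h
    dsimp only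
    rw [Finset.prod_union, Finset.prod_image (inj P₂ h₂)]
    rw [Finset.disjoint_left]
    intro B hB hB'
    obtain ⟨C, hC, rfl⟩ := Finset.mem_image.1 hB'
    exact notsub P₂ h₂ C hC (h₁.subset _ hB)

open Classical in
lemma sum_singleton_mem {R : Type*} [CommSemiring R] {a b : ℕ} (hab : a < b)
    (f : Finset ℕ → R) :
    ∑ P ∈ (ncBlocks (Finset.Ico a b)).filter ({a} ∈ ·), ∏ B ∈ P, f B =
      f {a} * ncSum (Finset.Ico (a + 1) b) f := by
  rw [ncSum, Finset.mul_sum]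
  symm
  have nota : ∀ P, IsNCBlocks (Finset.Ico (a + 1) b) P → ∀ B ∈ P, a ∉ B := by
    intro P₂ h₂ B hB ha
    have := h₂.subset B hB ha
    simp only [Finset.mem_Ico] at this; omega
  have notin : ∀ P, IsNCBlocks (Finset.Ico (a + 1) b) P → {a} ∉ P := fun P hP h =>
    nota P hP {a} h (by simp)
  refine Finset.sum_bij' (fun P _ => insert {a} P) (fun P _ => P.erase {a}) ?_ ?_ ?_ ?_ ?_
  · intro P hP
    rw [mem_ncBlocks] at hP
    have hb : ∀ B ∈ P, ∀ x ∈ B, a < x ∧ x < b := fun B hB x hx => by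
      have := hP.subset B hB hx; simp only [Finset.mem_Ico] at this; omega
    refine Finset.mem_filter.2 ⟨mem_ncBlocks.2 ?_, by simp⟩
    constructor
    · intro B hB
      rcases Finset.mem_insert.1 hB with rfl | hB
      · simp
      · exact hP.nonempty B hB
    · intro B hB x hx
      rcases Finset.mem_insert.1 hB with rfl | hB
      · simp only [Finset.mem_singleton] at hx; subst hx; simpa using hab
      · have := hb B hB x hx; simp only [Finset.mem_Ico]; omega
    · intro x hx
      by_cases hxa : x = a
      · exact ⟨{a}, by simp, by simp [hxa]⟩
      · obtain ⟨B, hB, h⟩ := hP.cover x (by simp only [Finset.mem_Ico] at hx ⊢; omega)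
        exact ⟨B, by simp [hB], h⟩
    · intro B hB C hC x hxB hxC
      rw [Finset.mem_insert] at hB hC
      rcases hB with rfl | hB <;> rcases hC with rfl | hC
      · rfl
      · simp only [Finset.mem_singleton] at hxB; subst hxB; exact absurd hxC (nota P hP C hC)
      · simp only [Finset.mem_singleton] at hxC; subst hxC; exact absurd hxB (nota P hP B hB)
      · exact hP.eq_of_mem B hB C hC x hxB hxC
    · intro B hB C hC hne i₁ i₂ i₃ i₄ h12 h23 h34 hi₁ hi₃ hi₂ hi₄
      rw [Finset.mem_insert] at hB hC
      rcases hB with rfl | hB <;> rcases hC with rfl | hC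
      · exact hne rfl
      · simp only [Finset.mem_singleton] at hi₁ hi₃; omega
      · simp only [Finset.mem_singleton] at hi₂ hi₄; omega
      · exact hP.noncrossing B hB C hC hne i₁ i₂ i₃ i₄ h12 h23 h34 hi₁ hi₃ hi₂ hi₄
  · intro P hP
    rw [Finset.mem_filter, mem_ncBlocks] at hP
    obtain ⟨hP, ha⟩ := hP
    refine mem_ncBlocks.2 ⟨?_, ?_, ?_, ?_, ?_⟩
    · intro B hB; exact hP.nonempty B (Finset.mem_of_mem_erase hB)
    · intro B hB x hx
      have h1 := hP.subset B (Finset.mem_of_mem_erase hB) hx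
      have h2 : x ≠ a := by
        rintro rfl
        exact (Finset.ne_of_mem_erase hB)
          (hP.eq_of_mem B (Finset.mem_of_mem_erase hB) _ ha x hx (by simp))
      simp only [Finset.mem_Ico] at h1 ⊢; omega
    · intro x hx
      simp only [Finset.mem_Ico] at hx
      obtain ⟨B, hB, h⟩ := hP.cover x (by simp only [Finset.mem_Ico]; omega)
      refine ⟨B, Finset.mem_erase.2 ⟨?_, hB⟩, h⟩
      rintro rfl
      simp only [Finset.mem_singleton] at h; omega
    · intro B hB C hC
      exact hP.eq_of_mem B (Finset.mem_of_mem_erase hB) C (Finset.mem_of_mem_erase hC)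
    · intro B hB C hC
      exact hP.noncrossing B (Finset.mem_of_mem_erase hB) C (Finset.mem_of_mem_erase hC)
  · intro P hP
    exact Finset.erase_insert (notin P (mem_ncBlocks.1 hP))
  · intro P hP
    exact Finset.insert_erase (Finset.mem_filter.1 hP).2
  · intro P hP
    rw [Finset.prod_insert (notin P (mem_ncBlocks.1 hP))]

/-- A non-crossing partition of `[a, b)` either has the block `{a}`, or is cut by the successor `j`
of `a` in its block into a partition of `(a, j)` and one of `[j, b)`. -/
lemma ncSum_Ico {R : Type*} [CommSemiring R] {a b : ℕ} (hab : a < b) (f : Finset ℕ → R) :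
    ncSum (Finset.Ico a b) f = f {a} * ncSum (Finset.Ico (a + 1) b) f +
      ∑ j ∈ Finset.Ico (a + 1) b,
        ncSum (Finset.Ico (a + 1) j) f * ncSum (Finset.Ico j b) (fun B => f (attach a j B)) := by
  classical
  rw [← sum_singleton_mem hab]
  have h1 : ∀ j ∈ Finset.Ico (a + 1) b,
      ncSum (Finset.Ico (a + 1) j) f * ncSum (Finset.Ico j b) (fun B => f (attach a j B)) =
      ∑ P ∈ (ncBlocks (Finset.Ico a b)).filter (IsNextInBlock a j), ∏ B ∈ P, f B := by
    intro j hj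
    rw [Finset.mem_Ico] at hj
    rw [sum_isNextInBlock (by omega) (by omega)]
  rw [Finset.sum_congr rfl h1, ncSum,
    ← Finset.sum_filter_add_sum_filter_not (ncBlocks (Finset.Ico a b)) (fun P => {a} ∈ P)]
  congr 1
  have hex : ∀ P, IsNCBlocks (Finset.Ico a b) P → {a} ∉ P →
      ∃ j, (Finset.Ico (a + 1) b).filter (fun j => IsNextInBlock a j P) = {j} := by
    intro P hP hn
    obtain ⟨B, hB, haB⟩ := hP.cover a (by simp [hab])
    have hne : (B.erase a).Nonempty := by
      rw [Finset.nonempty_iff_ne_empty]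
      intro h
      rcases (Finset.erase_eq_empty_iff B a).1 h with h | h
      · simp [h] at haB
      · exact hn (h ▸ hB)
    have hmin := Finset.min'_mem _ hne
    set j := (B.erase a).min' hne
    have hjB := Finset.mem_of_mem_erase hmin
    have hja := Finset.ne_of_mem_erase hmin
    have hjI := hP.subset B hB hjB
    rw [Finset.mem_Ico] at hjI
    refine ⟨j, Finset.ext fun k => ?_⟩
    rw [Finset.mem_filter, Finset.mem_singleton, Finset.mem_Ico]
    constructor
    · rintro ⟨_, C, hC, haC, hkC, hak, hk⟩
      obtain rfl := hP.eq_of_mem B hB C hC a haB haC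
      exact le_antisymm (hk j hjB hja)
        (Finset.min'_le _ _ (Finset.mem_erase.2 ⟨hak.ne', hkC⟩))
    · rintro rfl
      exact ⟨by omega, B, hB, haB, hjB, by omega, fun x hx hxa =>
        Finset.min'_le _ _ (Finset.mem_erase.2 ⟨hxa, hx⟩)⟩
  have h2 : ∀ P ∈ (ncBlocks (Finset.Ico a b)).filter (fun P => {a} ∉ P), ∏ B ∈ P, f B =
      ∑ j ∈ (Finset.Ico (a + 1) b).filter (fun j => IsNextInBlock a j P), ∏ B ∈ P, f B := by
    intro P hP
    rw [Finset.mem_filter, mem_ncBlocks] at hP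
    obtain ⟨j, hj⟩ := hex P hP.1 hP.2
    rw [hj, Finset.sum_singleton]
  rw [Finset.sum_congr rfl h2]
  refine Finset.sum_comm' fun P j => ?_
  simp only [Finset.mem_filter, mem_ncBlocks]
  constructor
  · rintro ⟨⟨h, _⟩, h', h''⟩
    exact ⟨⟨h, h''⟩, h'⟩
  · rintro ⟨⟨h, h''⟩, h'⟩
    refine ⟨⟨h, fun hmem => ?_⟩, h', h''⟩
    obtain ⟨C, hC, haC, hjC, haj, -⟩ := h''
    rw [← h.eq_of_mem {a} hmem C hC a (by simp) haC, Finset.mem_singleton] at hjC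
    omega

open Classical in
/-- The passage from partitions of `Fin n` to sets of blocks in `ℕ`. -/
lemma sum_nonCrossingPartitions {R : Type*} [CommSemiring R] (n : ℕ) (κ : ℕ → R) :
    ∑ π ∈ nonCrossingPartitions n, ∏ B ∈ π.parts, κ B.card =
      ncSum (Finset.Ico 0 n) (fun B => κ B.card) := by
  rw [ncSum]
  let φ : Finset (Fin n) ↪ Finset ℕ := Finset.mapEmbedding Fin.valEmbedding |>.toEmbedding
  have hφ : ∀ B (x : ℕ), x ∈ φ B ↔ ∃ h : x < n, (⟨x, h⟩ : Fin n) ∈ B := by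
    intro B x
    change x ∈ B.map Fin.valEmbedding ↔ _
    rw [Finset.mem_map]
    constructor
    · rintro ⟨y, hy, rfl⟩; exact ⟨y.2, hy⟩
    · rintro ⟨h, hx⟩; exact ⟨_, hx, rfl⟩
  have hφ' : ∀ B (x : Fin n), (x : ℕ) ∈ φ B ↔ x ∈ B := fun B x => by simp [hφ]
  have hcard : ∀ B, (φ B).card = B.card := fun B => Finset.card_map _
  have hsurj : ∀ B ⊆ Finset.Ico 0 n, φ (Finset.univ.filter fun x : Fin n => (x : ℕ) ∈ B) = B := by
    intro B hB
    ext x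
    rw [hφ]
    constructor
    · rintro ⟨h, hx⟩; simpa using hx
    · intro hx
      have := hB hx
      rw [Finset.mem_Ico] at this
      exact ⟨this.2, by simpa using hx⟩
  refine Finset.sum_bij (fun π _ => π.parts.map φ) ?_ ?_ ?_ ?_
  · intro π hπ
    have hnc : IsNonCrossing π := (Finset.mem_filter.1 hπ).2
    rw [mem_ncBlocks]
    have hm : ∀ B, B ∈ π.parts.map φ ↔ ∃ C ∈ π.parts, φ C = B := by simp
    constructor
    · intro B hB
      obtain ⟨C, hC, rfl⟩ := (hm B).1 hB
      obtain ⟨x, hx⟩ := π.nonempty_of_mem_parts hC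
      exact ⟨x, (hφ' C x).2 hx⟩
    · intro B hB x hx
      obtain ⟨C, hC, rfl⟩ := (hm B).1 hB
      obtain ⟨h, _⟩ := (hφ C x).1 hx
      simpa using h
    · intro x hx
      rw [Finset.mem_Ico] at hx
      obtain ⟨C, hC, h⟩ := π.exists_mem (Finset.mem_univ (⟨x, hx.2⟩ : Fin n))
      exact ⟨φ C, (hm _).2 ⟨C, hC, rfl⟩, (hφ C x).2 ⟨hx.2, h⟩⟩
    · intro B hB C hC x hxB hxC
      rw [hm] at hB hC
      obtain ⟨B, hB, rfl⟩ := hB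
      obtain ⟨C, hC, rfl⟩ := hC
      obtain ⟨h, hxB⟩ := (hφ B x).1 hxB
      obtain ⟨_, hxC⟩ := (hφ C x).1 hxC
      rw [π.eq_of_mem_parts hB hC hxB hxC]
    · intro B hB C hC hne i j k l hij hjk hkl hi hk hj hl
      rw [hm] at hB hC
      obtain ⟨B, hB, rfl⟩ := hB
      obtain ⟨C, hC, rfl⟩ := hC
      obtain ⟨h1, hi⟩ := (hφ B i).1 hi
      obtain ⟨h2, hj⟩ := (hφ C j).1 hj
      obtain ⟨h3, hk⟩ := (hφ B k).1 hk
      obtain ⟨h4, hl⟩ := (hφ C l).1 hl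
      exact hnc B hB C hC (fun h => hne (by rw [h])) ⟨_, _, _, _, hij, hjk, hkl, hi, hk, hj, hl⟩
  · intro π _ π' _ h
    exact Finpartition.ext (Finset.map_injective φ h)
  · intro P hP
    rw [mem_ncBlocks] at hP
    let Q : Finset (Finset (Fin n)) := P.image fun B => Finset.univ.filter fun x : Fin n => (x : ℕ) ∈ B
    have hQ : Q.map φ = P := by
      rw [Finset.map_eq_image, Finset.image_image]
      conv_rhs => rw [← Finset.image_id (s := P)]
      exact Finset.image_congr fun B hB => hsurj B (hP.subset B hB)
    have hQm : ∀ B ∈ Q, φ B ∈ P := fun B hB => hQ ▸ Finset.mem_map_of_mem φ hB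
    have hQe : ∀ B ∈ Q, ∀ C ∈ Q, ∀ x, x ∈ B → x ∈ C → B = C := fun B hB C hC x hxB hxC =>
      φ.injective (hP.eq_of_mem _ (hQm B hB) _ (hQm C hC) x ((hφ' _ _).2 hxB) ((hφ' _ _).2 hxC))
    let π : Finpartition (Finset.univ : Finset (Fin n)) :=
      { parts := Q
        supIndep := by
          rw [Finset.supIndep_iff_pairwiseDisjoint]
          intro B hB C hC hne
          rw [Function.onFun, id, id, Finset.disjoint_left]
          exact fun x hxB hxC => hne (hQe B hB C hC x hxB hxC)
        sup_parts := by
          rw [Finset.eq_univ_iff_forall]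
          intro x
          obtain ⟨B, hB, hx⟩ := hP.cover x (by simp)
          rw [Finset.mem_sup]
          exact ⟨_, Finset.mem_image_of_mem _ hB, by simpa using hx⟩
        bot_notMem := by
          intro h
          obtain ⟨x, hx⟩ := hP.nonempty _ (hQm _ h)
          obtain ⟨_, hx⟩ := (hφ _ x).1 hx
          simp at hx }
    refine ⟨π, ?_, hQ⟩
    refine Finset.mem_filter.2 ⟨Finset.mem_univ _, ?_⟩
    rintro B hB C hC hne ⟨i, j, k, l, hij, hjk, hkl, hi, hk, hj, hl⟩
    exact hP.noncrossing _ (hQm B hB) _ (hQm C hC) (fun h => hne (φ.injective h)) i j k l hij hjk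
      hkl ((hφ' _ _).2 hi) ((hφ' _ _).2 hk) ((hφ' _ _).2 hj) ((hφ' _ _).2 hl)
  · intro π _
    rw [Finset.prod_map]
    simp [hcard]

/-- The weight `κ_{|B|}` of a block, with index raised by `k` on the block that contains `a`. -/
def shiftedWeight {R : Type*} (κ : ℕ → R) (k a : ℕ) (B : Finset ℕ) : R :=
  if a ∈ B then κ (B.card + k) else κ B.card

lemma shiftedWeight_zero {R : Type*} (κ : ℕ → R) (a : ℕ) :
    shiftedWeight κ 0 a = fun B => κ B.card := by
  funext B; simp [shiftedWeight]

/-- The sum over the non-crossing partitions of an `n`-element chain of the products of the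
weights `κ_{|B|}`, where the index of the block of the first element is raised by `k`. -/
noncomputable def shiftedMoment {R : Type*} [CommSemiring R] (κ : ℕ → R) (k n : ℕ) : R :=
  ncSum (Finset.Ico 0 n) (shiftedWeight κ k 0)

lemma shiftedMoment_zero_right {R : Type*} [CommSemiring R] (κ : ℕ → R) (k : ℕ) :
    shiftedMoment κ k 0 = 1 := by
  simp [shiftedMoment, ncSum_empty]

/-- In the recursion `ncSum_Ico` the cut at the successor of `a` removes one point from the block of
`a`, which raises the shift by one. -/
lemma ncSum_shiftedWeight {R : Type*} [CommSemiring R] (κ : ℕ → R) (k a n : ℕ) :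
    ncSum (Finset.Ico a (a + (n + 1))) (shiftedWeight κ k a) =
      κ (k + 1) * ncSum (Finset.Ico (a + 1) (a + 1 + n)) (shiftedWeight κ 0 (a + 1)) +
      ∑ i ∈ Finset.range n, ncSum (Finset.Ico (a + 1) (a + 1 + i)) (shiftedWeight κ 0 (a + 1)) *
        ncSum (Finset.Ico (a + 1 + i) (a + 1 + i + (n - i))) (shiftedWeight κ (k + 1) (a + 1 + i)) := by
  have h0 : ∀ b, ncSum (Finset.Ico (a + 1) b) (shiftedWeight κ k a) =
      ncSum (Finset.Ico (a + 1) b) (shiftedWeight κ 0 (a + 1)) := by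
    intro b
    refine ncSum_congr fun B hB => ?_
    have : a ∉ B := fun h => by simpa using hB h
    simp [shiftedWeight, this]
  rw [ncSum_Ico (by omega), Finset.sum_Ico_eq_sum_range, h0]
  congr 1
  · simp [shiftedWeight, add_comm, add_left_comm]
  · rw [show a + (n + 1) - (a + 1) = n by omega]
    refine Finset.sum_congr rfl fun i hi => ?_
    rw [Finset.mem_range] at hi
    rw [h0, show a + 1 + i + (n - i) = a + (n + 1) by omega]
    congr 1
    refine ncSum_congr fun B hB => ?_
    have : a ∉ B := fun h => by have := hB h; simp only [Finset.mem_Ico] at this; omega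
    by_cases hj : a + 1 + i ∈ B
    · have e : B.card + 1 + k = B.card + (k + 1) := by ring
      simp [shiftedWeight, attach, hj, this, e]
    · simp [shiftedWeight, attach, hj, this]

/-- Translation invariance, by induction along the recursion. -/
lemma ncSum_Ico_shift {R : Type*} [CommSemiring R] (κ : ℕ → R) (n : ℕ) :
    ∀ k a, ncSum (Finset.Ico a (a + n)) (shiftedWeight κ k a) = shiftedMoment κ k n := by
  induction n using Nat.strong_induction_on with
  | _ n ih =>
    intro k a
    rcases n with _ | n
    · simp [shiftedMoment, ncSum_empty]
    · have h0 := ncSum_shiftedWeight κ k 0 n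
      simp only [Nat.zero_add] at h0
      rw [shiftedMoment, h0, ncSum_shiftedWeight, ih n (by omega), ih n (by omega)]
      congr 1
      refine Finset.sum_congr rfl fun i hi => ?_
      rw [Finset.mem_range] at hi
      rw [ih i (by omega), ih i (by omega), ih (n - i) (by omega), ih (n - i) (by omega)]

lemma shiftedMoment_succ {R : Type*} [CommSemiring R] (κ : ℕ → R) (k n : ℕ) :
    shiftedMoment κ k (n + 1) = κ (k + 1) * shiftedMoment κ 0 n +
      ∑ i ∈ Finset.range n, shiftedMoment κ 0 i * shiftedMoment κ (k + 1) (n - i) := by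
  have h0 := ncSum_shiftedWeight κ k 0 n
  simp only [ncSum_Ico_shift] at h0
  simpa [shiftedMoment] using h0

/-! ### The functional equation of the moment and cumulant series -/

namespace PowerSeries

lemma subst_injective {R : Type*} [CommRing R] {f : R⟦X⟧} (h0 : constantCoeff f = 0)
    (h1 : IsUnit (coeff 1 f)) : Function.Injective (fun g : R⟦X⟧ => g.subst f) := by
  intro g h hgh
  let := h1.invertible
  have hf : HasSubst f := HasSubst.of_constantCoeff_zero' h0
  have key : ∀ g : R⟦X⟧, PowerSeries.subst f.substInv (g.subst f) = g := by
    intro g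
    rw [subst_comp_subst_apply hf (HasSubst.substInv (P := f)), subst_substInv_right, X_subst]
    exact h0
  have := congrArg (fun g : R⟦X⟧ => PowerSeries.subst f.substInv g) hgh
  simpa only [key] using this

/-- Apply a linear functional to all coefficients. -/
noncomputable def mapLinear {A : Type*} [Ring A] [Algebra ℂ A] (L : A →ₗ[ℂ] ℂ) (f : A⟦X⟧) : ℂ⟦X⟧ :=
  mk fun n => L (coeff n f)

lemma mapLinear_map_mul {A : Type*} [Ring A] [Algebra ℂ A] (L : A →ₗ[ℂ] ℂ) (g : ℂ⟦X⟧) (f : A⟦X⟧) :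
    mapLinear L (map (algebraMap ℂ A) g * f) = g * mapLinear L f := by
  ext n
  simp only [mapLinear, coeff_mk, coeff_mul, coeff_map, map_sum]
  refine Finset.sum_congr rfl fun p _ => ?_
  rw [← Algebra.smul_def, map_smul, smul_eq_mul]

lemma mapLinear_subst {A : Type*} [CommRing A] [Algebra ℂ A] (L : A →ₗ[ℂ] ℂ) {g : ℂ⟦X⟧}
    (hg : constantCoeff g = 0) (f : A⟦X⟧) :
    mapLinear L (f.subst (map (algebraMap ℂ A) g)) = (mapLinear L f).subst g := by
  have hs : HasSubst g := HasSubst.of_constantCoeff_zero' hg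
  have hs' : HasSubst (map (algebraMap ℂ A) g) :=
    HasSubst.of_constantCoeff_zero' (by
      rw [← coeff_zero_eq_constantCoeff_apply, coeff_map, coeff_zero_eq_constantCoeff_apply, hg,
        map_zero])
  ext n
  rw [mapLinear, coeff_mk, coeff_subst' hs', coeff_subst' hs]
  have := L.toAddMonoidHom.map_finsum (coeff_subst_finite' hs' f n)
  simp only [LinearMap.toAddMonoidHom_coe] at this
  rw [this]
  refine finsum_congr fun d => ?_
  rw [← map_pow, coeff_map, smul_eq_mul, mul_comm, ← Algebra.smul_def, map_smul, mapLinear,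
    coeff_mk, smul_eq_mul, smul_eq_mul, mul_comm]

end PowerSeries

open PowerSeries in
/-- The functional equation `M(z) = C(z M(z))` between the generating function of the sums over
non-crossing partitions and the generating function `C(w) = 1 + ∑ κ_n wⁿ` of the weights. -/
theorem mk_shiftedMoment_eq_subst {R : Type*} [CommRing R] (κ : ℕ → R) :
    PowerSeries.mk (shiftedMoment κ 0) =
      (PowerSeries.mk fun n => if n = 0 then 1 else κ n).subst
        (PowerSeries.X * PowerSeries.mk (shiftedMoment κ 0)) := by
  set M := PowerSeries.mk (shiftedMoment κ 0) with hM
  set F : ℕ → R⟦X⟧ := fun k => PowerSeries.mk fun n => shiftedMoment κ k (n + 1) with hF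
  set D : ℕ → R⟦X⟧ := fun k => PowerSeries.mk fun n => κ (k + n + 1) with hD
  have hs : HasSubst (X * M) := HasSubst.of_constantCoeff_zero' (by simp)
  have hMF : M = 1 + X * F 0 := by
    ext n
    rcases n with _ | n
    · simp [hM, shiftedMoment_zero_right]
    · simp [hM, hF, coeff_succ_X_mul, coeff_one]
  have hFrec : ∀ k, F k = C (κ (k + 1)) * M + X * M * F (k + 1) := by
    intro k
    ext n
    simp only [hF, hM, coeff_mk, map_add, coeff_C_mul, mul_assoc]
    rw [shiftedMoment_succ]
    congr 1
    rcases n with _ | n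
    · simp
    · rw [coeff_succ_X_mul, coeff_mul, Finset.Nat.sum_antidiagonal_eq_sum_range_succ_mk]
      refine Finset.sum_congr rfl fun i hi => ?_
      rw [Finset.mem_range] at hi
      simp only [coeff_mk]
      rw [show n - i + 1 = n + 1 - i by omega]
  have hDrec : ∀ k, D k = C (κ (k + 1)) + X * D (k + 1) := by
    intro k
    ext n
    rcases n with _ | n
    · simp [hD]
    · simp only [hD, coeff_mk, map_add, coeff_succ_X_mul, coeff_C]
      simp [show k + (n + 1) + 1 = k + 1 + n + 1 by omega]
  have hDs : ∀ k, (D k).subst (X * M) = C (κ (k + 1)) + X * M * (D (k + 1)).subst (X * M) := by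
    intro k
    conv_lhs => rw [hDrec k]
    rw [subst_add hs, subst_mul hs, subst_X hs]
    congr 1
    exact subst_C _
  -- both `F k` and `M · D_k(zM)` solve the recursion `E k = κ_{k+1} M + z M E (k + 1)`
  have hdvd : ∀ n k, X ^ n ∣ F k - M * (D k).subst (X * M) := by
    intro n
    induction n with
    | zero => intro k; simp
    | succ n ih =>
      intro k
      obtain ⟨q, hq⟩ := ih (k + 1)
      refine ⟨M * q, ?_⟩
      rw [hFrec k, hDs k, pow_succ]
      linear_combination (X * M) * hq
  have heq : F 0 = M * (D 0).subst (X * M) := by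
    rw [← sub_eq_zero]
    ext n
    exact X_pow_dvd_iff.1 (hdvd (n + 1) 0) n (by omega)
  have hC : (PowerSeries.mk fun n => if n = 0 then (1 : R) else κ n) = 1 + X * D 0 := by
    ext n
    rcases n with _ | n
    · simp
    · simp [hD, coeff_succ_X_mul, coeff_one]
  rw [hC, subst_add hs, subst_mul hs, subst_X hs, mul_assoc, ← heq]
  conv_lhs => rw [hMF]
  congr 1
  rw [← coe_substAlgHom hs, map_one]

/-- The generating function `∑ m_n zⁿ`. -/
noncomputable def momentSeries (m : ℕ → ℝ) : PowerSeries ℂ := PowerSeries.mk fun n => (m n : ℂ)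

/-- The generating function `1 + ∑_{n ≥ 1} κ_n wⁿ` of the free cumulants of `m`. -/
noncomputable def cumulantSeries (m : ℕ → ℝ) : PowerSeries ℂ :=
  PowerSeries.mk fun n => if n = 0 then 1 else (freeCumulant m n : ℂ)

lemma constantCoeff_cumulantSeries (m : ℕ → ℝ) :
    PowerSeries.constantCoeff (cumulantSeries m) = 1 := by
  simp [cumulantSeries]

lemma coeff_cumulantSeries (m : ℕ → ℝ) {n : ℕ} (hn : 1 ≤ n) :
    PowerSeries.coeff n (cumulantSeries m) = freeCumulant m n := by
  simp [cumulantSeries, Nat.one_le_iff_ne_zero.1 hn]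

lemma eq_shiftedMoment_freeCumulant {m : ℕ → ℝ} (h0 : m 0 = 1) :
    m = shiftedMoment (freeCumulant m) 0 := by
  funext n
  rcases n with _ | n
  · rw [h0, shiftedMoment_zero_right]
  · rw [moment_eq_sum_freeCumulant m (n + 1) (by omega), sum_nonCrossingPartitions, shiftedMoment,
      shiftedWeight_zero]

open PowerSeries in
/-- The functional equation `M(z) = C(z M(z))` of the moment series and the cumulant series. -/
theorem momentSeries_eq_subst {m : ℕ → ℝ} (h0 : m 0 = 1) :
    momentSeries m = (cumulantSeries m).subst (PowerSeries.X * momentSeries m) := by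
  have h := mk_shiftedMoment_eq_subst (freeCumulant m)
  rw [← eq_shiftedMoment_freeCumulant h0] at h
  have hs : HasSubst (X * PowerSeries.mk m) := HasSubst.of_constantCoeff_zero' (by simp)
  have e1 : map Complex.ofRealHom (PowerSeries.mk m) = momentSeries m := by
    ext n; simp [momentSeries]
  have e2 : map Complex.ofRealHom (PowerSeries.mk fun n => if n = 0 then 1 else freeCumulant m n)
      = cumulantSeries m := by
    ext n
    simp only [cumulantSeries, coeff_map, coeff_mk]
    split_ifs <;> simp
  have h2 := congrArg (PowerSeries.map Complex.ofRealHom) h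
  have h3 := PowerSeries.map_subst hs (h := Complex.ofRealHom)
    (PowerSeries.mk fun n => if n = 0 then 1 else freeCumulant m n)
  rw [h2] at e1
  rw [← e1, ← e2]
  refine h3.trans ?_
  congr 1
  conv_rhs => rw [← h2]
  have e3 : PowerSeries.map Complex.ofRealHom (X * PowerSeries.mk m) =
      X * PowerSeries.map Complex.ofRealHom (PowerSeries.mk m) := by rw [map_mul, map_X]
  exact e3

open PowerSeries in
/-- The series `z M(z) = z + ⋯` has a compositional inverse. -/
lemma subst_X_mul_momentSeries_injective {m : ℕ → ℝ} (h0 : m 0 = 1) :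
    Function.Injective (fun g : PowerSeries ℂ => g.subst (PowerSeries.X * momentSeries m)) := by
  refine subst_injective (by simp) ?_
  rw [show (1 : ℕ) = 0 + 1 from rfl, coeff_succ_X_mul]
  simp [momentSeries, h0]

open PowerSeries in
/-- The functional equation `M(z) = C(z M(z))` determines the cumulant series. -/
theorem cumulantSeries_eq_of_subst {m : ℕ → ℝ} (h0 : m 0 = 1) {D : PowerSeries ℂ}
    (h : momentSeries m = D.subst (PowerSeries.X * momentSeries m)) : cumulantSeries m = D :=
  subst_X_mul_momentSeries_injective h0 ((momentSeries_eq_subst h0).symm.trans h)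

theorem moments_eq_of_freeCumulant_eq {m m' : ℕ → ℝ} (h0 : m 0 = 1) (h0' : m' 0 = 1)
    (h : ∀ n, 1 ≤ n → freeCumulant m n = freeCumulant m' n) : m = m' := by
  funext n
  rcases n with _ | n
  · rw [h0, h0']
  · rw [moment_eq_sum_freeCumulant m _ (by omega), moment_eq_sum_freeCumulant m' _ (by omega)]
    refine Finset.sum_congr rfl fun π _ => Finset.prod_congr rfl fun B hB => ?_
    exact h _ (Finset.card_pos.2 (π.nonempty_of_mem_parts hB))

/-! ### The resolvent as a formal power series -/

open PowerSeries in
/-- The formal power series `C(w) - w x` with coefficients in `ℂ[x]`. -/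
noncomputable def resolventDenom (D : PowerSeries ℂ) : PowerSeries (Polynomial ℂ) :=
  PowerSeries.map (algebraMap ℂ (Polynomial ℂ)) D - PowerSeries.X * PowerSeries.C Polynomial.X

/-- The formal resolvent `(C(w) - w x)⁻¹`. -/
noncomputable def resolventSeries (D : PowerSeries ℂ) : PowerSeries (Polynomial ℂ) :=
  PowerSeries.invOfUnit (resolventDenom D) 1

lemma constantCoeff_resolventDenom {D : PowerSeries ℂ} (hD : PowerSeries.constantCoeff D = 1) :
    PowerSeries.constantCoeff (resolventDenom D) = 1 := by
  rw [resolventDenom, map_sub, map_mul, PowerSeries.constantCoeff_X, zero_mul, sub_zero,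
    ← PowerSeries.coeff_zero_eq_constantCoeff_apply, PowerSeries.coeff_map,
    PowerSeries.coeff_zero_eq_constantCoeff_apply, hD, map_one]

lemma resolventDenom_mul_resolventSeries {D : PowerSeries ℂ}
    (hD : PowerSeries.constantCoeff D = 1) : resolventDenom D * resolventSeries D = 1 :=
  PowerSeries.mul_invOfUnit _ _ (by simpa using constantCoeff_resolventDenom hD)

lemma constantCoeff_resolventSeries (D : PowerSeries ℂ) :
    PowerSeries.constantCoeff (resolventSeries D) = 1 := by
  simp [resolventSeries]

open PowerSeries in
/-- If `L(xⁿ) = m_n` and `C` is the cumulant series of `m`, then `L((C(w) - w x)⁻¹) = 1`.  Under the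
substitution `w = z M(z)` the resolvent turns into `M(z)⁻¹ (1 - z x)⁻¹`. -/
theorem mapLinear_resolventSeries {m : ℕ → ℝ} (h0 : m 0 = 1) (L : Polynomial ℂ →ₗ[ℂ] ℂ)
    (hL : ∀ n, L (Polynomial.X ^ n) = m n) :
    mapLinear L (resolventSeries (cumulantSeries m)) = 1 := by
  set D := cumulantSeries m with hD
  set M := momentSeries m with hM
  set ι := algebraMap ℂ (Polynomial ℂ) with hι
  have hc : constantCoeff (X * M) = 0 := by simp
  have hs : HasSubst (X * M) := HasSubst.of_constantCoeff_zero' hc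
  have hs' : HasSubst (map ι (X * M)) := by
    refine HasSubst.of_constantCoeff_zero' ?_
    rw [map_mul, map_X, map_mul, constantCoeff_X, zero_mul]
  apply subst_X_mul_momentSeries_injective h0
  dsimp only
  rw [← hM, ← mapLinear_subst L hc, ← coe_substAlgHom hs, map_one]
  have hMne : M ≠ 0 := by
    intro h
    have := congrArg constantCoeff h
    simp [hM, momentSeries, h0] at this
  apply mul_left_cancel₀ hMne
  rw [← mapLinear_map_mul, mul_one]
  have hDs : (map ι D).subst (map ι (X * M)) = map ι M := by
    have h3 := PowerSeries.map_subst hs (h := ι) D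
    have h4 := momentSeries_eq_subst h0
    rw [← hM, ← hD] at h4
    rw [← h4] at h3
    exact h3.symm
  have hden : (resolventDenom D).subst (map ι (X * M)) =
      map ι M * (1 - X * C Polynomial.X) := by
    rw [resolventDenom, subst_sub hs', subst_mul hs', subst_X hs', hDs]
    have : (C (Polynomial.X : Polynomial ℂ)).subst (map ι (X * M)) = C (Polynomial.X : Polynomial ℂ) :=
      subst_C _
    rw [this, map_mul, map_X]
    ring
  have hgeo : (1 - X * C (Polynomial.X : Polynomial ℂ)) *
      PowerSeries.mk (fun n => (Polynomial.X : Polynomial ℂ) ^ n) = 1 := by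
    ext n
    rw [sub_mul, one_mul, map_sub, mul_assoc]
    rcases n with _ | n
    · simp
    · rw [coeff_succ_X_mul, coeff_C_mul, coeff_mk, coeff_mk, coeff_one, pow_succ']
      simp
  have h1 : map ι M * (1 - X * C Polynomial.X) *
      (resolventSeries D).subst (map ι (X * M)) = 1 := by
    rw [← hden, ← subst_mul hs',
      resolventDenom_mul_resolventSeries (constantCoeff_cumulantSeries m),
      ← coe_substAlgHom hs', map_one]
  have h2 : map ι M * (resolventSeries D).subst (map ι (X * M)) =
      PowerSeries.mk (fun n => (Polynomial.X : Polynomial ℂ) ^ n) := by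
    linear_combination (PowerSeries.mk (fun n => (Polynomial.X : Polynomial ℂ) ^ n)) * h1 -
      (map ι M * (resolventSeries D).subst (map ι (X * M))) * hgeo
  rw [h2]
  ext n
  simp [mapLinear, hM, momentSeries, hL]

open PowerSeries in
/-- The series `C` is determined by `L((C(w) - w x)⁻¹) = 1`. -/
theorem eq_of_mapLinear_resolventSeries {L : Polynomial ℂ →ₗ[ℂ] ℂ} (hL : L 1 = 1)
    {D D' : PowerSeries ℂ} (hD : constantCoeff D = 1) (hD' : constantCoeff D' = 1)
    (h : mapLinear L (resolventSeries D) = 1) (h' : mapLinear L (resolventSeries D') = 1) :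
    D = D' := by
  have key : resolventSeries D - resolventSeries D' =
      resolventSeries D * resolventSeries D' * map (algebraMap ℂ (Polynomial ℂ)) (D' - D) := by
    have e1 := resolventDenom_mul_resolventSeries hD
    have e2 := resolventDenom_mul_resolventSeries hD'
    rw [resolventDenom] at e1 e2
    rw [map_sub]
    linear_combination resolventSeries D' * e1 - resolventSeries D * e2
  have hz : ∀ n, coeff n (D' - D) = 0 := by
    intro n
    induction n using Nat.strong_induction_on with
    | _ n ih =>
      have h1 := congrArg (coeff n) key
      rw [coeff_mul, Finset.sum_eq_single (0, n)] at h1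
      · have h2 := congrArg L h1
        have h3 := congrArg (coeff n) (h.trans h'.symm)
        simp only [mapLinear, coeff_mk] at h3
        dsimp only at h2
        rw [map_sub, map_sub, h3, sub_self, coeff_zero_eq_constantCoeff_apply,
          map_mul constantCoeff,
          constantCoeff_resolventSeries, constantCoeff_resolventSeries, one_mul, one_mul, coeff_map,
          Algebra.algebraMap_eq_smul_one, map_smul, hL, smul_eq_mul, mul_one] at h2
        exact h2.symm
      · rintro ⟨i, j⟩ hij hne
        rw [Finset.HasAntidiagonal.mem_antidiagonal] at hij
        have : j < n := by
          rcases Nat.eq_zero_or_pos i with hi | hi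
          · exact absurd (by simp at hij; simp [hi] ; omega) hne
          · simp at hij; omega
        dsimp only
        rw [coeff_map, ih j this, map_zero, mul_zero]
      · intro h; exact absurd (by simp) h
  have : D' - D = 0 := by ext n; simpa using hz n
  exact (sub_eq_zero.1 this).symm

/-! ### Additivity of free cumulants -/

section Freeness

variable {A : Type*} [Ring A] [Algebra ℂ A]

/-- The span of the alternating products of centered polynomials in `X` and in `Y`, the leftmost
factor being a polynomial in `X` if `i = true` and in `Y` if `i = false`. -/
noncomputable def altSpan (τ : A →ₗ[ℂ] ℂ) (X Y : A) (i : Bool) : Submodule ℂ A :=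
  Submodule.span ℂ {x | ∃ (p : Polynomial ℂ) (l : List (Bool × Polynomial ℂ)),
    ((i, p) :: l).IsChain (fun p q => p.1 ≠ q.1) ∧
    (∀ q ∈ (i, p) :: l, τ (Polynomial.aeval (if q.1 then X else Y) q.2) = 0) ∧
    x = (((i, p) :: l).map fun q => Polynomial.aeval (if q.1 then X else Y) q.2).prod}

lemma FreelyIndependent.apply_altSpan {τ : A →ₗ[ℂ] ℂ} {X Y : A} (h : FreelyIndependent τ X Y)
    {i : Bool} {x : A} (hx : x ∈ altSpan τ X Y i) : τ x = 0 := by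
  induction hx using Submodule.span_induction with
  | mem x hx =>
    obtain ⟨p, l, hc, h0, rfl⟩ := hx
    exact h _ (by simp) hc h0
  | zero => simp
  | add x y _ _ hx hy => rw [map_add, hx, hy, add_zero]
  | smul c x _ hx => rw [map_smul, hx, smul_zero]

lemma aeval_mem_altSpan {τ : A →ₗ[ℂ] ℂ} {X Y : A} {i : Bool} {p : Polynomial ℂ}
    (hp : τ (Polynomial.aeval (if i then X else Y) p) = 0) :
    Polynomial.aeval (if i then X else Y) p ∈ altSpan τ X Y i :=
  Submodule.subset_span ⟨p, [], by simp, by simpa using hp, by simp⟩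

lemma aeval_mul_mem_altSpan {τ : A →ₗ[ℂ] ℂ} {X Y : A} {i : Bool} {p : Polynomial ℂ}
    (hp : τ (Polynomial.aeval (if i then X else Y) p) = 0) {x : A} (hx : x ∈ altSpan τ X Y (!i)) :
    Polynomial.aeval (if i then X else Y) p * x ∈ altSpan τ X Y i := by
  induction hx using Submodule.span_induction with
  | mem x hx =>
    obtain ⟨q, l, hc, h0, rfl⟩ := hx
    refine Submodule.subset_span ⟨p, (!i, q) :: l, ?_, ?_, by simp⟩
    · rw [List.isChain_cons_cons]
      exact ⟨by simp, hc⟩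
    · intro r hr
      rcases List.mem_cons.1 hr with rfl | hr
      · exact hp
      · exact h0 r hr
  | zero => simp
  | add x y _ _ hx hy => rw [mul_add]; exact add_mem hx hy
  | smul c x _ hx => rw [mul_smul_comm]; exact Submodule.smul_mem _ _ hx

open PowerSeries

/-- Left multiplication by a series with centered coefficients in one variable maps `1 + f`, with
the coefficients of `f` in the alternating products that start with the other variable, to
alternating products. -/
lemma coeff_mul_mem_altSpan {τ : A →ₗ[ℂ] ℂ} {X Y : A} (i : Bool) (a v : A⟦X⟧) (n : ℕ)
    (ha : ∀ n, ∃ p : Polynomial ℂ, coeff n a = Polynomial.aeval (if i then X else Y) p)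
    (hτ : ∀ n, τ (coeff n a) = 0)
    (hv : ∀ k ≤ n, coeff k a = 0 ∨ coeff (n - k) v - coeff (n - k) 1 ∈ altSpan τ X Y (!i)) :
    coeff n (a * v) ∈ altSpan τ X Y i := by
  have h1 : ∀ k, coeff k a ∈ altSpan τ X Y i := by
    intro k
    obtain ⟨p, hp⟩ := ha k
    rw [hp]
    exact aeval_mem_altSpan (hp ▸ hτ k)
  have e : a * v = a + a * (v - 1) := by rw [mul_sub, mul_one]; abel
  rw [e, map_add, coeff_mul]
  refine add_mem (h1 n) (Submodule.sum_mem _ ?_)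
  rintro ⟨k, l⟩ hkl
  rw [Finset.HasAntidiagonal.mem_antidiagonal] at hkl
  dsimp only at hkl ⊢
  obtain rfl : l = n - k := by omega
  rcases hv k (by omega) with h | h
  · rw [h, zero_mul]; exact zero_mem _
  · obtain ⟨p, hp⟩ := ha k
    rw [hp, map_sub]
    exact aeval_mul_mem_altSpan (hp ▸ hτ k) h

lemma map_aeval_resolventDenom (D : ℂ⟦X⟧) (S : A) :
    map (Polynomial.aeval S : Polynomial ℂ →ₐ[ℂ] A).toRingHom (resolventDenom D) =
      map (algebraMap ℂ A) D - PowerSeries.X * PowerSeries.C S := by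
  rw [resolventDenom, map_sub, map_mul, map_X, map_C, ← RingHom.comp_apply, ← map_comp]
  congr 3
  · ext x; simp
  · simp

/-- For free `X` and `Y` the formal resolvent of `X + Y` with denominator
`C_X(w) + C_Y(w) - 1 - w (X + Y)` has expectation `1`.  With `a = 1 - (C_X - w X)⁻¹` and
`b = 1 - (C_Y - w Y)⁻¹` this denominator factors as `(1 - a)⁻¹ (1 - a b) (1 - b)⁻¹`, so the resolvent
is `(1 - b) (∑ (a b)ⁿ) (1 - a)`, a sum of `1` and of alternating products of centered elements. -/
theorem FreelyIndependent.mapLinear_resolventSeries_add {τ : A →ₗ[ℂ] ℂ} {X Y : A} (h1 : τ 1 = 1)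
    (h : FreelyIndependent τ X Y) {D₁ D₂ : ℂ⟦X⟧} (hD₁ : constantCoeff D₁ = 1)
    (hD₂ : constantCoeff D₂ = 1)
    (hX : mapLinear (τ ∘ₗ (Polynomial.aeval X).toLinearMap) (resolventSeries D₁) = 1)
    (hY : mapLinear (τ ∘ₗ (Polynomial.aeval Y).toLinearMap) (resolventSeries D₂) = 1) :
    mapLinear (τ ∘ₗ (Polynomial.aeval (X + Y)).toLinearMap) (resolventSeries (D₁ + D₂ - 1)) = 1 := by
  let φ : A → (Polynomial ℂ)⟦X⟧ →+* A⟦X⟧ := fun S =>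
    map (Polynomial.aeval S : Polynomial ℂ →ₐ[ℂ] A).toRingHom
  have hφc : ∀ S f n, coeff n (φ S f) = Polynomial.aeval S (coeff n f) := fun S f n => by
    simp [φ]
  have hden : ∀ D S, φ S (resolventDenom D) =
      map (algebraMap ℂ A) D - PowerSeries.X * PowerSeries.C S := map_aeval_resolventDenom
  have hinv : ∀ D S, constantCoeff D = 1 →
      φ S (resolventDenom D) * φ S (resolventSeries D) = 1 := fun D S hD => by
    rw [← map_mul, resolventDenom_mul_resolventSeries hD, map_one]
  have hinv' : ∀ D S, constantCoeff D = 1 →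
      φ S (resolventSeries D) * φ S (resolventDenom D) = 1 := fun D S hD => by
    rw [← map_mul, mul_comm, resolventDenom_mul_resolventSeries hD, map_one]
  set r₁ := φ X (resolventSeries D₁) with hr₁
  set r₂ := φ Y (resolventSeries D₂) with hr₂
  set p₁ := φ X (resolventDenom D₁) with hp₁
  set p₂ := φ Y (resolventDenom D₂) with hp₂
  set a : A⟦X⟧ := 1 - r₁ with ha
  set b : A⟦X⟧ := 1 - r₂ with hb
  have hac : ∀ n, ∃ p : Polynomial ℂ, coeff n a = Polynomial.aeval (if true then X else Y) p := by
    intro n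
    refine ⟨coeff n (1 - resolventSeries D₁), ?_⟩
    rw [ha, hr₁, ← map_one (φ X), ← map_sub, hφc]
    rfl
  have hbc : ∀ n, ∃ p : Polynomial ℂ, coeff n b = Polynomial.aeval (if false then X else Y) p := by
    intro n
    refine ⟨coeff n (1 - resolventSeries D₂), ?_⟩
    rw [hb, hr₂, ← map_one (φ Y), ← map_sub, hφc]
    rfl
  have hone : ∀ n, τ (coeff n (1 : A⟦X⟧)) = coeff n (1 : ℂ⟦X⟧) := by
    intro n
    rw [coeff_one, coeff_one]
    split_ifs <;> simp [h1]
  have haτ : ∀ n, τ (coeff n a) = 0 := by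
    intro n
    have := congrArg (coeff n) hX
    simp only [mapLinear, coeff_mk, LinearMap.comp_apply, AlgHom.toLinearMap_apply] at this
    rw [ha, map_sub, map_sub, hone, hr₁, hφc, this, sub_self]
  have hbτ : ∀ n, τ (coeff n b) = 0 := by
    intro n
    have := congrArg (coeff n) hY
    simp only [mapLinear, coeff_mk, LinearMap.comp_apply, AlgHom.toLinearMap_apply] at this
    rw [hb, map_sub, map_sub, hone, hr₂, hφc, this, sub_self]
  have ha0 : coeff 0 a = 0 := by
    rw [ha, map_sub, hr₁, hφc, coeff_zero_eq_constantCoeff_apply (resolventSeries D₁),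
      constantCoeff_resolventSeries]
    simp
  set u : A⟦X⟧ := invOfUnit (1 - a * b) 1 with hu
  have hu1 : (1 - a * b) * u = 1 := by
    refine mul_invOfUnit _ _ ?_
    rw [← coeff_zero_eq_constantCoeff_apply, map_sub, coeff_mul]
    simp [ha0]
  -- the coefficients of `v - 1` are alternating and start with `X`, those of `b v` start with `Y`
  set v : A⟦X⟧ := u * r₁ with hv
  have hv1 : (1 - a * b) * v = r₁ := by rw [hv, ← mul_assoc, hu1, one_mul]
  have hv2 : v = 1 - a + a * (b * v) := by
    have : 1 - a = r₁ := by rw [ha]; abel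
    rw [this, ← hv1, sub_mul, one_mul, mul_assoc]; abel
  have hbv : ∀ n, (∀ k ≤ n, coeff k v - coeff k 1 ∈ altSpan τ X Y true) →
      coeff n (b * v) ∈ altSpan τ X Y false := by
    intro n hn
    exact coeff_mul_mem_altSpan false b v n hbc hbτ fun k hk => Or.inr (hn _ (by omega))
  have hvn : ∀ n, coeff n v - coeff n 1 ∈ altSpan τ X Y true := by
    intro n
    induction n using Nat.strong_induction_on with
    | _ n ih =>
      have e : coeff n v - coeff n 1 = coeff n (a * (b * v - 1)) := by
        have := congrArg (coeff n) hv2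
        rw [this, ← map_sub]
        congr 1
        noncomm_ring
      have e2 : a * (b * v - 1) = -(a * (1 - b * v)) := by noncomm_ring
      rw [e, e2, map_neg]
      refine Submodule.neg_mem _ (coeff_mul_mem_altSpan true a _ n hac haτ fun k hk => ?_)
      rcases Nat.eq_zero_or_pos k with rfl | hk0
      · exact Or.inl ha0
      · right
        rw [map_sub, sub_sub_cancel_left]
        exact Submodule.neg_mem _ (hbv _ fun l hl => ih l (by omega))
  set R : A⟦X⟧ := r₂ * v with hR
  have hRτ : ∀ n, τ (coeff n R) = coeff n (1 : ℂ⟦X⟧) := by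
    intro n
    have e : R = 1 + (v - 1) - b * v := by rw [hR, hb]; noncomm_ring
    rw [e, map_sub, map_add, map_sub (coeff n) v, map_sub, map_add, h.apply_altSpan (hvn n),
      h.apply_altSpan (hbv n fun k _ => hvn k), hone, add_zero, sub_zero]
  have hD : constantCoeff (D₁ + D₂ - 1) = 1 := by simp [hD₁, hD₂]
  have hp : φ (X + Y) (resolventDenom (D₁ + D₂ - 1)) = p₁ + p₂ - 1 := by
    rw [hden, hp₁, hp₂, hden, hden, map_sub, map_add, map_one, map_add]
    noncomm_ring
  have hpR : φ (X + Y) (resolventDenom (D₁ + D₂ - 1)) * R = 1 := by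
    have e1 : p₁ + p₂ - 1 = p₁ * (1 - a * b) * p₂ := by
      have h3 : p₁ * r₁ = 1 := hinv D₁ X hD₁
      have h4 : r₂ * p₂ = 1 := hinv' D₂ Y hD₂
      have h5 : p₁ * a = p₁ - 1 := by rw [ha, mul_sub, mul_one, h3]
      have h6 : b * p₂ = p₂ - 1 := by rw [hb, sub_mul, one_mul, h4]
      have : p₁ * (1 - a * b) * p₂ = p₁ * p₂ - (p₁ * a) * (b * p₂) := by noncomm_ring
      rw [this, h5, h6]
      noncomm_ring
    rw [hp, e1, hR, mul_assoc, ← mul_assoc p₂, hinv D₂ Y hD₂, one_mul, mul_assoc, hv1,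
      hinv D₁ X hD₁]
  have hRe : φ (X + Y) (resolventSeries (D₁ + D₂ - 1)) = R :=
    left_inv_eq_right_inv (hinv' _ _ hD) hpR
  ext n
  rw [mapLinear, coeff_mk, LinearMap.comp_apply, AlgHom.toLinearMap_apply, ← hφc, hRe, hRτ]

/-- Free cumulants are additive: `C_X + C_Y - 1` satisfies the equation that determines `C_{X+Y}`. -/
theorem FreelyIndependent.freeCumulant_add {τ : A →ₗ[ℂ] ℂ} {X Y : A} (h1 : τ 1 = 1)
    (h : FreelyIndependent τ X Y) {m₁ m₂ m : ℕ → ℝ} (hm₁ : ∀ n, τ (X ^ n) = (m₁ n : ℝ))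
    (hm₂ : ∀ n, τ (Y ^ n) = (m₂ n : ℝ)) (hm : ∀ n, τ ((X + Y) ^ n) = (m n : ℝ)) {n : ℕ}
    (hn : 1 ≤ n) : freeCumulant m n = freeCumulant m₁ n + freeCumulant m₂ n := by
  have zero : ∀ {S : A} {m : ℕ → ℝ}, (∀ n, τ (S ^ n) = (m n : ℝ)) → m 0 = 1 := by
    intro S m hm
    have := hm 0
    rw [pow_zero, h1] at this
    exact_mod_cast this.symm
  have hL : ∀ {S : A} {m : ℕ → ℝ}, (∀ n, τ (S ^ n) = (m n : ℝ)) →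
      mapLinear (τ ∘ₗ (Polynomial.aeval S).toLinearMap) (resolventSeries (cumulantSeries m)) = 1 :=
    fun hm => mapLinear_resolventSeries (zero hm) _ fun n => by simp [hm]
  have hc := constantCoeff_cumulantSeries
  have key : cumulantSeries m = cumulantSeries m₁ + cumulantSeries m₂ - 1 :=
    eq_of_mapLinear_resolventSeries (by simp [h1]) (hc m) (by simp [hc]) (hL hm)
      (h.mapLinear_resolventSeries_add h1 (hc m₁) (hc m₂) (hL hm₁) (hL hm₂))
  have := congrArg (coeff n) key
  rw [map_sub, map_add, coeff_cumulantSeries _ hn, coeff_cumulantSeries _ hn,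
    coeff_cumulantSeries _ hn, coeff_one, if_neg (by omega), sub_zero] at this
  exact_mod_cast this

end Freeness

/-! ### Compactly supported measures and their moments -/

lemma isCompactProbability_of_ae_le {μ : Measure ℝ} [hμ : IsProbabilityMeasure μ] {R : ℝ}
    (hR : ∀ᵐ t ∂μ, |t| ≤ R) : IsCompactProbability μ := by
  refine ⟨hμ, ?_⟩
  have hs : μ.support ⊆ Set.Icc (-R) R := by
    refine Measure.support_subset_of_isClosed isClosed_Icc ?_
    filter_upwards [hR] with t ht using abs_le.1 ht
  exact isCompact_Icc.of_isClosed_subset Measure.isClosed_support hs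

lemma IsCompactProbability.exists_ae_le {μ : Measure ℝ} (hμ : IsCompactProbability μ) :
    ∃ R : ℝ, 1 ≤ R ∧ ∀ᵐ t ∂μ, |t| ≤ R := by
  obtain ⟨R, hR⟩ := hμ.compact.isBounded.exists_norm_le
  refine ⟨max R 1, le_max_right _ _, ?_⟩
  filter_upwards [Measure.support_mem_ae (μ := μ)] with t ht
  exact (hR t ht).trans (le_max_left _ _)

lemma integrable_of_ae_abs_le {μ : Measure ℝ} [IsFiniteMeasure μ] {R : ℝ}
    (hR : ∀ᵐ t ∂μ, |t| ≤ R) {g : ℝ → ℝ} (hg : Continuous g) : Integrable g μ := by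
  obtain ⟨C, hC⟩ := (isCompact_Icc (a := -R) (b := R)).exists_bound_of_continuousOn hg.continuousOn
  refine Integrable.of_bound hg.aestronglyMeasurable C ?_
  filter_upwards [hR] with t ht using hC t (abs_le.1 ht)

lemma IsCompactProbability.integrable {μ : Measure ℝ} (hμ : IsCompactProbability μ) {g : ℝ → ℝ}
    (hg : Continuous g) : Integrable g μ := by
  have := hμ.prob
  obtain ⟨R, -, hR⟩ := hμ.exists_ae_le
  exact integrable_of_ae_abs_le hR hg

lemma IsCompactProbability.measureMoment_zero {μ : Measure ℝ} (hμ : IsCompactProbability μ) :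
    measureMoment μ 0 = 1 := by
  have := hμ.prob
  simp [measureMoment]

lemma abs_measureMoment_le {μ : Measure ℝ} [IsProbabilityMeasure μ] {R : ℝ}
    (hR : ∀ᵐ t ∂μ, |t| ≤ R) (n : ℕ) : |measureMoment μ n| ≤ R ^ n := by
  have := norm_integral_le_of_norm_le_const (μ := μ) (f := fun t : ℝ => t ^ n) (C := R ^ n) (by
    filter_upwards [hR] with t ht
    rw [Real.norm_eq_abs, abs_pow]
    exact pow_le_pow_left₀ (abs_nonneg t) ht n)
  simpa [measureMoment] using this

lemma IsCompactProbability.integral_eval {μ : Measure ℝ} (hμ : IsCompactProbability μ)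
    (p : Polynomial ℝ) :
    ∫ t, p.eval t ∂μ = ∑ i ∈ Finset.range (p.natDegree + 1), p.coeff i * measureMoment μ i := by
  simp_rw [Polynomial.eval_eq_sum_range, measureMoment]
  rw [integral_finsetSum _ fun i _ => (hμ.integrable (by fun_prop))]
  simp_rw [integral_const_mul]

/-- Polynomials approximate a bounded continuous function on `[-R, R]`, and outside of that interval
the error is dominated by every sufficiently high even power of `t / R`. -/
lemma exists_polynomial_abs_sub_le (f : BoundedContinuousFunction ℝ ℝ) {R ε : ℝ} (hR : 1 ≤ R)
    (hε : 0 < ε) : ∃ (p : Polynomial ℝ) (C : ℝ), 0 ≤ C ∧ ∃ K : ℕ, ∀ k ≥ K, ∀ t : ℝ,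
      |f t - p.eval t| ≤ ε + C * (t / R) ^ (2 * k) := by
  obtain ⟨p, hp⟩ := exists_polynomial_near_of_continuousOn (-R) R f f.continuous.continuousOn ε hε
  set d := p.natDegree
  set S := ∑ i ∈ Finset.range (d + 1), |p.coeff i|
  have hS : 0 ≤ S := Finset.sum_nonneg fun i _ => abs_nonneg _
  have hR0 : 0 < R := by linarith
  refine ⟨p, ‖f‖ + S * R ^ d, by positivity, d, fun k hk t => ?_⟩
  have hpow : 0 ≤ (t / R) ^ (2 * k) := by rw [pow_mul]; positivity
  have hC : 0 ≤ ‖f‖ + S * R ^ d := by positivity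
  by_cases ht : |t| ≤ R
  · have := hp t (abs_le.1 ht)
    rw [abs_sub_comm] at this
    have h2 := mul_nonneg hC hpow
    linarith
  · rw [not_le] at ht
    have h1 : 1 ≤ |t| / R := (one_le_div hR0).2 ht.le
    have h2 : |p.eval t| ≤ S * |t| ^ d := by
      rw [Polynomial.eval_eq_sum_range, Finset.sum_mul]
      refine (Finset.abs_sum_le_sum_abs _ _).trans (Finset.sum_le_sum fun i hi => ?_)
      rw [abs_mul, abs_pow]
      have : i ≤ d := by rw [Finset.mem_range] at hi; omega
      exact mul_le_mul_of_nonneg_left (pow_le_pow_right₀ (by linarith) this) (abs_nonneg _)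
    have h3 : |t| ^ d = R ^ d * (|t| / R) ^ d := by rw [← mul_pow]; congr 1; field_simp
    have h4 : (|t| / R) ^ d ≤ (|t| / R) ^ (2 * k) := pow_le_pow_right₀ h1 (by omega)
    have h5 : (|t| / R) ^ (2 * k) = (t / R) ^ (2 * k) := by
      rw [pow_mul, pow_mul (t / R), div_pow |t|, div_pow t R, sq_abs]
    have h6 : |f t| ≤ ‖f‖ := f.norm_coe_le_norm t
    have h7 : 1 ≤ (|t| / R) ^ (2 * k) := one_le_pow₀ h1
    calc |f t - p.eval t| ≤ |f t| + |p.eval t| := abs_sub _ _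
      _ ≤ ‖f‖ * (|t| / R) ^ (2 * k) + S * (R ^ d * (|t| / R) ^ (2 * k)) := by
          refine add_le_add ?_ (h2.trans ?_)
          · exact h6.trans (le_mul_of_one_le_right (norm_nonneg f) h7)
          · rw [h3]
            gcongr
      _ = (‖f‖ + S * R ^ d) * (t / R) ^ (2 * k) := by rw [h5]; ring
      _ ≤ _ := by linarith

/-- The method of moments: convergence of all moments to those of a compactly supported limit
entails weak convergence.  No uniform bound on the supports is needed. -/
theorem tendsto_integral_of_tendsto_moments {ι : Type*} {l : Filter ι} {μ : ι → Measure ℝ}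
    {ν : Measure ℝ} (hμ : ∀ᶠ i in l, IsCompactProbability (μ i)) (hν : IsCompactProbability ν)
    (h : ∀ n, Tendsto (fun i => measureMoment (μ i) n) l (𝓝 (measureMoment ν n)))
    (f : BoundedContinuousFunction ℝ ℝ) :
    Tendsto (fun i => ∫ t, f t ∂(μ i)) l (𝓝 (∫ t, f t ∂ν)) := by
  obtain ⟨R₀, hR₀, hbd⟩ := hν.exists_ae_le
  rw [Metric.tendsto_nhds]
  intro ε hε
  have hR : 1 ≤ 2 * R₀ := by linarith
  obtain ⟨p, C, hC, K, hp⟩ := exists_polynomial_abs_sub_le f hR (show 0 < ε / 8 by linarith)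
  obtain ⟨k, hkK, hk⟩ : ∃ k ≥ K, C * (1 / 2 : ℝ) ^ (2 * k) < ε / 8 := by
    have h1 : Tendsto (fun k : ℕ => C * ((1 / 2 : ℝ) ^ 2) ^ k) atTop (𝓝 (C * 0)) :=
      (tendsto_pow_atTop_nhds_zero_of_lt_one (by norm_num) (by norm_num)).const_mul C
    rw [mul_zero] at h1
    obtain ⟨k, hk, hk'⟩ := ((h1.eventually_lt_const (show 0 < ε / 8 by linarith)).and
      (eventually_ge_atTop K)).exists
    exact ⟨k, hk', by rw [pow_mul]; exact hk⟩
  have hdev : ∀ ρ : Measure ℝ, IsCompactProbability ρ → |∫ t, f t ∂ρ - ∫ t, p.eval t ∂ρ| ≤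
      ε / 8 + C / (2 * R₀) ^ (2 * k) * measureMoment ρ (2 * k) := by
    intro ρ hρ
    have := hρ.prob
    have hi := hρ.integrable p.continuous
    have hfi := hρ.integrable f.continuous
    have hm := hρ.integrable (g := fun t => C / (2 * R₀) ^ (2 * k) * t ^ (2 * k)) (by fun_prop)
    rw [← integral_sub hfi hi]
    have e : ε / 8 + C / (2 * R₀) ^ (2 * k) * measureMoment ρ (2 * k) =
        ∫ t, (ε / 8 + C / (2 * R₀) ^ (2 * k) * t ^ (2 * k)) ∂ρ := by
      rw [integral_add (integrable_const _) hm, integral_const_mul]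
      simp [measureMoment]
    rw [e]
    refine (abs_integral_le_integral_abs).trans
      (integral_mono (hfi.sub hi).abs ((integrable_const _).add hm) fun t => ?_)
    have := hp k hkK t
    rw [div_pow] at this
    calc _ ≤ _ := this
      _ = _ := by ring
  have hν2 : C / (2 * R₀) ^ (2 * k) * measureMoment ν (2 * k) < ε / 8 := by
    have := hν.prob
    refine lt_of_le_of_lt ?_ hk
    have h1 := (le_abs_self _).trans (abs_measureMoment_le hbd (2 * k))
    have h2 : C * (1 / 2 : ℝ) ^ (2 * k) = C / (2 * R₀) ^ (2 * k) * R₀ ^ (2 * k) := by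
      rw [mul_pow, div_pow, one_pow]; field_simp
    rw [h2]
    exact mul_le_mul_of_nonneg_left h1 (by positivity)
  have ht1 : Tendsto (fun i => C / (2 * R₀) ^ (2 * k) * measureMoment (μ i) (2 * k)) l
      (𝓝 (C / (2 * R₀) ^ (2 * k) * measureMoment ν (2 * k))) := (h _).const_mul _
  have ht2 : Tendsto (fun i => ∑ j ∈ Finset.range (p.natDegree + 1),
      p.coeff j * measureMoment (μ i) j) l
      (𝓝 (∑ j ∈ Finset.range (p.natDegree + 1), p.coeff j * measureMoment ν j)) :=
    tendsto_finsetSum _ fun j _ => (h j).const_mul _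
  rw [← hν.integral_eval] at ht2
  filter_upwards [hμ, ht1.eventually_lt_const hν2,
    (Metric.tendsto_nhds.1 ht2) (ε / 8) (by linarith)] with i hi h1 h2
  rw [← hi.integral_eval, Real.dist_eq] at h2
  rw [Real.dist_eq]
  have h3 := hdev _ hi
  have h4 := hdev _ hν
  rw [abs_le] at h3 h4
  rw [abs_lt] at h2 ⊢
  constructor <;> linarith [h3.1, h3.2, h4.1, h4.2, h2.1, h2.2]

/-- A compactly supported probability measure is determined by its moments. -/
theorem IsCompactProbability.ext_of_moments {μ ν : Measure ℝ} (hμ : IsCompactProbability μ)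
    (hν : IsCompactProbability ν) (h : ∀ n, measureMoment μ n = measureMoment ν n) : μ = ν := by
  have := hμ.prob
  have := hν.prob
  refine ext_of_forall_integral_eq_of_IsFiniteMeasure fun f => ?_
  -- the method of moments for a constant family
  have h1 := tendsto_integral_of_tendsto_moments (l := (pure () : Filter Unit)) (μ := fun _ => μ)
    (by simpa using hμ) hν (fun n => by rw [h n]; exact tendsto_const_nhds) f
  exact tendsto_nhds_unique tendsto_const_nhds h1

theorem IsCompactProbability.ext_of_freeCumulants {μ ν : Measure ℝ} (hμ : IsCompactProbability μ)
    (hν : IsCompactProbability ν)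
    (h : ∀ n, 1 ≤ n → measureFreeCumulant μ n = measureFreeCumulant ν n) : μ = ν :=
  hμ.ext_of_moments hν fun n => congrFun
    (moments_eq_of_freeCumulant_eq hμ.measureMoment_zero hν.measureMoment_zero h) n

lemma ncSpectralRadius_lt_top {A : Type*} [Ring A] [Algebra ℂ A] {τ : A →ₗ[ℂ] ℂ} {X : A} {R : ℝ}
    (h : ∀ n, ‖τ (X ^ n)‖ ≤ R ^ n) : ncSpectralRadius τ X < ⊤ := by
  have hR : 0 ≤ R := by simpa using (norm_nonneg _).trans (h 1)
  refine lt_of_le_of_lt (b := ENNReal.ofReal R) ?_ ENNReal.ofReal_lt_top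
  refine limsup_le_of_le (by isBoundedDefault) ?_
  filter_upwards [eventually_gt_atTop 0] with k hk
  have hk' : (0 : ℝ) < 2 * k := by positivity
  have h1 : ‖τ (X ^ (2 * k))‖ₑ ≤ ENNReal.ofReal R ^ (2 * k : ℝ) := by
    rw [← ofReal_norm, ENNReal.ofReal_rpow_of_nonneg hR hk'.le]
    refine ENNReal.ofReal_le_ofReal ((h (2 * k)).trans_eq ?_)
    rw [← Real.rpow_natCast]
    push_cast
    rfl
  calc _ ≤ (ENNReal.ofReal R ^ (2 * k : ℝ)) ^ (1 / (2 * k : ℝ)) :=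
        ENNReal.rpow_le_rpow h1 (by positivity)
    _ = ENNReal.ofReal R := by
        rw [← ENNReal.rpow_mul, mul_one_div_cancel hk'.ne', ENNReal.rpow_one]

/-! ### Distributions of bounded self-adjoint operators -/

section VectorState

variable {H : Type*} [NormedAddCommGroup H] [InnerProductSpace ℂ H]

/-- The vector state `T ↦ ⟪Ω, T Ω⟫`. -/
noncomputable def vectorState (Ω : H) : (H →L[ℂ] H) →ₗ[ℂ] ℂ where
  toFun T := inner ℂ Ω (T Ω)
  map_add' S T := by simp
  map_smul' c T := by simp

lemma vectorState_apply (Ω : H) (T : H →L[ℂ] H) : vectorState Ω T = inner ℂ Ω (T Ω) := rfl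

lemma isStarExpectation_vectorState [CompleteSpace H] {Ω : H} (hΩ : ‖Ω‖ = 1) :
    IsStarExpectation (vectorState Ω) where
  map_one := by simp [vectorState_apply, inner_self_eq_norm_sq_to_K, hΩ]
  map_star T := by
    rw [vectorState_apply, vectorState_apply, ContinuousLinearMap.star_eq_adjoint,
      ContinuousLinearMap.adjoint_inner_right, ← inner_conj_symm]
    rfl
  nonneg T := by
    rw [vectorState_apply, mul_apply_eq_comp, ContinuousLinearMap.star_eq_adjoint,
      ← ContinuousLinearMap.adjoint_inner_left]
    exact inner_self_nonneg (𝕜 := ℂ)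

lemma norm_vectorState_pow_le {Ω : H} (hΩ : ‖Ω‖ = 1) (T : H →L[ℂ] H) (n : ℕ) :
    ‖vectorState Ω (T ^ n)‖ ≤ ‖T‖ ^ n := by
  have h : ‖(T ^ n) Ω‖ ≤ ‖T‖ ^ n := by
    induction n with
    | zero => simp [hΩ]
    | succ n ih =>
      rw [pow_succ', pow_succ', mul_apply_eq_comp]
      exact (T.le_opNorm _).trans (mul_le_mul_of_nonneg_left ih (norm_nonneg _))
  refine (norm_inner_le_norm _ _).trans ?_
  rwa [hΩ, one_mul]

/-- The spectral distribution of a self-adjoint operator in a vector state: the continuous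
functional calculus gives a positive functional on the continuous functions on the spectrum. -/
theorem exists_spectral_distribution [CompleteSpace H] {Ω : H} (hΩ : ‖Ω‖ = 1) {S : H →L[ℂ] H}
    (hS : IsSelfAdjoint S) : ∃ ρ : Measure ℝ, IsCompactProbability ρ ∧
      ∀ n : ℕ, vectorState Ω (S ^ n) = ((measureMoment ρ n : ℝ) : ℂ) := by
  let σ := spectrum ℝ S
  let Φ : C(σ, ℝ) →⋆ₐ[ℝ] (H →L[ℂ] H) := cfcHom hS
  have hreal : ∀ f : C(σ, ℝ), ((vectorState Ω (Φ f)).re : ℂ) = vectorState Ω (Φ f) := by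
    intro f
    have h1 : star (Φ f) = Φ f := by rw [← map_star, star_trivial]
    have h2 := (isStarExpectation_vectorState hΩ).map_star (Φ f)
    rw [h1] at h2
    exact Complex.conj_eq_iff_re.1 h2.symm
  let L : CompactlySupportedContinuousMap σ ℝ →ₗ[ℝ] ℝ :=
    { toFun := fun f => (vectorState Ω (Φ f.toContinuousMap)).re
      map_add' := fun f g => by
        have : (f + g).toContinuousMap = f.toContinuousMap + g.toContinuousMap := rfl
        rw [this, map_add, map_add, Complex.add_re]
      map_smul' := fun c f => by
        have : (c • f).toContinuousMap = c • f.toContinuousMap := rfl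
        rw [this, map_smul, ← Complex.coe_smul, map_smul]
        simp }
  have hL : ∀ f, 0 ≤ f → 0 ≤ L f := by
    intro f hf
    let g : C(σ, ℝ) := ⟨fun x => √(f x), by fun_prop⟩
    have hg : f.toContinuousMap = g * star g := by
      ext x
      have : 0 ≤ f x := hf x
      simp [g, Real.mul_self_sqrt this]
    change 0 ≤ (vectorState Ω (Φ f.toContinuousMap)).re
    rw [hg, map_mul, map_star]
    exact (isStarExpectation_vectorState hΩ).nonneg _
  let Λ := PositiveLinearMap.mk₀ L hL
  let ρ₀ : Measure σ := RealRMK.rieszMeasure Λ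
  have hint : ∀ f : C(σ, ℝ), ∫ x, f x ∂ρ₀ = (vectorState Ω (Φ f)).re := fun f =>
    RealRMK.integral_rieszMeasure Λ (CompactlySupportedContinuousMap.continuousMapEquiv f)
  have hρ₀ : IsProbabilityMeasure ρ₀ := by
    have h1 := hint 1
    rw [map_one, (isStarExpectation_vectorState hΩ).map_one] at h1
    simp only [ContinuousMap.one_apply, integral_const, smul_eq_mul, mul_one, Complex.one_re] at h1
    rw [Measure.real, ENNReal.toReal_eq_one_iff] at h1
    exact ⟨h1⟩
  have hmeas : Measurable (Subtype.val : σ → ℝ) := measurable_subtype_coe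
  have hprob : IsProbabilityMeasure (ρ₀.map Subtype.val) :=
    Measure.isProbabilityMeasure_map hmeas.aemeasurable
  refine ⟨ρ₀.map Subtype.val, isCompactProbability_of_ae_le (R := ‖S‖ * ‖(1 : H →L[ℂ] H)‖) ?_,
    fun n => ?_⟩
  · rw [ae_map_iff hmeas.aemeasurable (measurableSet_le (by fun_prop) (by fun_prop))]
    exact Eventually.of_forall fun x => spectrum.norm_le_norm_mul_of_mem x.2
  · rw [measureMoment, integral_map hmeas.aemeasurable (by fun_prop)]
    have h1 := hint (((ContinuousMap.id ℝ).restrict σ) ^ n)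
    have h2 : Φ (((ContinuousMap.id ℝ).restrict σ) ^ n) = S ^ n := by
      rw [map_pow]; congr 1; exact cfcHom_id hS
    simp only [ContinuousMap.pow_apply, ContinuousMap.restrict_apply, ContinuousMap.id_apply] at h1
    rw [h1, hreal, h2]

lemma hasDistribution_vectorState [CompleteSpace H] {Ω : H} (hΩ : ‖Ω‖ = 1) {S : H →L[ℂ] H}
    (hS : IsSelfAdjoint S) {ρ : Measure ℝ} (hρ : IsCompactProbability ρ)
    (h : ∀ n : ℕ, vectorState Ω (S ^ n) = ((measureMoment ρ n : ℝ) : ℂ)) :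
    HasDistribution (vectorState Ω) S ρ :=
  ⟨hS, ncSpectralRadius_lt_top (norm_vectorState_pow_le hΩ S), hρ, h⟩

end VectorState

open ComplexConjugate in
/-- Multiplication by the coordinate on `L²(μ)` has distribution `μ` in the constant vector `1`. -/
theorem exists_multiplication_operator {μ : Measure ℝ} (hμ : IsCompactProbability μ) :
    ∃ (T : Lp ℂ 2 μ →L[ℂ] Lp ℂ 2 μ) (ξ : Lp ℂ 2 μ), IsSelfAdjoint T ∧ ‖ξ‖ = 1 ∧
      ∀ n : ℕ, vectorState ξ (T ^ n) = ((measureMoment μ n : ℝ) : ℂ) := by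
  have := hμ.prob
  obtain ⟨R, hR1, hR⟩ := hμ.exists_ae_le
  have hle : ∀ g : Lp ℂ 2 μ, ∀ᵐ t : ℝ ∂μ, ‖(t : ℂ) * g t‖ ≤ R * ‖g t‖ := by
    intro g
    filter_upwards [hR] with t ht
    rw [norm_mul, Complex.norm_real]
    exact mul_le_mul_of_nonneg_right ht (norm_nonneg _)
  have hmem : ∀ g : Lp ℂ 2 μ, MemLp (fun t : ℝ => (t : ℂ) * g t) 2 μ := fun g =>
    (Lp.memLp g).of_le_mul
      ((Complex.continuous_ofReal.aestronglyMeasurable).mul (Lp.aestronglyMeasurable g)) (hle g)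
  let T₀ : Lp ℂ 2 μ →ₗ[ℂ] Lp ℂ 2 μ :=
    { toFun := fun g => (hmem g).toLp
      map_add' := fun f g => by
        apply Lp.ext
        filter_upwards [(hmem (f + g)).coeFn_toLp, (hmem f).coeFn_toLp, (hmem g).coeFn_toLp,
          Lp.coeFn_add f g, Lp.coeFn_add (hmem f).toLp (hmem g).toLp] with t h1 h2 h3 h4 h5
        rw [h1, h5, Pi.add_apply, h2, h3, h4, Pi.add_apply, mul_add]
      map_smul' := fun c g => by
        apply Lp.ext
        filter_upwards [(hmem (c • g)).coeFn_toLp, (hmem g).coeFn_toLp,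
          Lp.coeFn_smul c g, Lp.coeFn_smul c (hmem g).toLp] with t h1 h2 h3 h4
        rw [h1, RingHom.id_apply, h4, Pi.smul_apply, h2, h3, Pi.smul_apply, smul_eq_mul,
          smul_eq_mul, mul_left_comm] }
  have hT₀ : ∀ g, T₀ g =ᵐ[μ] fun t : ℝ => (t : ℂ) * g t := fun g => (hmem g).coeFn_toLp
  let T := T₀.mkContinuous R fun g => by
    refine Lp.norm_le_mul_norm_of_ae_le_mul ?_
    filter_upwards [hT₀ g, hle g] with t h1 h2
    rw [h1]; exact h2
  have hT : ∀ g, T g =ᵐ[μ] fun t : ℝ => (t : ℂ) * g t := hT₀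
  have hone : MemLp (fun _ : ℝ => (1 : ℂ)) 2 μ := memLp_const 1
  let ξ : Lp ℂ 2 μ := hone.toLp
  have hξ : ξ =ᵐ[μ] fun _ => (1 : ℂ) := hone.coeFn_toLp
  have hpow : ∀ n : ℕ, (T ^ n) ξ =ᵐ[μ] fun t : ℝ => (t : ℂ) ^ n := by
    intro n
    induction n with
    | zero => simpa using hξ
    | succ n ih =>
      rw [pow_succ', mul_apply_eq_comp]
      filter_upwards [hT ((T ^ n) ξ), ih] with t h1 h2
      rw [h1, h2, pow_succ']
  have hmom : ∀ n : ℕ, vectorState ξ (T ^ n) = ((measureMoment μ n : ℝ) : ℂ) := by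
    intro n
    rw [vectorState_apply, L2.inner_def, measureMoment, ← integral_complex_ofReal]
    refine integral_congr_ae ?_
    filter_upwards [hξ, hpow n] with t h1 h2
    rw [h1, h2]
    simp
  refine ⟨T, ξ, ?_, ?_, hmom⟩
  · rw [ContinuousLinearMap.isSelfAdjoint_iff_isSymmetric]
    intro f g
    change inner ℂ (T f) g = inner ℂ f (T g)
    rw [L2.inner_def, L2.inner_def]
    refine integral_congr_ae ?_
    filter_upwards [hT f, hT g] with t h1 h2
    rw [h1, h2]
    simp [mul_left_comm, mul_assoc]
  · have h0 := hmom 0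
    rw [hμ.measureMoment_zero, pow_zero, vectorState_apply, one_apply_eq_self] at h0
    have h1 : ‖ξ‖ ^ 2 = 1 := by rw [norm_sq_eq_re_inner (𝕜 := ℂ), h0]; simp
    nlinarith [norm_nonneg ξ]

/-! ### The free product of two Hilbert spaces with unit vectors -/

section Amplification

variable {W K : Type*} [NormedAddCommGroup K] [InnerProductSpace ℂ K]

lemma memℓp_two_apply (T : K →L[ℂ] K) (f : lp (fun _ : W => K) 2) :
    Memℓp (fun w => T (f w)) 2 := by
  have h := (lp.memℓp f).summable (by simp)
  refine memℓp_gen (Summable.of_nonneg_of_le (fun w => by positivity) (fun w => ?_)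
    (h.mul_left (‖T‖ ^ (2 : ENNReal).toReal)))
  rw [← Real.mul_rpow (norm_nonneg _) (norm_nonneg _)]
  exact Real.rpow_le_rpow (norm_nonneg _) (T.le_opNorm _) (by simp)

/-- The action of an operator on every component of a Hilbert sum of copies of one space. -/
noncomputable def amplify : (K →L[ℂ] K) →ₐ[ℂ] (lp (fun _ : W => K) 2 →L[ℂ] lp (fun _ : W => K) 2) where
  toFun T := LinearMap.mkContinuous
    { toFun := fun f => ⟨fun w => T (f w), memℓp_two_apply T f⟩
      map_add' := fun f g => by ext w; exact T.map_add _ _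
      map_smul' := fun c f => by ext w; simp } ‖T‖ fun f => by
    have hp : 0 < (2 : ENNReal).toReal := by simp
    refine lp.norm_le_of_forall_sum_le hp (by positivity) fun s => ?_
    rw [Real.mul_rpow (norm_nonneg _) (norm_nonneg _)]
    refine le_trans ?_ (mul_le_mul_of_nonneg_left (lp.sum_rpow_le_norm_rpow hp f s)
      (by positivity))
    rw [Finset.mul_sum]
    refine Finset.sum_le_sum fun w _ => ?_
    rw [← Real.mul_rpow (norm_nonneg _) (norm_nonneg _)]
    exact Real.rpow_le_rpow (norm_nonneg _) (T.le_opNorm _) (by simp)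
  map_one' := by ext f w; rfl
  map_mul' S T := by ext f w; rfl
  map_zero' := by ext f w; rfl
  map_add' S T := by ext f w; rfl
  commutes' c := by ext f w; rfl

lemma amplify_apply (T : K →L[ℂ] K) (f : lp (fun _ : W => K) 2) (w : W) :
    amplify T f w = T (f w) := rfl

lemma isSelfAdjoint_amplify [CompleteSpace K] {T : K →L[ℂ] K} (hT : IsSelfAdjoint T) :
    IsSelfAdjoint (amplify (W := W) T) := by
  rw [ContinuousLinearMap.isSelfAdjoint_iff_isSymmetric] at hT ⊢
  intro f g
  change inner ℂ (amplify T f) g = inner ℂ f (amplify T g)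
  rw [lp.inner_eq_tsum, lp.inner_eq_tsum]
  exact tsum_congr fun w => hT (f w) (g w)

end Amplification

/-- A monoid structure on a set with a distinguished element `o`: `o` is the unit, and otherwise the
left factor is the product.  It turns pointed sets into monoids, so that reduced words in the
complements of the base points become the reduced words of a free product of monoids. -/
@[reducible]
noncomputable def pointedMonoid {ι : Type*} (o : ι) : Monoid ι := by
  classical
  exact
  { mul := fun a b => if a = o then b else a
    one := o
    mul_assoc := fun a b c => by
      change (if (if a = o then b else a) = o then c else (if a = o then b else a)) =
        if a = o then (if b = o then c else b) else a
      split_ifs <;> simp_all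
    one_mul := fun a => if_pos rfl
    mul_one := fun a => by
      change (if a = o then o else a) = a
      split_ifs with h
      · exact h.symm
      · rfl }

section FreeProduct

open Monoid.CoprodI

variable {ι : Bool → Type} [∀ i, Monoid (ι i)] [∀ i, DecidableEq (ι i)]
  {K : Bool → Type} [∀ i, NormedAddCommGroup (K i)] [∀ i, InnerProductSpace ℂ (K i)]
  [∀ i, CompleteSpace (K i)]

variable (ι) in
/-- The reduced words that do not start with a letter of the `i`-th kind. -/
abbrev TailWord (i : Bool) : Type := {w : Word ι // w.fstIdx ≠ some i}

/-- Splitting off a first letter of the `i`-th kind, or the unit if there is none, is a bijection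
between the reduced words and the pairs of a letter and a reduced word that does not start with a
letter of the `i`-th kind.  Accordingly, a Hilbert basis of `K i` makes the reduced words the index
set of a Hilbert basis of the sum of copies of `K i` over `TailWord ι i`. -/
noncomputable def wordBasis (b : ∀ i, HilbertBasis (ι i) ℂ (K i)) (i : Bool) :
    HilbertBasis (Word ι) ℂ (lp (fun _ : TailWord ι i => K i) 2) := by
  classical
  refine HilbertBasis.mkOfOrthogonalEqBot (v := fun w => lp.single 2
    (⟨(Word.equivPair i w).tail, (Word.equivPair i w).fstIdx_ne⟩ : TailWord ι i)
    (b i (Word.equivPair i w).head)) ?_ ?_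
  · rw [orthonormal_iff_ite]
    intro w w'
    rw [lp.inner_single_left, lp.single_apply, Pi.single_apply]
    have hb := orthonormal_iff_ite.1 (b i).orthonormal
    by_cases h : w = w'
    · subst h; rw [if_pos rfl, if_pos rfl, hb, if_pos rfl]
    · rw [if_neg h]
      split_ifs with h1
      · rw [hb, if_neg]
        intro h2
        exact h ((Word.equivPair i).injective (Word.Pair.ext h2 (congrArg Subtype.val h1)))
      · simp
  · rw [Submodule.eq_bot_iff]
    intro f hf
    ext w : 2
    apply (b i).repr.injective
    rw [lp.coeFn_zero, Pi.zero_apply, map_zero]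
    ext n
    rw [HilbertBasis.repr_apply_apply]
    have h1 := (Submodule.mem_orthogonal _ _).1 hf _ (Submodule.subset_span
      (Set.mem_range_self ((Word.equivPair i).symm ⟨n, w.1, w.2⟩)))
    rw [Equiv.apply_symm_apply, lp.inner_single_left] at h1
    exact h1

variable (b : ∀ i, HilbertBasis (ι i) ℂ (K i))

lemma wordBasis_repr_apply (i : Bool) (f : lp (fun _ : TailWord ι i => K i) 2) (w : Word ι) :
    (wordBasis b i).repr f w = inner ℂ (b i (Word.equivPair i w).head)
      (f ⟨(Word.equivPair i w).tail, (Word.equivPair i w).fstIdx_ne⟩) := by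
  classical
  rw [HilbertBasis.repr_apply_apply, wordBasis, HilbertBasis.coe_mkOfOrthogonalEqBot,
    lp.inner_single_left]

/-- The representation of the operators on `K i` on the free product Hilbert space, which has the
reduced words as its orthonormal basis. -/
noncomputable def freeRep (i : Bool) :
    (K i →L[ℂ] K i) →ₐ[ℂ] (lp (fun _ : Word ι => ℂ) 2 →L[ℂ] lp (fun _ : Word ι => ℂ) 2) :=
  (AlgHomClass.toAlgHom (wordBasis b i).repr.conjStarAlgEquiv).comp amplify

lemma freeRep_apply (i : Bool) (T : K i →L[ℂ] K i) (h : lp (fun _ : Word ι => ℂ) 2) :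
    freeRep b i T h = (wordBasis b i).repr (amplify T ((wordBasis b i).repr.symm h)) := rfl

lemma isSelfAdjoint_freeRep (i : Bool) {T : K i →L[ℂ] K i} (hT : IsSelfAdjoint T) :
    IsSelfAdjoint (freeRep b i T) := by
  have h := isSelfAdjoint_amplify (W := TailWord ι i) hT
  rw [ContinuousLinearMap.isSelfAdjoint_iff_isSymmetric] at h ⊢
  intro f g
  change inner ℂ (freeRep b i T f) g = inner ℂ f (freeRep b i T g)
  rw [freeRep_apply, freeRep_apply, LinearIsometryEquiv.inner_map_eq_flip]
  refine (h _ _).trans ?_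
  rw [LinearIsometryEquiv.inner_map_eq_flip, LinearIsometryEquiv.symm_symm]
  rfl

variable (ι) in
/-- The vacuum vector, the basis vector of the empty word. -/
noncomputable def vacuum : lp (fun _ : Word ι => ℂ) 2 := by
  classical exact lp.single 2 Word.empty 1

lemma vacuum_apply_of_ne {w : Word ι} (h : w ≠ Word.empty) : vacuum ι w = 0 := by
  classical
  rw [vacuum, lp.single_apply, Pi.single_apply, if_neg h]

lemma norm_vacuum : ‖vacuum ι‖ = 1 := by
  classical
  rw [vacuum, lp.norm_single (by simp)]
  simp

lemma inner_vacuum (h : lp (fun _ : Word ι => ℂ) 2) : inner ℂ (vacuum ι) h = h Word.empty := by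
  classical
  rw [vacuum, lp.inner_single_left]
  simp

lemma equivPair_empty (i : Bool) : Word.equivPair i (Word.empty : Word ι) =
    ⟨1, Word.empty, by simp [Word.fstIdx, Word.empty]⟩ :=
  Word.equivPair_eq_of_fstIdx_ne _

lemma vectorState_freeRep (i : Bool) (T : K i →L[ℂ] K i) :
    vectorState (vacuum ι) (freeRep b i T) = vectorState (b i 1) T := by
  classical
  have h1 : (wordBasis b i).repr.symm (vacuum ι) = lp.single 2
      (⟨Word.empty, by simp [Word.fstIdx, Word.empty]⟩ : TailWord ι i) (b i 1) := by
    rw [vacuum, HilbertBasis.repr_symm_single, wordBasis, HilbertBasis.coe_mkOfOrthogonalEqBot]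
    simp only [equivPair_empty]
  rw [vectorState_apply, vectorState_apply, inner_vacuum, freeRep_apply, wordBasis_repr_apply, h1]
  simp only [equivPair_empty, amplify_apply, lp.single_apply, Pi.single_eq_same]

/-- A centered operator on `K i` maps vectors supported on words not starting with the `i`-th kind
of letters to vectors supported on words that do. -/
lemma freeRep_apply_eq_zero (i : Bool) {T : K i →L[ℂ] K i} (hT : vectorState (b i 1) T = 0)
    {h : lp (fun _ : Word ι => ℂ) 2} (hh : ∀ w : Word ι, w.fstIdx = some i → h w = 0)
    (w : Word ι) (hw : w.fstIdx ≠ some i) : freeRep b i T h w = 0 := by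
  rw [freeRep_apply, wordBasis_repr_apply]
  simp only [Word.equivPair_eq_of_fstIdx_ne hw, amplify_apply]
  set g := (wordBasis b i).repr.symm h with hg
  have hgr : (wordBasis b i).repr g = h := by rw [hg, LinearIsometryEquiv.apply_symm_apply]
  have h1 : g ⟨w, hw⟩ = inner ℂ (b i 1) (g ⟨w, hw⟩) • b i 1 := by
    apply (b i).repr.injective
    ext n
    rw [HilbertBasis.repr_apply_apply, HilbertBasis.repr_apply_apply, inner_smul_right,
      orthonormal_iff_ite.1 (b i).orthonormal]
    by_cases hn : n = 1
    · simp [hn]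
    · rw [if_neg hn, mul_zero]
      have h2 := wordBasis_repr_apply b i g ((Word.equivPair i).symm ⟨n, w, hw⟩)
      simp only [Equiv.apply_symm_apply] at h2
      rw [← h2, hgr]
      apply hh
      rw [Word.equivPair_symm, Word.rcons, dif_neg hn, Word.fstIdx_cons]
  rw [h1, map_smul, inner_smul_right]
  rw [vectorState_apply] at hT
  rw [hT, mul_zero]

/-- An alternating product of centered operators moves the vacuum, factor by factor from the right,
to vectors supported on words whose first letter is of the kind of the leftmost factor; these are
orthogonal to the vacuum. -/
theorem freelyIndependent_freeRep (T : ∀ i, K i →L[ℂ] K i) :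
    FreelyIndependent (vectorState (vacuum ι)) (freeRep b true (T true))
      (freeRep b false (T false)) := by
  intro l hl hc h0
  set τ := vectorState (vacuum ι)
  have hvar : ∀ (i : Bool) (p : Polynomial ℂ), Polynomial.aeval
      (if i then freeRep b true (T true) else freeRep b false (T false)) p =
      freeRep b i (Polynomial.aeval (T i) p) := by
    intro i p
    rw [← Polynomial.aeval_algHom_apply]
    cases i <;> rfl
  have key : ∀ l : List (Bool × Polynomial ℂ), l.IsChain (fun p q => p.1 ≠ q.1) →
      (∀ p ∈ l, τ (Polynomial.aeval
        (if p.1 then freeRep b true (T true) else freeRep b false (T false)) p.2) = 0) →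
      ∀ w : Word ι, w.fstIdx ≠ l.head?.map Prod.fst →
      (l.map (fun p => Polynomial.aeval
        (if p.1 then freeRep b true (T true) else freeRep b false (T false)) p.2)).prod
          (vacuum ι) w = 0 := by
    intro l
    induction l with
    | nil =>
      intro _ _ w hw
      refine vacuum_apply_of_ne ?_
      rintro rfl
      simp [Word.fstIdx, Word.empty] at hw
    | cons p l ih =>
      intro hc h0 w hw
      rw [List.map_cons, List.prod_cons, mul_apply_eq_comp, hvar]
      have hp := h0 p (by simp)
      rw [hvar, vectorState_freeRep] at hp
      refine freeRep_apply_eq_zero b p.1 hp (fun w' hw' => ?_) w (by simpa using hw)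
      refine ih hc.tail (fun q hq => h0 q (by simp [hq])) w' ?_
      rw [hw']
      rcases l with _ | ⟨q, l⟩
      · simp
      · rw [List.isChain_cons_cons] at hc
        simpa using hc.1
  rw [vectorState_apply, inner_vacuum]
  refine key l hc h0 _ ?_
  rcases l with _ | ⟨p, l⟩
  · exact absurd rfl hl
  · simp [Word.fstIdx, Word.empty]

end FreeProduct

/-! ### Existence and uniqueness of the free convolution -/

/-- The multiplication operators on `L²(μ)` and `L²(ν)`, with the constant functions as base points,
act freely on the free product Hilbert space. -/
theorem exists_isFreeConvolution {μ ν : Measure ℝ} (hμ : IsCompactProbability μ)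
    (hν : IsCompactProbability ν) : ∃ ρ, IsFreeConvolution μ ν ρ := by
  classical
  let m : Bool → Measure ℝ := fun i => if i then μ else ν
  have hm : ∀ i, IsCompactProbability (m i) := by rintro (_ | _) <;> assumption
  choose T ξ hT hξ hmom using fun i => exists_multiplication_operator (hm i)
  have hon : ∀ i, Orthonormal ℂ (Subtype.val : ({ξ i} : Set (Lp ℂ 2 (m i))) → Lp ℂ 2 (m i)) := by
    intro i
    refine ⟨fun x => by rw [x.2, hξ], fun x y hxy => absurd (Subsingleton.elim x y) hxy⟩
  choose s b hs hb using fun i => (hon i).exists_hilbertBasis_extension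
  have hmem : ∀ i, ξ i ∈ s i := fun i => hs i rfl
  let : ∀ i, Monoid (s i) := fun i => pointedMonoid ⟨ξ i, hmem i⟩
  have hb1 : ∀ i, b i 1 = ξ i := by
    intro i
    rw [hb i]
    rfl
  let Ω := vacuum fun i => s i
  have hΩ : ‖Ω‖ = 1 := norm_vacuum
  let X : ∀ i, _ := fun i => freeRep b i (T i)
  have hX : ∀ i, IsSelfAdjoint (X i) := fun i => isSelfAdjoint_freeRep b i (hT i)
  have hXm : ∀ i n, vectorState Ω (X i ^ n) = ((measureMoment (m i) n : ℝ) : ℂ) := by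
    intro i n
    rw [← hmom i n, ← hb1 i, ← vectorState_freeRep b, map_pow (freeRep b i)]
  have hsum : IsSelfAdjoint (X true + X false) := (hX true).add (hX false)
  obtain ⟨ρ, hρ, hρm⟩ := exists_spectral_distribution hΩ hsum
  exact ⟨ρ, _, inferInstance, inferInstance, inferInstance, inferInstance, vectorState Ω, X true,
    X false, isStarExpectation_vectorState hΩ,
    hasDistribution_vectorState hΩ (hX true) hμ (hXm true),
    hasDistribution_vectorState hΩ (hX false) hν (hXm false),
    freelyIndependent_freeRep b T, hasDistribution_vectorState hΩ hsum hρ hρm⟩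

lemma IsFreeConvolution.isCompactProbability {μ ν ρ : Measure ℝ} (h : IsFreeConvolution μ ν ρ) :
    IsCompactProbability ρ := by
  obtain ⟨A, _, _, _, _, τ, X, Y, _, _, _, _, hρ⟩ := h
  exact hρ.measure

theorem IsFreeConvolution.measureFreeCumulant_eq {μ ν ρ : Measure ℝ} (h : IsFreeConvolution μ ν ρ)
    {n : ℕ} (hn : 1 ≤ n) :
    measureFreeCumulant ρ n = measureFreeCumulant μ n + measureFreeCumulant ν n := by
  obtain ⟨A, _, _, _, _, τ, X, Y, hτ, hμ, hν, hf, hρ⟩ := h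
  exact hf.freeCumulant_add hτ.map_one hμ.moments hν.moments hρ.moments hn

/-- Uniqueness holds because free cumulants add and determine a compactly supported measure. -/
theorem isFreeConvolution_iff {μ ν : Measure ℝ} (hμ : IsCompactProbability μ)
    (hν : IsCompactProbability ν) (ρ : Measure ℝ) :
    IsFreeConvolution μ ν ρ ↔ ρ = freeConv μ ν := by
  have hex := exists_isFreeConvolution hμ hν
  have hconv : IsFreeConvolution μ ν (freeConv μ ν) := by
    rw [freeConv, dif_pos hex]
    exact hex.choose_spec
  constructor
  · intro h
    refine h.isCompactProbability.ext_of_freeCumulants hconv.isCompactProbability fun n hn => ?_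
    rw [h.measureFreeCumulant_eq hn, hconv.measureFreeCumulant_eq hn]
  · rintro rfl
    exact hconv

lemma isCompactProbability_freeConvPow {μ : Measure ℝ} (hμ : IsCompactProbability μ) {k : ℕ}
    (hk : 1 ≤ k) : IsCompactProbability (freeConvPow μ k) := by
  induction k, hk using Nat.le_induction with
  | base => exact hμ
  | succ k hk ih =>
    obtain ⟨j, rfl⟩ : ∃ j, k = j + 1 := ⟨k - 1, by omega⟩
    exact ((isFreeConvolution_iff ih hμ _).2 rfl).isCompactProbability

theorem isFreeConvolution_freeConvPow_iff {μ : Measure ℝ} (hμ : IsCompactProbability μ) {k : ℕ}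
    (hk : 1 ≤ k) (ρ : Measure ℝ) :
    IsFreeConvolution (freeConvPow μ k) μ ρ ↔ ρ = freeConvPow μ (k + 1) := by
  obtain ⟨j, rfl⟩ : ∃ j, k = j + 1 := ⟨k - 1, by omega⟩
  exact isFreeConvolution_iff (isCompactProbability_freeConvPow hμ hk) hμ ρ

theorem measureFreeCumulant_freeConvPow {μ : Measure ℝ} (hμ : IsCompactProbability μ) {k n : ℕ}
    (hk : 1 ≤ k) (hn : 1 ≤ n) :
    measureFreeCumulant (freeConvPow μ k) n = k * measureFreeCumulant μ n := by
  induction k, hk using Nat.le_induction with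
  | base => simp [freeConvPow]
  | succ k hk ih =>
    rw [((isFreeConvolution_freeConvPow_iff hμ hk _).2 rfl).measureFreeCumulant_eq hn, ih]
    push_cast
    ring

/-! ### The square root `s(z)` off the interval -/

section Root

variable {lam α : ℝ}

lemma mem_mpInterval_iff_abs (hlam : 0 < lam) (t : ℝ) :
    t ∈ mpInterval lam α ↔ |t - α * (1 + lam)| ≤ 2 * (α * √lam) := by
  have h := Real.sq_sqrt hlam.le
  have e1 : α * (1 - √lam) ^ 2 = α * (1 + lam) - 2 * (α * √lam) := by
    linear_combination α * h
  have e2 : α * (1 + √lam) ^ 2 = α * (1 + lam) + 2 * (α * √lam) := by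
    linear_combination α * h
  rw [mpInterval, Set.mem_Icc, e1, e2, abs_le]
  constructor <;> rintro ⟨h1, h2⟩ <;> constructor <;> linarith

lemma mem_mpInterval_iff_sq (hlam : 0 < lam) (hα : 0 < α) (t : ℝ) :
    t ∈ mpInterval lam α ↔ (t - α * (1 + lam)) ^ 2 ≤ 4 * lam * α ^ 2 := by
  have h := Real.sq_sqrt hlam.le
  have h0 : 0 ≤ 2 * (α * √lam) := by positivity
  rw [mem_mpInterval_iff_abs hlam, ← abs_of_nonneg h0, ← sq_le_sq]
  have : (2 * (α * √lam)) ^ 2 = 4 * lam * α ^ 2 := by linear_combination 4 * α ^ 2 * h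
  rw [this]

/-- The square root of `(z - α (1 + lam))² - 4 lam α²` that is asymptotic to `z`.  The radicand of
the principal square root in it avoids the negative half-line unless `z ∈ mpInterval lam α`. -/
noncomputable def mpRoot (lam α : ℝ) (z : ℂ) : ℂ :=
  (z - α * (1 + lam)) * (1 - 4 * lam * α ^ 2 / (z - α * (1 + lam)) ^ 2) ^ (1 / 2 : ℂ)

/-- The point `ω` of the unit disk with `α √lam (ω + 1/ω) = z - α (1 + lam)`. -/
noncomputable def joukowskyPoint (lam α : ℝ) (z : ℂ) : ℂ :=
  (z - α * (1 + lam) - mpRoot lam α z) / (2 * (α * √lam : ℝ))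

lemma sub_ne_zero_of_notMem (hlam : 0 < lam) (hα : 0 < α) {z : ℂ}
    (hz : z ∉ Complex.ofReal '' mpInterval lam α) : z - α * (1 + lam) ≠ 0 := by
  intro h
  refine hz ⟨α * (1 + lam), ?_, ?_⟩
  · rw [mem_mpInterval_iff_sq hlam hα, sub_self, zero_pow two_ne_zero]; positivity
  · push_cast; exact (sub_eq_zero.1 h).symm

lemma radicand_mem_slitPlane (hlam : 0 < lam) (hα : 0 < α) {z : ℂ}
    (hz : z ∉ Complex.ofReal '' mpInterval lam α) :
    1 - 4 * lam * α ^ 2 / (z - α * (1 + lam)) ^ 2 ∈ Complex.slitPlane := by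
  have hne := sub_ne_zero_of_notMem hlam hα hz
  by_contra hcon
  rw [Complex.mem_slitPlane_iff, not_or, not_lt, not_not] at hcon
  set v : ℂ := 1 - 4 * lam * α ^ 2 / (z - α * (1 + lam)) ^ 2 with hv
  set x := v.re
  have hvx : v = (x : ℂ) := Complex.ext rfl (by simpa using hcon.2)
  have h1 : (z - α * (1 + lam)) ^ 2 * ((1 - x : ℝ) : ℂ) = ((4 * lam * α ^ 2 : ℝ) : ℂ) := by
    push_cast
    rw [← hvx, hv]
    field_simp
    ring
  have hx : 0 < 1 - x := by have := hcon.1; linarith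
  have hx' : ((1 - x : ℝ) : ℂ) ≠ 0 := by exact_mod_cast hx.ne'
  have h2 : (z - α * (1 + lam)) ^ 2 = ((4 * lam * α ^ 2 / (1 - x) : ℝ) : ℂ) := by
    rw [Complex.ofReal_div, eq_div_iff hx', h1]
  set y := z - α * (1 + lam) with hy
  have hre := congrArg Complex.re h2
  have him := congrArg Complex.im h2
  rw [Complex.ofReal_re, pow_two, Complex.mul_re] at hre
  rw [Complex.ofReal_im, pow_two, Complex.mul_im] at him
  have hpos : 0 < 4 * lam * α ^ 2 / (1 - x) := by positivity
  have him0 : y.im = 0 := by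
    have h3 : y.re * y.im = 0 := by linarith
    rcases mul_eq_zero.1 h3 with h | h
    · rw [h] at hre; nlinarith [sq_nonneg y.im]
    · exact h
  refine hz ⟨α * (1 + lam) + y.re, ?_, ?_⟩
  · rw [mem_mpInterval_iff_sq hlam hα]
    have h4 : 4 * lam * α ^ 2 / (1 - x) ≤ 4 * lam * α ^ 2 :=
      div_le_self (by positivity) (by have := hcon.1; linarith)
    rw [him0] at hre
    nlinarith
  · have : (y.re : ℂ) = y := Complex.ext rfl (by simp [him0])
    push_cast
    rw [this, hy]
    ring

lemma sq_cpow_half (v : ℂ) : (v ^ (1 / 2 : ℂ)) ^ 2 = v := by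
  rw [← Complex.cpow_nat_mul]
  norm_num

lemma re_cpow_half_pos {v : ℂ} (hv : v ∈ Complex.slitPlane) : 0 < (v ^ (1 / 2 : ℂ)).re := by
  have hv0 := Complex.slitPlane_ne_zero hv
  rw [Complex.cpow_def_of_ne_zero hv0, Complex.exp_re]
  refine mul_pos (Real.exp_pos _) (Real.cos_pos_of_mem_Ioo ?_)
  have e : (Complex.log v * (1 / 2)).im = v.arg / 2 := by
    have : (1 / 2 : ℂ) = ((1 / 2 : ℝ) : ℂ) := by norm_num
    rw [this, Complex.im_mul_ofReal, Complex.log_im]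
    ring
  rw [e]
  have h1 := Complex.neg_pi_lt_arg v
  have h2 := Complex.arg_le_pi v
  have h3 := Complex.slitPlane_arg_ne_pi hv
  have h4 := lt_of_le_of_ne h2 h3
  constructor <;> linarith

lemma mpRoot_sq (hlam : 0 < lam) (hα : 0 < α) {z : ℂ}
    (hz : z ∉ Complex.ofReal '' mpInterval lam α) :
    mpRoot lam α z ^ 2 = (z - α * (1 + lam)) ^ 2 - 4 * lam * α ^ 2 := by
  have hne := sub_ne_zero_of_notMem hlam hα hz
  rw [mpRoot, mul_pow, sq_cpow_half]
  field_simp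

lemma differentiableOn_mpRoot (hlam : 0 < lam) (hα : 0 < α) :
    DifferentiableOn ℂ (mpRoot lam α) (Complex.ofReal '' mpInterval lam α)ᶜ := by
  intro z hz
  have hne := sub_ne_zero_of_notMem hlam hα hz
  have hsl := radicand_mem_slitPlane hlam hα hz
  apply DifferentiableAt.differentiableWithinAt
  unfold mpRoot
  refine DifferentiableAt.mul (by fun_prop) (DifferentiableAt.cpow ?_ (by fun_prop) hsl)
  exact (differentiableAt_const _).sub
    (DifferentiableAt.div (by fun_prop) (by fun_prop) (pow_ne_zero 2 hne))

lemma joukowskyPoint_mul (hlam : 0 < lam) (hα : 0 < α) {z : ℂ}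
    (hz : z ∉ Complex.ofReal '' mpInterval lam α) :
    joukowskyPoint lam α z *
      ((z - α * (1 + lam) + mpRoot lam α z) / (2 * (α * √lam : ℝ))) = 1 := by
  have h := Real.sq_sqrt hlam.le
  have h' : ((√lam : ℝ) : ℂ) ^ 2 = lam := by exact_mod_cast h
  have hs : ((√lam : ℝ) : ℂ) ≠ 0 := by exact_mod_cast (Real.sqrt_pos.2 hlam).ne'
  have ha : (α : ℂ) ≠ 0 := by exact_mod_cast hα.ne'
  rw [joukowskyPoint, div_mul_div_comm, div_eq_one_iff_eq (by simp [hs, ha])]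
  push_cast
  linear_combination (-1 : ℂ) * mpRoot_sq hlam hα hz - 4 * (α : ℂ) ^ 2 * h'

lemma norm_one_add_ge {q : ℂ} (hq : 0 < q.re) : 1 ≤ ‖1 + q‖ := by
  have := Complex.re_le_norm (1 + q)
  simp at this
  linarith

lemma joukowskyPoint_ne_zero (hlam : 0 < lam) (hα : 0 < α) {z : ℂ}
    (hz : z ∉ Complex.ofReal '' mpInterval lam α) : joukowskyPoint lam α z ≠ 0 :=
  left_ne_zero_of_mul_eq_one (joukowskyPoint_mul hlam hα hz)

lemma mul_joukowskyPoint_add_inv (hlam : 0 < lam) (hα : 0 < α) {z : ℂ}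
    (hz : z ∉ Complex.ofReal '' mpInterval lam α) :
    (α * √lam : ℝ) * (joukowskyPoint lam α z + (joukowskyPoint lam α z)⁻¹) =
      z - α * (1 + lam) := by
  rw [inv_eq_of_mul_eq_one_right (joukowskyPoint_mul hlam hα hz)]
  have hs : ((α * √lam : ℝ) : ℂ) ≠ 0 := by
    exact_mod_cast (mul_pos hα (Real.sqrt_pos.2 hlam)).ne'
  rw [joukowskyPoint]
  field_simp
  ring

lemma mul_inv_joukowskyPoint_sub (hlam : 0 < lam) (hα : 0 < α) {z : ℂ}
    (hz : z ∉ Complex.ofReal '' mpInterval lam α) :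
    (α * √lam : ℝ) * ((joukowskyPoint lam α z)⁻¹ - joukowskyPoint lam α z) = mpRoot lam α z := by
  rw [inv_eq_of_mul_eq_one_right (joukowskyPoint_mul hlam hα hz)]
  have hs : ((α * √lam : ℝ) : ℂ) ≠ 0 := by
    exact_mod_cast (mul_pos hα (Real.sqrt_pos.2 hlam)).ne'
  rw [joukowskyPoint]
  field_simp
  ring

/-- The factor `q` in `s = (z - α (1 + lam)) q` has positive real part, so `|1 - q| < |1 + q|`; of the
two reciprocal solutions of the equation for `ω` the smaller one is the quotient with `1 - q`. -/
lemma norm_joukowskyPoint_lt_one (hlam : 0 < lam) (hα : 0 < α) {z : ℂ}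
    (hz : z ∉ Complex.ofReal '' mpInterval lam α) : ‖joukowskyPoint lam α z‖ < 1 := by
  have hne := sub_ne_zero_of_notMem hlam hα hz
  have hq := re_cpow_half_pos (radicand_mem_slitPlane hlam hα hz)
  set q := (1 - 4 * lam * α ^ 2 / (z - α * (1 + lam)) ^ 2 : ℂ) ^ (1 / 2 : ℂ) with hqdef
  have hroot : mpRoot lam α z = (z - α * (1 + lam)) * q := rfl
  have hmul := congrArg norm (joukowskyPoint_mul hlam hα hz)
  rw [norm_mul, norm_one] at hmul
  have hlt : ‖joukowskyPoint lam α z‖ <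
      ‖(z - α * (1 + lam) + mpRoot lam α z) / (2 * (α * √lam : ℝ))‖ := by
    have hs : 0 < ‖(2 * (α * √lam : ℝ) : ℂ)‖ := by
      rw [norm_pos_iff]
      exact_mod_cast (mul_pos two_pos (mul_pos hα (Real.sqrt_pos.2 hlam))).ne'
    rw [joukowskyPoint, norm_div, norm_div, div_lt_div_iff_of_pos_right hs, hroot]
    have e1 : z - α * (1 + lam) - (z - α * (1 + lam)) * q = (z - α * (1 + lam)) * (1 - q) := by ring
    have e2 : z - α * (1 + lam) + (z - α * (1 + lam)) * q = (z - α * (1 + lam)) * (1 + q) := by ring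
    rw [e1, e2, norm_mul, norm_mul]
    refine mul_lt_mul_of_pos_left ?_ (norm_pos_iff.2 hne)
    rw [← sq_lt_sq₀ (norm_nonneg _) (norm_nonneg _), Complex.sq_norm, Complex.sq_norm,
      Complex.normSq_apply, Complex.normSq_apply]
    simp only [Complex.sub_re, Complex.add_re, Complex.one_re, Complex.sub_im, Complex.add_im,
      Complex.one_im]
    nlinarith
  by_contra hcon
  rw [not_lt] at hcon
  nlinarith [norm_nonneg (joukowskyPoint lam α z)]

lemma norm_joukowskyPoint_le (hlam : 0 < lam) (hα : 0 < α) {z : ℂ}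
    (hz : z ∉ Complex.ofReal '' mpInterval lam α) :
    ‖joukowskyPoint lam α z‖ ≤ 2 * (α * √lam) / ‖z - α * (1 + lam)‖ := by
  have hne := sub_ne_zero_of_notMem hlam hα hz
  have hq := norm_one_add_ge (re_cpow_half_pos (radicand_mem_slitPlane hlam hα hz))
  have hmul := congrArg norm (joukowskyPoint_mul hlam hα hz)
  set q := (1 - 4 * lam * α ^ 2 / (z - α * (1 + lam)) ^ 2 : ℂ) ^ (1 / 2 : ℂ) with hqdef
  have hroot : mpRoot lam α z = (z - α * (1 + lam)) * q := rfl
  have e2 : z - α * (1 + lam) + (z - α * (1 + lam)) * q = (z - α * (1 + lam)) * (1 + q) := by ring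
  have hs : 0 < 2 * (α * √lam) := mul_pos two_pos (mul_pos hα (Real.sqrt_pos.2 hlam))
  have hs' : ‖(2 * (α * √lam : ℝ) : ℂ)‖ = 2 * (α * √lam) := by
    rw [norm_mul, Complex.norm_real, Real.norm_of_nonneg (by linarith)]
    simp
  have hp := norm_pos_iff.2 hne
  rw [norm_mul, norm_one, norm_div, hroot, e2, norm_mul, hs', mul_div_assoc',
    div_eq_one_iff_eq hs.ne'] at hmul
  rw [le_div_iff₀ hp, ← hmul, ← mul_assoc]
  exact le_mul_of_one_le_right (by positivity) hq

lemma isCompact_image_mpInterval : IsCompact (Complex.ofReal '' mpInterval lam α) :=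
  isCompact_Icc.image Complex.continuous_ofReal

lemma eventually_notMem_mpInterval :
    ∀ᶠ z : ℂ in Bornology.cobounded ℂ, z ∉ Complex.ofReal '' mpInterval lam α :=
  Bornology.isBounded_def.1 isCompact_image_mpInterval.isBounded

lemma tendsto_joukowskyPoint (hlam : 0 < lam) (hα : 0 < α) :
    Tendsto (joukowskyPoint lam α) (Bornology.cobounded ℂ) (𝓝 0) := by
  have h1 : Tendsto (fun z : ℂ => ‖z - α * (1 + lam)‖) (Bornology.cobounded ℂ) atTop := by
    have h2 : Tendsto (fun z : ℂ => ‖z‖ - ‖(α * (1 + lam) : ℂ)‖) (Bornology.cobounded ℂ) atTop :=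
      tendsto_atTop_add_const_right _ _ tendsto_norm_cobounded_atTop
    exact tendsto_atTop_mono (fun z => norm_sub_norm_le _ _) h2
  refine squeeze_zero_norm' ?_ (h1.const_div_atTop (2 * (α * √lam)))
  filter_upwards [eventually_notMem_mpInterval] with z hz
  exact norm_joukowskyPoint_le hlam hα hz

lemma mpRoot_eq (hlam : 0 < lam) (hα : 0 < α) (z : ℂ) :
    mpRoot lam α z = z - α * (1 + lam) - 2 * (α * √lam : ℝ) * joukowskyPoint lam α z := by
  have hs : ((α * √lam : ℝ) : ℂ) ≠ 0 := by
    exact_mod_cast (mul_pos hα (Real.sqrt_pos.2 hlam)).ne'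
  rw [joukowskyPoint]
  field_simp
  ring

lemma tendsto_mpRoot_div (hlam : 0 < lam) (hα : 0 < α) :
    Tendsto (fun z : ℂ => mpRoot lam α z / z) (Bornology.cobounded ℂ) (𝓝 1) := by
  have hinv : Tendsto (fun z : ℂ => z⁻¹) (Bornology.cobounded ℂ) (𝓝 0) :=
    tendsto_inv₀_cobounded
  have h1 : Tendsto (fun z : ℂ => 1 - (α * (1 + lam) +
      2 * (α * √lam : ℝ) * joukowskyPoint lam α z) * z⁻¹) (Bornology.cobounded ℂ)
      (𝓝 (1 - (α * (1 + lam) + 2 * (α * √lam : ℝ) * 0) * 0)) :=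
    tendsto_const_nhds.sub
      ((tendsto_const_nhds.add ((tendsto_joukowskyPoint hlam hα).const_mul _)).mul hinv)
  rw [mul_zero, sub_zero] at h1
  refine h1.congr' ?_
  filter_upwards [Bornology.eventually_ne_cobounded (0 : ℂ)] with z hz
  rw [mpRoot_eq hlam hα]
  field_simp
  ring

/-- The root maps the upper half plane to itself: with `s = α √lam (1/ω - ω)` and
`z - α (1 + lam) = α √lam (ω + 1/ω)`, both imaginary parts have the sign of `-Im ω`. -/
lemma im_mpRoot_pos (hlam : 0 < lam) (hα : 0 < α) {z : ℂ} (hz : 0 < z.im) :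
    0 < (mpRoot lam α z).im := by
  have hzI : z ∉ Complex.ofReal '' mpInterval lam α := by
    rintro ⟨t, -, rfl⟩
    simp at hz
  have h1 := mul_joukowskyPoint_add_inv hlam hα hzI
  have h2 := mul_inv_joukowskyPoint_sub hlam hα hzI
  have h0 := joukowskyPoint_ne_zero hlam hα hzI
  set ω := joukowskyPoint lam α z
  have hσ : 0 < α * √lam := mul_pos hα (Real.sqrt_pos.2 hlam)
  have hn : 0 < Complex.normSq ω := Complex.normSq_pos.2 h0
  have hn1 : Complex.normSq ω < 1 := by
    rw [← Complex.sq_norm]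
    have := norm_joukowskyPoint_lt_one hlam hα hzI
    nlinarith [norm_nonneg ω]
  have e1 := congrArg Complex.im h1
  have e2 := congrArg Complex.im h2
  rw [Complex.im_ofReal_mul, Complex.add_im, Complex.inv_im] at e1
  rw [Complex.im_ofReal_mul, Complex.sub_im, Complex.inv_im] at e2
  have e3 : (z - α * (1 + lam) : ℂ).im = z.im := by
    have : (α * (1 + lam) : ℂ) = ((α * (1 + lam) : ℝ) : ℂ) := by push_cast; rfl
    rw [this, Complex.sub_im, Complex.ofReal_im, sub_zero]
  rw [e3] at e1
  set N := Complex.normSq ω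
  have hω : ω.im < 0 := by
    have h5 : ω.im + -ω.im / N = -(ω.im * (1 / N - 1)) := by ring
    have h6 : 0 < 1 / N - 1 := by rw [sub_pos]; exact (one_lt_div hn).2 hn1
    rw [h5] at e1
    by_contra hcon
    rw [not_lt] at hcon
    have := mul_nonneg hσ.le (mul_nonneg hcon h6.le)
    nlinarith
  rw [← e2]
  refine mul_pos hσ ?_
  have : 0 < -ω.im / N := div_pos (by linarith) hn
  linarith

end Root

/-! ### The Cauchy transform of the Marchenko–Pastur law -/

section PoissonKernel

lemma hasSum_pow_mul_sin {ω : ℂ} (hω : ‖ω‖ < 1) (θ : ℝ) :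
    HasSum (fun n : ℕ => ω ^ n * (Real.sin ((n + 1) * θ) : ℂ))
      (Real.sin θ / (1 - 2 * ω * Real.cos θ + ω ^ 2)) := by
  have hgeo : ∀ e : ℂ, ‖e‖ = 1 → HasSum (fun n : ℕ => ω ^ n * e ^ (n + 1)) (e / (1 - ω * e)) := by
    intro e he
    have h1 : ‖ω * e‖ < 1 := by rwa [norm_mul, he, mul_one]
    have h2 := (hasSum_geometric_of_norm_lt_one h1).mul_left e
    rw [← div_eq_mul_inv] at h2
    refine h2.congr_fun fun n => ?_
    rw [mul_pow, pow_succ]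
    ring
  set e := Complex.exp (θ * Complex.I) with he
  set e' := Complex.exp (-θ * Complex.I) with he'
  have hen : ‖e‖ = 1 := Complex.norm_exp_ofReal_mul_I θ
  have hen' : ‖e'‖ = 1 := by
    have := Complex.norm_exp_ofReal_mul_I (-θ)
    rwa [Complex.ofReal_neg] at this
  have hee : e * e' = 1 := by
    rw [he, he', ← Complex.exp_add]; simp
  have hcos : (Real.cos θ : ℂ) = (e + e') / 2 := by rw [Complex.ofReal_cos]; rfl
  have hsin : ∀ n : ℕ, (Real.sin (n * θ) : ℂ) = (e' ^ n - e ^ n) * Complex.I / 2 := by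
    intro n
    rw [Complex.ofReal_sin, Complex.sin, he, he', ← Complex.exp_nat_mul, ← Complex.exp_nat_mul]
    have e1 : (n : ℂ) * (-θ * Complex.I) = -((n * θ : ℝ) : ℂ) * Complex.I := by push_cast; ring
    have e2 : (n : ℂ) * (θ * Complex.I) = ((n * θ : ℝ) : ℂ) * Complex.I := by push_cast; ring
    rw [e1, e2]
  have hne : ∀ x : ℂ, ‖x‖ = 1 → 1 - ω * x ≠ 0 := by
    intro x hx h
    have : ‖ω * x‖ = 1 := by rw [← sub_eq_zero.1 h, norm_one]
    rw [norm_mul, hx, mul_one] at this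
    linarith
  have h := (((hgeo e' hen').sub (hgeo e hen)).mul_right (Complex.I / 2))
  have hval : (e' / (1 - ω * e') - e / (1 - ω * e)) * (Complex.I / 2) =
      Real.sin θ / (1 - 2 * ω * Real.cos θ + ω ^ 2) := by
    have hs1 := hsin 1
    rw [Nat.cast_one, one_mul, pow_one, pow_one] at hs1
    have hden : 1 - 2 * ω * Real.cos θ + ω ^ 2 = (1 - ω * e') * (1 - ω * e) := by
      rw [hcos]; linear_combination (-ω ^ 2) * hee
    rw [hs1, hden, div_sub_div _ _ (hne e' hen') (hne e hen)]
    rw [div_mul_div_comm, mul_comm _ (2 : ℂ), ← div_div]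
    congr 1
    ring
  rw [hval] at h
  refine h.congr_fun fun n => ?_
  have := hsin (n + 1)
  push_cast at this ⊢
  rw [this]
  ring

lemma integral_sin_mul_sin (n : ℕ) :
    ∫ θ in (0 : ℝ)..Real.pi, Real.sin θ * Real.sin ((n + 1) * θ) =
      if n = 0 then Real.pi / 2 else 0 := by
  rcases n with _ | n
  · simp [← pow_two, integral_sin_sq]
  · have h : ∀ θ : ℝ, Real.sin θ * Real.sin (((n + 1 : ℕ) + 1) * θ) =
        (Real.cos ((n + 1 : ℕ) * θ) - Real.cos ((n + 3 : ℕ) * θ)) / 2 := by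
      intro θ
      have e1 : ((n + 1 : ℕ) : ℝ) * θ = ((n + 1 : ℕ) + 1) * θ - θ := by ring
      have e2 : ((n + 3 : ℕ) : ℝ) * θ = ((n + 1 : ℕ) + 1) * θ + θ := by push_cast; ring
      rw [e1, e2, Real.cos_sub, Real.cos_add]
      ring
    have hc : ∀ m : ℕ, 0 < m → ∫ θ in (0 : ℝ)..Real.pi, Real.cos (m * θ) = 0 := by
      intro m hm
      have hm' : (m : ℝ) ≠ 0 := by positivity
      rw [intervalIntegral.integral_comp_mul_left (fun x => Real.cos x) hm', integral_cos]
      simp [Real.sin_nat_mul_pi]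
    simp_rw [h]
    rw [intervalIntegral.integral_div, intervalIntegral.integral_sub, hc _ (by omega),
      hc _ (by omega)]
    · simp
    · exact (by fun_prop : Continuous fun θ : ℝ => Real.cos ((n + 1 : ℕ) * θ)).intervalIntegrable _ _
    · exact (by fun_prop : Continuous fun θ : ℝ => Real.cos ((n + 3 : ℕ) * θ)).intervalIntegrable _ _

/-- `∫₀^π sin² θ / (1 - 2 ω cos θ + ω²) dθ = π / 2` in the unit disk, by expanding in powers of `ω`
and the orthogonality of the functions `sin (n θ)`. -/
lemma integral_sin_sq_div {ω : ℂ} (hω : ‖ω‖ < 1) :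
    ∫ θ in (0 : ℝ)..Real.pi, ((Real.sin θ : ℂ) ^ 2) / (1 - 2 * ω * Real.cos θ + ω ^ 2) =
      ((Real.pi : ℂ) / 2) := by
  have hsum : HasSum (fun n : ℕ => ∫ θ in (0 : ℝ)..Real.pi,
      ω ^ n * ((Real.sin θ * Real.sin ((n + 1) * θ) : ℝ) : ℂ))
      (∫ θ in (0 : ℝ)..Real.pi, ((Real.sin θ : ℂ) ^ 2) / (1 - 2 * ω * Real.cos θ + ω ^ 2)) := by
    refine intervalIntegral.hasSum_integral_of_dominated_convergence (fun n _ => ‖ω‖ ^ n)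
      (fun n => ?_) (fun n => Eventually.of_forall fun θ _ => ?_)
      (Eventually.of_forall fun θ _ => summable_geometric_of_lt_one (norm_nonneg _) hω) ?_
      (Eventually.of_forall fun θ _ => ?_)
    · exact (by fun_prop : Continuous fun θ : ℝ =>
        ω ^ n * ((Real.sin θ * Real.sin ((n + 1) * θ) : ℝ) : ℂ)).aestronglyMeasurable
    · rw [norm_mul, norm_pow, Complex.norm_real, Real.norm_eq_abs, abs_mul]
      refine mul_le_of_le_one_right (by positivity) ?_
      exact mul_le_one₀ (Real.abs_sin_le_one _) (abs_nonneg _) (Real.abs_sin_le_one _)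
    · exact intervalIntegrable_const
    · have := (hasSum_pow_mul_sin hω θ).mul_left (Real.sin θ : ℂ)
      rw [mul_div_assoc', ← pow_two] at this
      refine this.congr_fun fun n => ?_
      push_cast
      ring
  have h0 : HasSum (fun n : ℕ => ∫ θ in (0 : ℝ)..Real.pi,
      ω ^ n * ((Real.sin θ * Real.sin ((n + 1) * θ) : ℝ) : ℂ)) ((Real.pi : ℂ) / 2) := by
    have e : ∀ n : ℕ, (∫ θ in (0 : ℝ)..Real.pi,
        ω ^ n * ((Real.sin θ * Real.sin ((n + 1) * θ) : ℝ) : ℂ)) =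
        if n = 0 then ((Real.pi : ℂ) / 2) else 0 := by
      intro n
      rw [intervalIntegral.integral_const_mul, intervalIntegral.integral_ofReal,
        integral_sin_mul_sin]
      split_ifs with h <;> simp [h]
    simp_rw [e]
    exact hasSum_ite_eq 0 _
  exact hsum.unique h0

/-- The real case of `integral_sin_sq_div`, which includes the boundary point `ω = -1`. -/
lemma integral_sin_sq_div_real {r : ℝ} (h0 : 0 ≤ r) (h1 : r ≤ 1) :
    ∫ θ in (0 : ℝ)..Real.pi, Real.sin θ ^ 2 / (1 + 2 * r * Real.cos θ + r ^ 2) = Real.pi / 2 := by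
  rcases h1.lt_or_eq with h | rfl
  · have hω : ‖((-r : ℝ) : ℂ)‖ < 1 := by
      rw [Complex.norm_real, Real.norm_eq_abs, abs_neg, abs_of_nonneg h0]; exact h
    have := integral_sin_sq_div hω
    have e : ∀ θ : ℝ, ((Real.sin θ : ℂ) ^ 2) / (1 - 2 * (-r : ℝ) * Real.cos θ + (-r : ℝ) ^ 2) =
        ((Real.sin θ ^ 2 / (1 + 2 * r * Real.cos θ + r ^ 2) : ℝ) : ℂ) := by
      intro θ
      push_cast
      congr 1
      ring
    simp_rw [e] at this
    rw [intervalIntegral.integral_ofReal] at this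
    exact_mod_cast this
  · have e : ∫ θ in (0 : ℝ)..Real.pi, Real.sin θ ^ 2 / (1 + 2 * 1 * Real.cos θ + 1 ^ 2) =
        ∫ θ in (0 : ℝ)..Real.pi, (1 - Real.cos θ) / 2 := by
      refine intervalIntegral.integral_congr_ae ?_
      have hne : ∀ᵐ θ : ℝ, θ ≠ Real.pi := Measure.ae_ne _ _
      filter_upwards [hne] with θ hθ hmem
      rw [Set.uIoc_of_le Real.pi_pos.le] at hmem
      have hcos : -1 < Real.cos θ := by
        rw [← Real.cos_pi]
        exact Real.cos_lt_cos_of_nonneg_of_le_pi hmem.1.le le_rfl (lt_of_le_of_ne hmem.2 hθ)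
      rw [Real.sin_sq, div_eq_div_iff (by linarith) two_ne_zero]
      ring
    rw [e, intervalIntegral.integral_div, intervalIntegral.integral_sub
      intervalIntegrable_const (Real.continuous_cos.intervalIntegrable _ _), integral_cos]
    simp

end PoissonKernel

section MarchenkoPastur

variable {lam α : ℝ}

/-- The angle parametrization `t = α (1 + lam + 2 √lam cos θ)` of `mpInterval lam α`. -/
noncomputable def mpAngle (lam α θ : ℝ) : ℝ := α * (1 + lam + 2 * √lam * Real.cos θ)

/-- The Marchenko–Pastur density with respect to the angle. -/
noncomputable def mpAngleDensity (lam θ : ℝ) : ℝ :=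
  2 * lam / Real.pi * (Real.sin θ ^ 2 / (1 + lam + 2 * √lam * Real.cos θ))

lemma hasDerivAt_mpAngle (lam α θ : ℝ) :
    HasDerivAt (mpAngle lam α) (-(2 * (α * √lam)) * Real.sin θ) θ := by
  have h := (((Real.hasDerivAt_cos θ).const_mul (2 * √lam)).const_add (1 + lam)).const_mul α
  exact h.congr_deriv (by ring)

lemma image_mpAngle (hlam : 0 < lam) (hα : 0 < α) :
    mpAngle lam α '' Set.Icc 0 Real.pi = mpInterval lam α := by
  have hσ : 0 < 2 * (α * √lam) := mul_pos two_pos (mul_pos hα (Real.sqrt_pos.2 hlam))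
  ext t
  rw [mem_mpInterval_iff_abs hlam]
  constructor
  · rintro ⟨θ, -, rfl⟩
    have e : mpAngle lam α θ - α * (1 + lam) = 2 * (α * √lam) * Real.cos θ := by
      rw [mpAngle]; ring
    rw [e, abs_mul, abs_of_pos hσ]
    exact mul_le_of_le_one_right hσ.le (Real.abs_cos_le_one θ)
  · intro ht
    have h1 : |(t - α * (1 + lam)) / (2 * (α * √lam))| ≤ 1 := by
      rw [abs_div, abs_of_pos hσ]; exact (div_le_one hσ).2 ht
    rw [abs_le] at h1
    obtain ⟨θ, hθ, h⟩ := Real.bijOn_cos.surjOn h1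
    refine ⟨θ, hθ, ?_⟩
    rw [mpAngle, h]
    field_simp
    ring

lemma injOn_mpAngle (hlam : 0 < lam) (hα : 0 < α) :
    Set.InjOn (mpAngle lam α) (Set.Icc 0 Real.pi) := by
  intro θ hθ θ' hθ' h
  apply Real.injOn_cos hθ hθ'
  have hs := (Real.sqrt_pos.2 hlam).ne'
  unfold mpAngle at h
  have h1 := mul_left_cancel₀ hα.ne' h
  have h2 := add_left_cancel h1
  exact mul_left_cancel₀ (mul_ne_zero two_ne_zero hs) h2

lemma sin_sq_le (hlam : 0 < lam) (θ : ℝ) :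
    Real.sin θ ^ 2 ≤ 1 + lam + 2 * √lam * Real.cos θ := by
  have h := Real.sq_sqrt hlam.le
  nlinarith [sq_nonneg (√lam + Real.cos θ), Real.sin_sq_add_cos_sq θ]

lemma mpAngleDensity_nonneg (hlam : 0 < lam) (θ : ℝ) : 0 ≤ mpAngleDensity lam θ := by
  have := sin_sq_le hlam θ
  have h2 := sq_nonneg (Real.sin θ)
  exact mul_nonneg (by positivity) (div_nonneg h2 (h2.trans this))

lemma mpAngleDensity_le (hlam : 0 < lam) (θ : ℝ) : mpAngleDensity lam θ ≤ 2 * lam / Real.pi := by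
  have := sin_sq_le hlam θ
  have h2 := sq_nonneg (Real.sin θ)
  exact mul_le_of_le_one_right (by positivity) (div_le_one_of_le₀ this (h2.trans this))

lemma measurable_mpAngleDensity : Measurable (mpAngleDensity lam) := by
  unfold mpAngleDensity; fun_prop

lemma measurable_mpDensity : Measurable (mpDensity lam α) := by
  unfold mpDensity
  exact Measurable.indicator (by fun_prop) measurableSet_Icc

lemma mpDensity_nonneg (hα : 0 < α) (t : ℝ) : 0 ≤ mpDensity lam α t := by
  refine Set.indicator_nonneg (fun t ht => ?_) t
  have : 0 ≤ t := le_trans (by positivity) ht.1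
  positivity

/-- The change of variables between the densities. -/
lemma abs_deriv_mul_mpDensity (hlam : 0 < lam) (hα : 0 < α) {θ : ℝ} (hθ : θ ∈ Set.Icc 0 Real.pi) :
    |-(2 * (α * √lam)) * Real.sin θ| * mpDensity lam α (mpAngle lam α θ) =
      mpAngleDensity lam θ := by
  have hmem : mpAngle lam α θ ∈ mpInterval lam α := image_mpAngle hlam hα ▸ ⟨θ, hθ, rfl⟩
  have hsin : 0 ≤ Real.sin θ := Real.sin_nonneg_of_mem_Icc hθ
  have h := Real.sq_sqrt hlam.le
  have hσ : 0 < 2 * (α * √lam) := mul_pos two_pos (mul_pos hα (Real.sqrt_pos.2 hlam))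
  rw [mpDensity, Set.indicator_of_mem hmem]
  have e1 : 4 * lam * α ^ 2 - (mpAngle lam α θ - α * (1 + lam)) ^ 2 =
      (2 * (α * √lam) * Real.sin θ) ^ 2 := by
    rw [mpAngle]
    linear_combination (-4 * α ^ 2 * (Real.cos θ ^ 2 + Real.sin θ ^ 2)) * h -
      4 * lam * α ^ 2 * Real.sin_sq_add_cos_sq θ
  rw [e1, Real.sqrt_sq (by positivity), abs_mul, abs_neg, abs_of_pos hσ, abs_of_nonneg hsin,
    mpAngleDensity, mpAngle]
  have e2 : 2 * (α * √lam) * Real.sin θ * (1 / (2 * Real.pi * α *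
      (α * (1 + lam + 2 * √lam * Real.cos θ))) * (2 * (α * √lam) * Real.sin θ)) =
      2 * √lam ^ 2 / Real.pi * (Real.sin θ ^ 2 / (1 + lam + 2 * √lam * Real.cos θ)) := by
    rw [show 2 * Real.pi * α * (α * (1 + lam + 2 * √lam * Real.cos θ)) =
      (2 * Real.pi * α ^ 2) * (1 + lam + 2 * √lam * Real.cos θ) by ring, ← div_div]
    field_simp
  rw [e2, h]

/-- The absolutely continuous part of the Marchenko–Pastur law. -/
noncomputable def mpContinuousPart (lam α : ℝ) : Measure ℝ :=
  volume.withDensity fun t => ENNReal.ofReal (mpDensity lam α t)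

lemma marchenkoPastur_eq_add (lam α : ℝ) : marchenkoPastur lam α =
    ENNReal.ofReal (1 - lam) • Measure.dirac 0 + mpContinuousPart lam α := by
  rw [marchenkoPastur]
  split_ifs with h
  · rfl
  · rw [ENNReal.ofReal_of_nonpos (by linarith), zero_smul, zero_add]
    rfl

/-- Integrals against the absolutely continuous part, in terms of the angle. -/
lemma integral_mpContinuousPart {E : Type*} [NormedAddCommGroup E] [NormedSpace ℝ E]
    (hlam : 0 < lam) (hα : 0 < α) (g : ℝ → E) :
    ∫ t, g t ∂(mpContinuousPart lam α) =
      ∫ θ in (0 : ℝ)..Real.pi, mpAngleDensity lam θ • g (mpAngle lam α θ) := by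
  rw [mpContinuousPart, integral_withDensity_eq_integral_toReal_smul
    (measurable_mpDensity.ennreal_ofReal) (Eventually.of_forall fun _ => ENNReal.ofReal_lt_top)]
  simp_rw [ENNReal.toReal_ofReal (mpDensity_nonneg hα _)]
  have e1 : ∀ t, mpDensity lam α t • g t = (mpInterval lam α).indicator
      (fun t => mpDensity lam α t • g t) t := by
    intro t
    by_cases ht : t ∈ mpInterval lam α
    · rw [Set.indicator_of_mem ht]
    · rw [Set.indicator_of_notMem ht, mpDensity, Set.indicator_of_notMem ht, zero_smul]
  rw [integral_congr_ae (Eventually.of_forall e1),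
    integral_indicator (show MeasurableSet (mpInterval lam α) from measurableSet_Icc), ← image_mpAngle hlam hα,
    integral_image_eq_integral_abs_deriv_smul measurableSet_Icc
      (fun θ _ => (hasDerivAt_mpAngle lam α θ).hasDerivWithinAt) (injOn_mpAngle hlam hα),
    intervalIntegral.integral_of_le Real.pi_pos.le, ← integral_Icc_eq_integral_Ioc]
  refine setIntegral_congr_fun measurableSet_Icc fun θ hθ => ?_
  rw [smul_smul, abs_deriv_mul_mpDensity hlam hα hθ]

lemma integrable_mpDensity (hlam : 0 < lam) (hα : 0 < α) : Integrable (mpDensity lam α) := by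
  have h1 : IntegrableOn (mpDensity lam α) (mpInterval lam α) := by
    rw [← image_mpAngle hlam hα, integrableOn_image_iff_integrableOn_abs_deriv_smul measurableSet_Icc
      (fun θ _ => (hasDerivAt_mpAngle lam α θ).hasDerivWithinAt) (injOn_mpAngle hlam hα)]
    have h2 : IntegrableOn (mpAngleDensity lam) (Set.Icc 0 Real.pi) := by
      refine Measure.integrableOn_of_bounded (M := 2 * lam / Real.pi)
        (by simp) measurable_mpAngleDensity.aestronglyMeasurable ?_
      refine Eventually.of_forall fun θ => ?_
      rw [Real.norm_of_nonneg (mpAngleDensity_nonneg hlam θ)]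
      exact mpAngleDensity_le hlam θ
    refine h2.congr_fun (fun θ hθ => ?_) measurableSet_Icc
    exact (abs_deriv_mul_mpDensity hlam hα hθ).symm
  refine (integrableOn_iff_integrable_of_support_subset ?_).1 h1
  exact Set.support_indicator_subset

lemma integral_mpAngleDensity (hlam : 0 < lam) :
    ∫ θ in (0 : ℝ)..Real.pi, mpAngleDensity lam θ = min lam 1 := by
  have h := Real.sq_sqrt hlam.le
  have hs := Real.sqrt_pos.2 hlam
  unfold mpAngleDensity
  rw [intervalIntegral.integral_const_mul]
  rcases le_total lam 1 with h1 | h1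
  · rw [min_eq_left h1]
    have := integral_sin_sq_div_real (Real.sqrt_nonneg lam) (Real.sqrt_le_one.2 h1)
    have e : ∀ θ : ℝ, Real.sin θ ^ 2 / (1 + lam + 2 * √lam * Real.cos θ) =
        Real.sin θ ^ 2 / (1 + 2 * √lam * Real.cos θ + √lam ^ 2) := by
      intro θ; rw [h]; congr 1; ring
    simp_rw [e]
    rw [this]
    field_simp
  · rw [min_eq_right h1]
    have h2 : 1 ≤ √lam := Real.one_le_sqrt.2 h1
    have := integral_sin_sq_div_real (r := 1 / √lam) (by positivity) ((div_le_one hs).2 h2)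
    have e : ∀ θ : ℝ, Real.sin θ ^ 2 / (1 + lam + 2 * √lam * Real.cos θ) =
        1 / lam * (Real.sin θ ^ 2 / (1 + 2 * (1 / √lam) * Real.cos θ + (1 / √lam) ^ 2)) := by
      intro θ
      have e3 : 1 + lam + 2 * √lam * Real.cos θ =
          lam * (1 + 2 * (1 / √lam) * Real.cos θ + (1 / √lam) ^ 2) := by
        rw [div_pow, h]
        field_simp
        linear_combination (2 * Real.cos θ) * h
      rw [e3, one_div_mul_eq_div, div_div, mul_comm lam]
    simp_rw [e]
    rw [intervalIntegral.integral_const_mul, this]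
    field_simp

/-- The absolutely continuous part has mass `min lam 1`, which the atom at `0` completes to `1`. -/
lemma isCompactProbability_marchenkoPastur (hlam : 0 < lam) (hα : 0 < α) :
    IsCompactProbability (marchenkoPastur lam α) := by
  have hmass : mpContinuousPart lam α Set.univ = ENNReal.ofReal (min lam 1) := by
    rw [mpContinuousPart, withDensity_apply _ MeasurableSet.univ, setLIntegral_univ,
      ← ofReal_integral_eq_lintegral_ofReal (integrable_mpDensity hlam hα)
        (Eventually.of_forall (mpDensity_nonneg hα)), ← integral_mpAngleDensity hlam]
    congr 1
    have h1 := integral_mpContinuousPart hlam hα (fun _ => (1 : ℝ))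
    simp only [smul_eq_mul, mul_one] at h1
    rw [← h1, mpContinuousPart, integral_withDensity_eq_integral_toReal_smul
      (measurable_mpDensity.ennreal_ofReal) (Eventually.of_forall fun _ => ENNReal.ofReal_lt_top)]
    simp_rw [ENNReal.toReal_ofReal (mpDensity_nonneg hα _), smul_eq_mul, mul_one]
  have hprob : IsProbabilityMeasure (marchenkoPastur lam α) := by
    refine ⟨?_⟩
    rw [marchenkoPastur_eq_add, Measure.add_apply, Measure.smul_apply, hmass, measure_univ,
      smul_eq_mul, mul_one]
    rcases le_total lam 1 with h | h
    · rw [min_eq_left h, ← ENNReal.ofReal_add (by linarith) hlam.le]; simp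
    · rw [min_eq_right h, ENNReal.ofReal_of_nonpos (by linarith)]; simp
  refine isCompactProbability_of_ae_le (R := α * (1 + √lam) ^ 2) ?_
  have hR : 0 ≤ α * (1 + √lam) ^ 2 := by positivity
  rw [marchenkoPastur_eq_add, ae_add_measure_iff]
  constructor
  · refine Measure.ae_smul_measure ?_ _
    rw [ae_dirac_iff (measurableSet_le (by fun_prop) (by fun_prop))]
    simpa using hR
  · rw [mpContinuousPart, ae_withDensity_iff measurable_mpDensity.ennreal_ofReal]
    refine Eventually.of_forall fun t ht => ?_
    have hmem : t ∈ mpInterval lam α := by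
      by_contra hcon
      rw [mpDensity, Set.indicator_of_notMem hcon, ENNReal.ofReal_zero] at ht
      exact ht rfl
    have h0 : 0 ≤ t := le_trans (by positivity) hmem.1
    rw [abs_of_nonneg h0]
    exact hmem.2

/-- `z G(z) = 1 + √lam ω(z)`, where `ω(z)` is the point of the unit disk with
`α √lam (ω + 1/ω) = z - α (1 + lam)`. -/
theorem cauchyTransform_marchenkoPastur (hlam : 0 < lam) (hα : 0 < α) {z : ℂ} (hz0 : z ≠ 0)
    (hz : z ∉ Complex.ofReal '' mpInterval lam α) :
    cauchyTransform (marchenkoPastur lam α) z = (1 + √lam * joukowskyPoint lam α z) / z := by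
  have hprob := (isCompactProbability_marchenkoPastur hlam hα).prob
  set ω := joukowskyPoint lam α z with hω
  have hω1 := norm_joukowskyPoint_lt_one hlam hα hz
  have hω0 := joukowskyPoint_ne_zero hlam hα hz
  have hωz := mul_joukowskyPoint_add_inv hlam hα hz
  rw [← hω] at hω1 hω0 hωz
  have hne : ∀ t ∈ mpInterval lam α, z - (t : ℂ) ≠ 0 := fun t ht h =>
    hz ⟨t, ht, (sub_eq_zero.1 h).symm⟩
  have hangle : ∀ θ ∈ Set.Icc 0 Real.pi, mpAngle lam α θ ∈ mpInterval lam α := fun θ hθ =>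
    image_mpAngle hlam hα ▸ ⟨θ, hθ, rfl⟩
  have hs : ((√lam : ℝ) : ℂ) ≠ 0 := by exact_mod_cast (Real.sqrt_pos.2 hlam).ne'
  have ha : (α : ℂ) ≠ 0 := by exact_mod_cast hα.ne'
  have hpi : (Real.pi : ℂ) ≠ 0 := by exact_mod_cast Real.pi_ne_zero
  have hlc : (lam : ℂ) = (√lam : ℂ) ^ 2 := by exact_mod_cast (Real.sq_sqrt hlam.le).symm
  -- the absolutely continuous part
  have hcont : ∫ t, 1 / (z - (t : ℂ)) ∂(mpContinuousPart lam α) =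
      ((min lam 1 : ℝ) + √lam * ω) / z := by
    rw [integral_mpContinuousPart hlam hα]
    have e : ∀ θ ∈ Set.uIcc 0 Real.pi, mpAngleDensity lam θ • (1 / (z - (mpAngle lam α θ : ℂ))) =
        1 / z * (mpAngleDensity lam θ : ℂ) + 1 / z * (2 * √lam * ω / Real.pi *
          (((Real.sin θ : ℂ) ^ 2) / (1 - 2 * ω * Real.cos θ + ω ^ 2))) := by
      intro θ hθ
      rw [Set.uIcc_of_le Real.pi_pos.le] at hθ
      have h1 := hne _ (hangle θ hθ)
      have h2 : ω * (z - (mpAngle lam α θ : ℂ)) = α * √lam * (1 - 2 * ω * Real.cos θ + ω ^ 2) := by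
        have : z - (mpAngle lam α θ : ℂ) =
            (α * √lam : ℝ) * (ω + ω⁻¹) - 2 * (α * √lam) * Real.cos θ := by
          rw [hωz, mpAngle]; push_cast; ring
        rw [this]
        push_cast
        field_simp
        ring
      have h3 : 1 - 2 * ω * Real.cos θ + ω ^ 2 ≠ 0 := by
        intro h
        rw [h, mul_zero] at h2
        exact mul_ne_zero hω0 h1 h2
      have h4 : (1 - 2 * ω * Real.cos θ + ω ^ 2 : ℂ) =
          ω * (z - (mpAngle lam α θ : ℂ)) / (α * √lam) := by
        rw [h2]; field_simp
      rw [h4, Complex.real_smul]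
      -- at the left end point for `lam = 1` the angle is `t = 0`, where the numerator vanishes
      by_cases ht : 1 + lam + 2 * √lam * Real.cos θ = 0
      · have h5 := sin_sq_le hlam θ
        rw [ht] at h5
        have h6 : Real.sin θ ^ 2 = 0 := le_antisymm h5 (sq_nonneg _)
        have h7 : (Real.sin θ : ℂ) ^ 2 = 0 := by exact_mod_cast h6
        rw [mpAngleDensity, h6, h7]
        simp
      · have h5 : (mpAngleDensity lam θ : ℂ) = 2 * √lam ^ 2 / Real.pi *
            ((Real.sin θ : ℂ) ^ 2 / ((mpAngle lam α θ : ℂ) / α)) := by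
          rw [mpAngleDensity, mpAngle]
          push_cast
          rw [mul_div_cancel_left₀ _ ha, hlc]
        have h6 : (mpAngle lam α θ : ℂ) ≠ 0 := by
          rw [mpAngle]; exact_mod_cast mul_ne_zero hα.ne' ht
        rw [h5]
        field_simp
        ring
    rw [intervalIntegral.integral_congr e]
    have hi1 : IntervalIntegrable (fun θ => (mpAngleDensity lam θ : ℂ)) volume 0 Real.pi := by
      rw [intervalIntegrable_iff]
      refine Measure.integrableOn_of_bounded (M := 2 * lam / Real.pi) (by simp)
        (Complex.measurable_ofReal.comp measurable_mpAngleDensity).aestronglyMeasurable ?_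
      refine Eventually.of_forall fun θ => ?_
      change ‖((mpAngleDensity lam θ : ℝ) : ℂ)‖ ≤ _
      rw [Complex.norm_real, Real.norm_of_nonneg (mpAngleDensity_nonneg hlam θ)]
      exact mpAngleDensity_le hlam θ
    have hden : ∀ θ : ℝ, (1 - 2 * ω * Real.cos θ + ω ^ 2 : ℂ) ≠ 0 := by
      intro θ h
      have h2 : (1 - 2 * ω * Real.cos θ + ω ^ 2 : ℂ) =
          (1 - ω * Complex.exp (θ * Complex.I)) * (1 - ω * Complex.exp (-θ * Complex.I)) := by
        have : Complex.exp (θ * Complex.I) * Complex.exp (-θ * Complex.I) = 1 := by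
          rw [← Complex.exp_add]; simp
        rw [Complex.ofReal_cos, Complex.cos]
        linear_combination (-ω ^ 2) * this
      rw [h2] at h
      have hx : ∀ x : ℂ, ‖x‖ = 1 → 1 - ω * x ≠ 0 := by
        intro x hx h
        have : ‖ω * x‖ = 1 := by rw [← sub_eq_zero.1 h, norm_one]
        rw [norm_mul, hx, mul_one] at this
        linarith
      have hn := Complex.norm_exp_ofReal_mul_I (-θ)
      rw [Complex.ofReal_neg] at hn
      exact mul_ne_zero (hx _ (Complex.norm_exp_ofReal_mul_I θ)) (hx _ hn) h
    have hi2 : IntervalIntegrable (fun θ : ℝ => ((Real.sin θ : ℂ) ^ 2) /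
        (1 - 2 * ω * Real.cos θ + ω ^ 2)) volume 0 Real.pi := by
      apply Continuous.intervalIntegrable
      exact Continuous.div (by fun_prop) (by fun_prop) hden
    rw [intervalIntegral.integral_add (hi1.const_mul _) ((hi2.const_mul _).const_mul _),
      intervalIntegral.integral_const_mul, intervalIntegral.integral_const_mul,
      intervalIntegral.integral_const_mul, integral_sin_sq_div hω1,
      intervalIntegral.integral_ofReal, integral_mpAngleDensity hlam]
    field_simp
  have hint : Integrable (fun t : ℝ => 1 / (z - (t : ℂ))) (mpContinuousPart lam α) := by
    have hfin : IsFiniteMeasure (mpContinuousPart lam α) := by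
      have hle : mpContinuousPart lam α ≤ marchenkoPastur lam α := by
        rw [marchenkoPastur_eq_add]; exact Measure.le_add_left le_rfl
      exact isFiniteMeasure_of_le _ hle
    have hc : ContinuousOn (fun t : ℝ => 1 / (z - (t : ℂ))) (mpInterval lam α) :=
      ContinuousOn.div (by fun_prop) (by fun_prop) hne
    obtain ⟨C, hC⟩ := IsCompact.exists_bound_of_continuousOn isCompact_Icc hc
    refine Integrable.of_bound
      (by fun_prop : Measurable fun t : ℝ => 1 / (z - (t : ℂ))).aestronglyMeasurable C ?_
    rw [mpContinuousPart, ae_withDensity_iff measurable_mpDensity.ennreal_ofReal]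
    refine Eventually.of_forall fun t ht => ?_
    have hmem : t ∈ mpInterval lam α := by
      by_contra hcon
      rw [mpDensity, Set.indicator_of_notMem hcon, ENNReal.ofReal_zero] at ht
      exact ht rfl
    exact hC t hmem
  rw [cauchyTransform, marchenkoPastur_eq_add, integral_add_measure _ hint, integral_smul_measure,
    integral_dirac, hcont]
  · rcases le_total lam 1 with h | h
    · rw [min_eq_left h, ENNReal.toReal_ofReal (by linarith), Complex.real_smul]
      push_cast
      field_simp
      ring
    · rw [min_eq_right h, ENNReal.ofReal_of_nonpos (by linarith)]
      simp
  · exact (integrable_dirac (by simp)).smul_measure ENNReal.ofReal_ne_top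

end MarchenkoPastur

/-! ### The equation for the Cauchy transform and the free cumulants of the limit -/

section Equation

variable {lam α : ℝ}

/-- The equation for `ω` in factored form, `z = α (1 + √lam ω) (1 + √lam / ω)`. -/
lemma eq_mul_div_joukowskyPoint (hlam : 0 < lam) (hα : 0 < α) {z : ℂ}
    (hz : z ∉ Complex.ofReal '' mpInterval lam α) :
    z = α * (1 + √lam * joukowskyPoint lam α z) * (joukowskyPoint lam α z + √lam) /
      joukowskyPoint lam α z := by
  have h := mul_joukowskyPoint_add_inv hlam hα hz
  have hω := joukowskyPoint_ne_zero hlam hα hz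
  have hlc : (lam : ℂ) = (√lam : ℂ) ^ 2 := by exact_mod_cast (Real.sq_sqrt hlam.le).symm
  set ω := joukowskyPoint lam α z
  rw [hlc] at h
  push_cast at h
  rw [eq_div_iff hω]
  have h2 : ω⁻¹ * ω = 1 := inv_mul_cancel₀ hω
  linear_combination (-ω) * h + α * √lam * h2

lemma joukowskyPoint_add_sqrt_ne_zero (hlam : 0 < lam) (hα : 0 < α) {z : ℂ} (hz0 : z ≠ 0)
    (hz : z ∉ Complex.ofReal '' mpInterval lam α) : joukowskyPoint lam α z + √lam ≠ 0 := by
  intro h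
  have := eq_mul_div_joukowskyPoint hlam hα hz
  rw [h, mul_zero, zero_div] at this
  exact hz0 this

lemma cauchyTransform_marchenkoPastur_eq_div (hlam : 0 < lam) (hα : 0 < α) {z : ℂ} (hz0 : z ≠ 0)
    (hz : z ∉ Complex.ofReal '' mpInterval lam α) :
    cauchyTransform (marchenkoPastur lam α) z =
      joukowskyPoint lam α z / (α * (joukowskyPoint lam α z + √lam)) := by
  have h1 := eq_mul_div_joukowskyPoint hlam hα hz
  have h2 := joukowskyPoint_add_sqrt_ne_zero hlam hα hz0 hz
  have hω := joukowskyPoint_ne_zero hlam hα hz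
  have ha : (α : ℂ) ≠ 0 := by exact_mod_cast hα.ne'
  rw [cauchyTransform_marchenkoPastur hlam hα hz0 hz, div_eq_div_iff hz0 (mul_ne_zero ha h2)]
  rw [eq_div_iff hω] at h1
  linear_combination -h1

/-- With `α G = ω / (ω + √lam)` and `1 - α G = √lam / (ω + √lam)`, the two summands are
`α (1 + √lam / ω)` and `α √lam (ω + √lam)`. -/
lemma cauchyTransform_marchenkoPastur_equation (hlam : 0 < lam) (hα : 0 < α) {z : ℂ} (hz0 : z ≠ 0)
    (hz : z ∉ Complex.ofReal '' mpInterval lam α) :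
    cauchyTransform (marchenkoPastur lam α) z ≠ 0 ∧
      1 - α * cauchyTransform (marchenkoPastur lam α) z ≠ 0 ∧
      1 / cauchyTransform (marchenkoPastur lam α) z
        + lam * α / (1 - α * cauchyTransform (marchenkoPastur lam α) z) = z := by
  have h2 := joukowskyPoint_add_sqrt_ne_zero hlam hα hz0 hz
  have hω := joukowskyPoint_ne_zero hlam hα hz
  have ha : (α : ℂ) ≠ 0 := by exact_mod_cast hα.ne'
  have hs : ((√lam : ℝ) : ℂ) ≠ 0 := by exact_mod_cast (Real.sqrt_pos.2 hlam).ne'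
  have hlc : (lam : ℂ) = (√lam : ℂ) ^ 2 := by exact_mod_cast (Real.sq_sqrt hlam.le).symm
  have h1 := eq_mul_div_joukowskyPoint hlam hα hz
  rw [cauchyTransform_marchenkoPastur_eq_div hlam hα hz0 hz]
  set ω := joukowskyPoint lam α z
  have e : 1 - α * (ω / (α * (ω + √lam))) = √lam / (ω + √lam) := by
    field_simp
    ring
  refine ⟨div_ne_zero hω (mul_ne_zero ha h2), ?_, ?_⟩
  · rw [e]; exact div_ne_zero hs h2
  · rw [e, hlc]
    conv_rhs => rw [h1]
    field_simp

lemma cauchyTransform_marchenkoPastur_eq_mpRoot (hlam : 0 < lam) (hα : 0 < α) {z : ℂ} (hz0 : z ≠ 0)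
    (hz : z ∉ Complex.ofReal '' mpInterval lam α) :
    cauchyTransform (marchenkoPastur lam α) z =
      (z + α * (1 - lam) - mpRoot lam α z) / (2 * α * z) := by
  have ha : (α : ℂ) ≠ 0 := by exact_mod_cast hα.ne'
  rw [cauchyTransform_marchenkoPastur hlam hα hz0 hz, mpRoot_eq hlam hα]
  push_cast
  field_simp
  ring

lemma tendsto_mul_cauchyTransform_marchenkoPastur (hlam : 0 < lam) (hα : 0 < α) :
    Tendsto (fun z : ℂ => z * cauchyTransform (marchenkoPastur lam α) z)
      (Bornology.cobounded ℂ) (𝓝 1) := by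
  have h := ((tendsto_joukowskyPoint hlam hα).const_mul ((√lam : ℝ) : ℂ)).const_add 1
  rw [mul_zero, add_zero] at h
  refine h.congr' ?_
  filter_upwards [eventually_notMem_mpInterval (lam := lam) (α := α),
    (Bornology.eventually_ne_cobounded (0 : ℂ))] with z hz hz0
  rw [cauchyTransform_marchenkoPastur hlam hα hz0 hz]
  field_simp

lemma tendsto_cauchyTransform_marchenkoPastur (hlam : 0 < lam) (hα : 0 < α) :
    Tendsto (cauchyTransform (marchenkoPastur lam α)) (Bornology.cobounded ℂ) (𝓝 0) := by
  have h := (tendsto_inv₀_cobounded (α := ℂ)).mul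
    (tendsto_mul_cauchyTransform_marchenkoPastur hlam hα)
  rw [zero_mul] at h
  refine h.congr' ?_
  filter_upwards [(Bornology.eventually_ne_cobounded (0 : ℂ))] with z hz0
  field_simp

end Equation

section Evaluation

open PowerSeries

/-- The power series `f` converges absolutely on the disk of radius `r`, to the function `g`. -/
def EvaluatesTo (r : ℝ) (f : PowerSeries ℂ) (g : ℂ → ℂ) : Prop :=
  ∀ x : ℂ, ‖x‖ < r → Summable (fun n => ‖coeff n f * x ^ n‖) ∧ ∑' n, coeff n f * x ^ n = g x

variable {r : ℝ} {f f' : PowerSeries ℂ} {g g' : ℂ → ℂ}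

lemma EvaluatesTo.add (h : EvaluatesTo r f g) (h' : EvaluatesTo r f' g') :
    EvaluatesTo r (f + f') (fun x => g x + g' x) := by
  intro x hx
  obtain ⟨h1, h2⟩ := h x hx
  obtain ⟨h1', h2'⟩ := h' x hx
  simp only [map_add, add_mul]
  refine ⟨(h1.add h1').of_nonneg_of_le (fun _ => norm_nonneg _) fun _ => norm_add_le _ _, ?_⟩
  rw [h1.of_norm.tsum_add h1'.of_norm, h2, h2']

lemma EvaluatesTo.mul (h : EvaluatesTo r f g) (h' : EvaluatesTo r f' g') :
    EvaluatesTo r (f * f') (fun x => g x * g' x) := by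
  intro x hx
  obtain ⟨h1, h2⟩ := h x hx
  obtain ⟨h1', h2'⟩ := h' x hx
  have e : ∀ n, coeff n (f * f') * x ^ n = ∑ p ∈ Finset.HasAntidiagonal.antidiagonal n,
      (coeff p.1 f * x ^ p.1) * (coeff p.2 f' * x ^ p.2) := by
    intro n
    rw [coeff_mul, Finset.sum_mul]
    refine Finset.sum_congr rfl fun p hp => ?_
    rw [← Finset.HasAntidiagonal.mem_antidiagonal.1 hp, pow_add]
    ring
  refine ⟨(summable_norm_sum_mul_antidiagonal_of_summable_norm h1 h1').congr fun n =>
    congrArg norm (e n).symm, ?_⟩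
  rw [tsum_congr e, ← tsum_mul_tsum_eq_tsum_sum_antidiagonal_of_summable_norm h1 h1', h2, h2']

lemma evaluatesTo_C (c : ℂ) : EvaluatesTo r (C c) (fun _ => c) := by
  intro x _
  have e : ∀ n, coeff n (C c) * x ^ n = if n = 0 then c else 0 := by
    intro n
    rw [coeff_C]
    split_ifs with h <;> simp [h]
  have hs : HasSum (fun n => ‖coeff n (C c) * x ^ n‖) ‖c‖ := by
    convert hasSum_ite_eq 0 ‖c‖ using 2 with n
    rw [e]
    split_ifs <;> simp
  refine ⟨hs.summable, ?_⟩
  simp_rw [e]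
  exact tsum_ite_eq 0 _

lemma evaluatesTo_X : EvaluatesTo r X (fun x => x) := by
  intro x _
  have e : ∀ n, coeff n (X : PowerSeries ℂ) * x ^ n = if n = 1 then x else 0 := by
    intro n
    rw [coeff_X]
    split_ifs with h <;> simp [h]
  have hs : HasSum (fun n => ‖coeff n (X : PowerSeries ℂ) * x ^ n‖) ‖x‖ := by
    convert hasSum_ite_eq 1 ‖x‖ using 2 with n
    rw [e]
    split_ifs <;> simp
  refine ⟨hs.summable, ?_⟩
  simp_rw [e]
  exact tsum_ite_eq 1 _

/-- A power series that sums to zero near the origin vanishes. -/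
lemma EvaluatesTo.eq_zero (hr : 0 < r) (h : EvaluatesTo r f g) (hg : ∀ x, ‖x‖ < r → g x = 0) :
    f = 0 := by
  have hp : HasFPowerSeriesAt (0 : ℂ → ℂ)
      (FormalMultilinearSeries.ofScalars ℂ fun n => coeff n f) 0 := by
    rw [hasFPowerSeriesAt_iff]
    filter_upwards [Metric.ball_mem_nhds (0 : ℂ) hr] with x hx
    have hx' : ‖x‖ < r := by simpa using hx
    obtain ⟨h1, h2⟩ := h x hx'
    have h3 := h1.of_norm.hasSum
    rw [h2, hg x hx'] at h3
    simpa [FormalMultilinearSeries.coeff_ofScalars, mul_comm] using h3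
  have h0 := hp.eq_zero
  ext n
  have := FormalMultilinearSeries.coeff_ofScalars (𝕜 := ℂ) (p := fun n => coeff n f) (n := n)
  rw [h0] at this
  exact this.symm

end Evaluation

/-- The expansion of the Cauchy transform at infinity, in terms of `x = 1 / z`. -/
lemma evaluatesTo_momentSeries {μ : Measure ℝ} (hμ : IsCompactProbability μ) {R : ℝ} (hR1 : 1 ≤ R)
    (hR : ∀ᵐ t ∂μ, |t| ≤ R) : EvaluatesTo R⁻¹ (momentSeries (measureMoment μ))
      (fun x => ∫ t : ℝ, 1 / (1 - x * t) ∂μ) := by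
  have := hμ.prob
  intro x hx
  have hR0 : 0 < R := by linarith
  have hq : ‖x‖ * R < 1 := by rwa [← lt_div_iff₀ hR0, one_div]
  have hb : ∀ n : ℕ, ∀ᵐ t : ℝ ∂μ, ‖((t : ℂ) ^ n * x ^ n)‖ ≤ (‖x‖ * R) ^ n := by
    intro n
    filter_upwards [hR] with t ht
    rw [norm_mul, norm_pow, norm_pow, Complex.norm_real, Real.norm_eq_abs, ← mul_pow, mul_comm]
    gcongr
  have hcoeff : ∀ n : ℕ, PowerSeries.coeff n (momentSeries (measureMoment μ)) * x ^ n =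
      ∫ t : ℝ, (t : ℂ) ^ n * x ^ n ∂μ := by
    intro n
    rw [integral_mul_const, momentSeries, PowerSeries.coeff_mk, measureMoment,
      ← integral_complex_ofReal]
    simp_rw [Complex.ofReal_pow]
  have hgeo : Summable fun n : ℕ => (‖x‖ * R) ^ n :=
    summable_geometric_of_lt_one (by positivity) hq
  refine ⟨hgeo.of_nonneg_of_le (fun _ => norm_nonneg _) fun n => ?_, ?_⟩
  · rw [hcoeff]
    have := norm_integral_le_of_norm_le_const (hb n)
    simpa using this
  · simp_rw [hcoeff]
    refine HasSum.tsum_eq ?_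
    refine hasSum_integral_of_dominated_convergence (fun n _ => (‖x‖ * R) ^ n)
      (fun n => (by fun_prop : Continuous fun t : ℝ => (t : ℂ) ^ n * x ^ n).aestronglyMeasurable)
      hb (Eventually.of_forall fun _ => hgeo) (integrable_const _) ?_
    filter_upwards [hR] with t ht
    have h1 : ‖(t : ℂ) * x‖ < 1 := by
      rw [norm_mul, Complex.norm_real, Real.norm_eq_abs, mul_comm]
      exact lt_of_le_of_lt (by gcongr) hq
    have := hasSum_geometric_of_norm_lt_one h1
    simp_rw [mul_pow] at this
    rwa [mul_comm x, one_div]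

section Cumulants

variable {lam α : ℝ}

open PowerSeries

/-- The quadratic equation `α z M² - M - α (1 - lam) z M + 1 = 0` for the moment series, which is the
equation for `G` at `1 / z`, where `G(1 / z) = z M(z)`. -/
lemma momentSeries_marchenkoPastur_equation (hlam : 0 < lam) (hα : 0 < α) :
    C (α : ℂ) * X * (momentSeries (measureMoment (marchenkoPastur lam α)) *
        momentSeries (measureMoment (marchenkoPastur lam α))) +
      (C (-1 : ℂ) * momentSeries (measureMoment (marchenkoPastur lam α)) +
      (C (-(α * (1 - lam)) : ℂ) * X * momentSeries (measureMoment (marchenkoPastur lam α)) +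
        C (1 : ℂ))) = 0 := by
  have hc := isCompactProbability_marchenkoPastur hlam hα
  have := hc.prob
  obtain ⟨R₀, hR₀, hR₀'⟩ := hc.exists_ae_le
  -- enlarge the radius so that the points `1 / x` are off the interval
  obtain ⟨R₁, hR₁⟩ := (isCompact_image_mpInterval (lam := lam) (α := α)).isBounded.exists_norm_le
  set R := max R₀ R₁ with hRdef
  have hR1 : 1 ≤ R := hR₀.trans (le_max_left _ _)
  have hM := evaluatesTo_momentSeries hc hR1 (hR₀'.mono fun t ht => ht.trans (le_max_left _ _))
  set M := momentSeries (measureMoment (marchenkoPastur lam α))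
  refine EvaluatesTo.eq_zero (r := R⁻¹) (by positivity)
    (((evaluatesTo_C _).mul evaluatesTo_X).mul (hM.mul hM) |>.add
      (((evaluatesTo_C _).mul hM).add
        ((((evaluatesTo_C _).mul evaluatesTo_X).mul hM).add (evaluatesTo_C _)))) ?_
  intro x hx
  rcases eq_or_ne x 0 with rfl | hx0
  · simp
  have hxR : R < ‖x⁻¹‖ := by
    rw [norm_inv]
    exact (lt_inv_comm₀ (by positivity) (by positivity)).1 hx
  have hz : x⁻¹ ∉ Complex.ofReal '' mpInterval lam α := fun h =>
    absurd (hR₁ _ h) (not_le.2 ((le_max_right _ _).trans_lt hxR))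
  have hG : ∫ t : ℝ, 1 / (1 - x * t) ∂(marchenkoPastur lam α) =
      x⁻¹ * cauchyTransform (marchenkoPastur lam α) x⁻¹ := by
    rw [cauchyTransform, ← integral_const_mul]
    refine integral_congr_ae (Eventually.of_forall fun t => ?_)
    dsimp only
    rw [show 1 - x * t = x * (x⁻¹ - t) by rw [mul_sub, mul_inv_cancel₀ hx0], one_div, mul_inv,
      one_div]
  obtain ⟨h1, h2, h3⟩ :=
    cauchyTransform_marchenkoPastur_equation hlam hα (inv_ne_zero hx0) hz
  rw [hG]
  set G := cauchyTransform (marchenkoPastur lam α) x⁻¹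
  have h4 : (1 - α * G) * x + lam * α * G * x = G * (1 - α * G) := by
    rw [div_add_div _ _ h1 h2, div_eq_iff (mul_ne_zero h1 h2)] at h3
    have h5 : x * x⁻¹ = 1 := mul_inv_cancel₀ hx0
    linear_combination x * h3 + G * (1 - α * G) * h5
  field_simp
  linear_combination h4

/-- The quadratic equation for `M` says `M = C(z M)` with
`C(w) = 1 + ∑ lam αⁿ wⁿ = 1 + lam α w / (1 - α w)`. -/
lemma measureFreeCumulant_marchenkoPastur (hlam : 0 < lam) (hα : 0 < α) {n : ℕ} (hn : 1 ≤ n) :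
    measureFreeCumulant (marchenkoPastur lam α) n = lam * α ^ n := by
  have hc := isCompactProbability_marchenkoPastur hlam hα
  have h := momentSeries_marchenkoPastur_equation hlam hα
  have h0 := hc.measureMoment_zero
  set m := measureMoment (marchenkoPastur lam α) with hm
  set D : PowerSeries ℂ := PowerSeries.mk fun n => if n = 0 then 1 else (lam * α ^ n : ℂ) with hD
  have hDeq : D * (1 - C (α : ℂ) * X) = 1 - C (α : ℂ) * X + C (lam * α : ℂ) * X := by
    ext k
    rcases k with _ | k
    · simp [hD]
    · rw [mul_sub, mul_one, ← mul_assoc, mul_comm D, mul_assoc, map_sub, map_add, map_sub]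
      rw [coeff_C_mul, coeff_succ_mul_X, coeff_C_mul, coeff_C_mul, coeff_X, hD, coeff_mk, coeff_mk,
        coeff_one]
      rcases k with _ | k
      · simp
        ring
      · simp
        ring
  set M := momentSeries m
  have hsub : HasSubst (X * M) := HasSubst.of_constantCoeff_zero' (by simp)
  have hne : 1 - C (α : ℂ) * (X * M) ≠ 0 := by
    intro h
    have := congrArg constantCoeff h
    simp at this
  have h1 : D.subst (X * M) * (1 - C (α : ℂ) * (X * M)) =
      1 - C (α : ℂ) * (X * M) + C (lam * α : ℂ) * (X * M) := by
    have := congrArg (fun f => f.subst (X * M)) hDeq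
    have hC : ∀ c : ℂ, (C c : PowerSeries ℂ).subst (X * M) = C c := fun c => by
      have := (substAlgHom hsub).commutes c
      rw [coe_substAlgHom] at this
      exact this
    have hsubst_sub : ∀ a b : PowerSeries ℂ, (a - b).subst (X * M) =
        a.subst (X * M) - b.subst (X * M) := fun a b => by
      rw [← coe_substAlgHom hsub, map_sub]
    have hone : (1 : PowerSeries ℂ).subst (X * M) = 1 := by
      rw [← coe_substAlgHom hsub, map_one]
    rw [subst_mul hsub, subst_add hsub, hsubst_sub, subst_mul hsub, subst_mul hsub, hC, hC,
      subst_X hsub, hone] at this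
    exact this
  have h2 : M = D.subst (X * M) := by
    apply mul_right_cancel₀ hne
    rw [h1]
    simp only [map_neg, map_mul, map_sub, map_one] at h ⊢
    linear_combination -h
  have h3 := cumulantSeries_eq_of_subst h0 h2
  have h4 := coeff_cumulantSeries m hn
  rw [h3, hD, coeff_mk, if_neg (by omega)] at h4
  have h5 : measureFreeCumulant (marchenkoPastur lam α) n = freeCumulant m n := rfl
  rw [h5]
  exact_mod_cast h4.symm

theorem isCompactProbability_and_freeCumulant_eq_iff (hlam : 0 < lam) (hα : 0 < α) (μ : Measure ℝ) :
    (IsCompactProbability μ ∧ ∀ n : ℕ, 1 ≤ n → measureFreeCumulant μ n = lam * α ^ n) ↔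
      μ = marchenkoPastur lam α := by
  have hc := isCompactProbability_marchenkoPastur hlam hα
  constructor
  · rintro ⟨hμ, h⟩
    exact hμ.ext_of_freeCumulants hc fun n hn => by
      rw [h n hn, measureFreeCumulant_marchenkoPastur hlam hα hn]
  · rintro rfl
    exact ⟨hc, fun n hn => measureFreeCumulant_marchenkoPastur hlam hα hn⟩

lemma hasSum_freeCumulant_marchenkoPastur (hlam : 0 < lam) (hα : 0 < α) {w : ℂ}
    (hw : ‖w‖ < 1 / α) :
    HasSum (fun n : ℕ => (measureFreeCumulant (marchenkoPastur lam α) (n + 1) : ℂ) * w ^ n)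
      (lam * α / (1 - α * w)) := by
  have h1 : ‖(α : ℂ) * w‖ < 1 := by
    rw [norm_mul, Complex.norm_real, Real.norm_of_nonneg hα.le, mul_comm]
    exact (lt_div_iff₀ hα).1 hw
  have h := (hasSum_geometric_of_norm_lt_one h1).mul_left (lam * α : ℂ)
  rw [← div_eq_mul_inv] at h
  refine h.congr_fun fun n => ?_
  rw [measureFreeCumulant_marchenkoPastur hlam hα (by omega)]
  push_cast
  ring

lemma voiculescuTransform_marchenkoPastur (hlam : 0 < lam) (hα : 0 < α) {w : ℂ}
    (hw : ‖w‖ < 1 / α) :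
    voiculescuTransform (marchenkoPastur lam α) w = 1 / w + lam * α / (1 - α * w) := by
  rw [voiculescuTransform, (hasSum_freeCumulant_marchenkoPastur hlam hα hw).tsum_eq]

lemma voiculescuTransform_cauchyTransform_marchenkoPastur (hlam : 0 < lam) (hα : 0 < α) :
    ∀ᶠ z : ℂ in Bornology.cobounded ℂ,
      voiculescuTransform (marchenkoPastur lam α) (cauchyTransform (marchenkoPastur lam α) z)
        = z := by
  have h := (tendsto_cauchyTransform_marchenkoPastur hlam hα).norm
  rw [norm_zero] at h
  filter_upwards [h.eventually (gt_mem_nhds (one_div_pos.2 hα)),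
    eventually_notMem_mpInterval (lam := lam) (α := α),
    Bornology.eventually_ne_cobounded (0 : ℂ)] with z hG hz hz0
  rw [voiculescuTransform_marchenkoPastur hlam hα hG]
  exact (cauchyTransform_marchenkoPastur_equation hlam hα hz0 hz).2.2

end Cumulants

section Stieltjes

variable {lam α : ℝ}

/-- On the cut the root tends from above to `i √(4 lam α² - (t - α (1 + lam))²)`: its square tends
to the negative of the radicand, and its imaginary part is positive. -/
lemma tendsto_mpRoot_of_mem (hlam : 0 < lam) (hα : 0 < α) {t : ℝ} (ht : t ∈ mpInterval lam α) :
    Tendsto (fun ε : ℝ => mpRoot lam α (t + ε * Complex.I)) (𝓝[>] 0)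
      (𝓝 ((√(4 * lam * α ^ 2 - (t - α * (1 + lam)) ^ 2) : ℝ) * Complex.I)) := by
  have hD := Real.sq_sqrt (sub_nonneg.2 ((mem_mpInterval_iff_sq hlam hα t).1 ht))
  set D := √(4 * lam * α ^ 2 - (t - α * (1 + lam)) ^ 2)
  have hD0 : 0 ≤ D := Real.sqrt_nonneg _
  have hDc : (D : ℂ) ^ 2 = 4 * lam * α ^ 2 - (t - α * (1 + lam)) ^ 2 := by exact_mod_cast hD
  have hlim : Tendsto (fun ε : ℝ => √‖((t : ℂ) + ε * Complex.I - α * (1 + lam)) ^ 2 -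
      4 * lam * α ^ 2 + (D : ℂ) ^ 2‖) (𝓝[>] 0) (𝓝 0) := by
    have hcont : Continuous (fun ε : ℝ => √‖((t : ℂ) + ε * Complex.I - α * (1 + lam)) ^ 2 -
      4 * lam * α ^ 2 + (D : ℂ) ^ 2‖) := by fun_prop
    have := hcont.tendsto 0
    rw [show √‖((t : ℂ) + (0 : ℝ) * Complex.I - α * (1 + lam)) ^ 2 -
      4 * lam * α ^ 2 + (D : ℂ) ^ 2‖ = 0 by rw [hDc]; simp] at this
    exact this.mono_left nhdsWithin_le_nhds
  rw [tendsto_iff_norm_sub_tendsto_zero]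
  refine squeeze_zero' (Eventually.of_forall fun _ => norm_nonneg _) ?_ hlim
  filter_upwards [self_mem_nhdsWithin] with ε hε
  have hε' : 0 < ((t : ℂ) + ε * Complex.I).im := by simpa using hε
  have hs := im_mpRoot_pos hlam hα hε'
  have hzI : (t : ℂ) + ε * Complex.I ∉ Complex.ofReal '' mpInterval lam α := by
    rintro ⟨u, -, hu⟩
    rw [← hu] at hε'
    simp at hε'
  have hsq := mpRoot_sq hlam hα hzI
  set s := mpRoot lam α (t + ε * Complex.I)
  apply Real.le_sqrt_of_sq_le
  have e : ((t : ℂ) + ε * Complex.I - α * (1 + lam)) ^ 2 - 4 * lam * α ^ 2 + (D : ℂ) ^ 2 =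
      (s - D * Complex.I) * (s + D * Complex.I) := by
    rw [← hsq]; linear_combination D ^ 2 * Complex.I_sq
  rw [e, norm_mul, pow_two]
  gcongr
  -- the point `s` of the upper half plane is closer to `i D` than to `-i D`
  rw [← sq_le_sq₀ (norm_nonneg _) (norm_nonneg _), Complex.sq_norm, Complex.sq_norm,
    Complex.normSq_apply, Complex.normSq_apply]
  simp
  nlinarith [mul_nonneg hD0 hs.le]

/-- Off the interval the square of the root is positive on the line, hence the root is real. -/
lemma im_mpRoot_ofReal (hlam : 0 < lam) (hα : 0 < α) {t : ℝ} (ht : t ∉ mpInterval lam α) :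
    (mpRoot lam α t).im = 0 := by
  have hzI : (t : ℂ) ∉ Complex.ofReal '' mpInterval lam α := by
    rintro ⟨u, hu, h⟩
    exact ht (Complex.ofReal_injective h ▸ hu)
  have hsq := mpRoot_sq hlam hα hzI
  have hpos : 0 < (t - α * (1 + lam)) ^ 2 - 4 * lam * α ^ 2 := by
    rw [mem_mpInterval_iff_sq hlam hα, not_le] at ht
    linarith
  set r := (t - α * (1 + lam)) ^ 2 - 4 * lam * α ^ 2
  have hr : ((t : ℂ) - α * (1 + lam)) ^ 2 - 4 * lam * α ^ 2 = ((√r : ℝ) : ℂ) ^ 2 := by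
    have := Real.sq_sqrt hpos.le
    exact_mod_cast this.symm
  rw [hr, sq_eq_sq_iff_eq_or_eq_neg] at hsq
  rcases hsq with h | h <;> rw [h] <;> simp

lemma tendsto_mpRoot_of_notMem (hlam : 0 < lam) (hα : 0 < α) {t : ℝ} (ht : t ∉ mpInterval lam α) :
    Tendsto (fun ε : ℝ => mpRoot lam α (t + ε * Complex.I)) (𝓝[>] 0) (𝓝 (mpRoot lam α t)) := by
  have hzI : (t : ℂ) ∉ Complex.ofReal '' mpInterval lam α := by
    rintro ⟨u, hu, h⟩
    exact ht (Complex.ofReal_injective h ▸ hu)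
  have hc : ContinuousAt (mpRoot lam α) t :=
    (differentiableOn_mpRoot hlam hα).continuousOn.continuousAt
      (isCompact_image_mpInterval.isClosed.isOpen_compl.mem_nhds hzI)
  have h1 : Tendsto (fun ε : ℝ => (t : ℂ) + ε * Complex.I) (𝓝 0) (𝓝 (t : ℂ)) := by
    have := (by fun_prop : Continuous fun ε : ℝ => (t : ℂ) + ε * Complex.I).tendsto 0
    simpa using this
  exact (hc.tendsto.comp h1).mono_left nhdsWithin_le_nhds

lemma exists_tendsto_mpRoot (hlam : 0 < lam) (hα : 0 < α) {t : ℝ} (ht : t ≠ 0) :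
    ∃ s : ℂ, Tendsto (fun ε : ℝ => mpRoot lam α (t + ε * Complex.I)) (𝓝[>] 0) (𝓝 s) ∧
      s.im = 2 * Real.pi * α * t * mpDensity lam α t := by
  by_cases h : t ∈ mpInterval lam α
  · refine ⟨_, tendsto_mpRoot_of_mem hlam hα h, ?_⟩
    rw [mpDensity, Set.indicator_of_mem h]
    simp only [Complex.mul_im, Complex.ofReal_re, Complex.I_im, mul_one, Complex.ofReal_im,
      Complex.I_re, mul_zero, add_zero]
    field_simp
  · refine ⟨_, tendsto_mpRoot_of_notMem hlam hα h, ?_⟩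
    rw [mpDensity, Set.indicator_of_notMem h, im_mpRoot_ofReal hlam hα h, mul_zero]

theorem stieltjes_inversion_marchenkoPastur (hlam : 0 < lam) (hα : 0 < α) {t : ℝ} (ht : t ≠ 0) :
    Tendsto (fun ε : ℝ =>
        -(1 / Real.pi) * (cauchyTransform (marchenkoPastur lam α) (t + ε * Complex.I)).im)
      (𝓝[>] 0) (𝓝 (mpDensity lam α t)) := by
  obtain ⟨s, hs, him⟩ := exists_tendsto_mpRoot hlam hα ht
  have hz : Tendsto (fun ε : ℝ => (t : ℂ) + ε * Complex.I) (𝓝[>] 0) (𝓝 (t : ℂ)) := by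
    have := (by fun_prop : Continuous fun ε : ℝ => (t : ℂ) + ε * Complex.I).tendsto 0
    rw [Complex.ofReal_zero, zero_mul, add_zero] at this
    exact this.mono_left nhdsWithin_le_nhds
  have htc : (t : ℂ) ≠ 0 := by exact_mod_cast ht
  have ha : (α : ℂ) ≠ 0 := by exact_mod_cast hα.ne'
  have hG : Tendsto (fun ε : ℝ => cauchyTransform (marchenkoPastur lam α) (t + ε * Complex.I))
      (𝓝[>] 0) (𝓝 ((t + α * (1 - lam) - s) / (2 * α * t))) := by
    refine Tendsto.congr' ?_ (((hz.add_const _).sub hs).div (hz.const_mul (2 * α : ℂ))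
      (mul_ne_zero (mul_ne_zero two_ne_zero ha) htc))
    filter_upwards [self_mem_nhdsWithin] with ε hε
    have hε' : 0 < ((t : ℂ) + ε * Complex.I).im := by simpa using hε
    refine (cauchyTransform_marchenkoPastur_eq_mpRoot hlam hα ?_ ?_).symm
    · intro h
      rw [h] at hε'
      simp at hε'
    · rintro ⟨u, -, hu⟩
      rw [← hu] at hε'
      simp at hε'
  have h := ((Complex.continuous_im.tendsto _).comp hG).const_mul (-(1 / Real.pi))
  have hval : -(1 / Real.pi) * ((t + α * (1 - lam) - s) / (2 * α * t) : ℂ).im =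
      mpDensity lam α t := by
    have e : ((t + α * (1 - lam) - s) / (2 * α * t) : ℂ) =
        ((t + α * (1 - lam) : ℝ) - s) / ((2 * α * t : ℝ) : ℂ) := by push_cast; rfl
    rw [e, Complex.div_ofReal_im, Complex.sub_im, Complex.ofReal_im, him]
    field_simp
    ring
  rw [hval] at h
  exact h

end Stieltjes

/-! ### Rare events and the limit theorem -/

section RareEvents

variable {lam α : ℝ}

lemma integral_rareEventMeasure (hlam : 0 < lam) {N : ℕ} (hN : lam ≤ N) (f : ℝ → ℝ) :
    ∫ t, f t ∂(rareEventMeasure lam α N) = (1 - lam / N) * f 0 + lam / N * f α := by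
  have hN0 : (0 : ℝ) < N := hlam.trans_le hN
  have h1 : lam / N ≤ 1 := (div_le_one hN0).2 hN
  have h2 : 0 ≤ lam / N := by positivity
  have hi : ∀ a : ℝ, Integrable f (Measure.dirac a) := fun a => integrable_dirac (by simp)
  rw [rareEventMeasure, integral_add_measure ((hi 0).smul_measure ENNReal.ofReal_ne_top)
    ((hi α).smul_measure ENNReal.ofReal_ne_top), integral_smul_measure, integral_smul_measure,
    integral_dirac, integral_dirac, ENNReal.toReal_ofReal (by linarith), ENNReal.toReal_ofReal h2,
    smul_eq_mul, smul_eq_mul]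

lemma isCompactProbability_rareEventMeasure (hlam : 0 < lam) {N : ℕ} (hN : lam ≤ N) :
    IsCompactProbability (rareEventMeasure lam α N) := by
  have hN0 : (0 : ℝ) < N := hlam.trans_le hN
  have h1 : lam / N ≤ 1 := (div_le_one hN0).2 hN
  have h2 : 0 ≤ lam / N := by positivity
  have hprob : IsProbabilityMeasure (rareEventMeasure lam α N) := by
    constructor
    simp only [rareEventMeasure, Measure.add_apply, Measure.smul_apply, measure_univ, smul_eq_mul,
      mul_one]
    rw [← ENNReal.ofReal_add (by linarith) h2, sub_add_cancel, ENNReal.ofReal_one]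
  refine isCompactProbability_of_ae_le (R := |α|) ?_
  rw [rareEventMeasure, ae_add_measure_iff]
  constructor
  · refine Measure.ae_smul_measure ?_ _
    rw [ae_dirac_eq]
    simp
  · refine Measure.ae_smul_measure ?_ _
    rw [ae_dirac_eq]
    simp

lemma measureMoment_rareEventMeasure (hlam : 0 < lam) {N : ℕ} (hN : lam ≤ N) {n : ℕ} (hn : 1 ≤ n) :
    measureMoment (rareEventMeasure lam α N) n = lam / N * α ^ n := by
  rw [measureMoment, integral_rareEventMeasure hlam hN, zero_pow (by omega), mul_zero, zero_add]

lemma eventually_le_natCast (lam : ℝ) : ∀ᶠ N : ℕ in atTop, lam ≤ N :=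
  tendsto_natCast_atTop_atTop.eventually_ge_atTop lam

/-- If all moments are of order `1 / N`, then the free cumulants agree with them to leading order: by
induction each block contributes a factor `O(1 / N)`, so partitions with at least two blocks
contribute `O(1 / N²)`. -/
lemma isBigO_freeCumulant_sub {m : ℕ → ℕ → ℝ} {c : ℕ → ℝ}
    (hm : ∀ n, 1 ≤ n → ∀ᶠ N : ℕ in atTop, m N n = c n / N) {n : ℕ} (hn : 1 ≤ n) :
    (fun N : ℕ => freeCumulant (m N) n - c n / N) =O[atTop] fun N : ℕ => 1 / (N : ℝ) ^ 2 := by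
  induction n using Nat.strong_induction_on with
  | _ n ih =>
    have hle : ∀ᶠ N : ℕ in atTop, 1 / (N : ℝ) ≤ 1 := by
      filter_upwards [eventually_ge_atTop 1] with N hN
      exact (div_le_one (by exact_mod_cast hN)).2 (by exact_mod_cast hN)
    have hpow : ∀ k, 2 ≤ k → (fun N : ℕ => (1 / (N : ℝ)) ^ k) =O[atTop]
        fun N : ℕ => 1 / (N : ℝ) ^ 2 := by
      intro k hk
      refine Asymptotics.IsBigO.of_bound 1 ?_
      filter_upwards [hle] with N hN
      rw [one_mul, ← one_div_pow, Real.norm_of_nonneg (by positivity),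
        Real.norm_of_nonneg (by positivity)]
      exact pow_le_pow_of_le_one (by positivity) hN hk
    have hone : (fun N : ℕ => 1 / (N : ℝ) ^ 2) =O[atTop] fun N : ℕ => 1 / (N : ℝ) := by
      refine Asymptotics.IsBigO.of_bound 1 ?_
      filter_upwards [hle] with N hN
      rw [one_mul, ← one_div_pow, Real.norm_of_nonneg (by positivity),
        Real.norm_of_nonneg (by positivity)]
      exact pow_le_of_le_one (by positivity) hN two_ne_zero
    have hκ : ∀ k, 1 ≤ k → k < n →
        (fun N : ℕ => freeCumulant (m N) k) =O[atTop] fun N : ℕ => 1 / (N : ℝ) := by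
      intro k hk hkn
      have h1 : (fun N : ℕ => c k / (N : ℝ)) =O[atTop] fun N : ℕ => 1 / (N : ℝ) := by
        refine (Asymptotics.isBigO_const_mul_self (c k) (fun N : ℕ => 1 / (N : ℝ)) atTop).congr_left
          fun N => ?_
        rw [mul_one_div]
      exact (((ih k hkn hk).trans hone).add h1).congr_left fun N => sub_add_cancel _ _
    have hsum : (fun N : ℕ => -∑ π ∈ (nonCrossingPartitions n).filter (fun π => 2 ≤ π.parts.card),
        ∏ B ∈ π.parts, if _h : B.card < n then freeCumulant (m N) B.card else 0) =O[atTop]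
        fun N : ℕ => 1 / (N : ℝ) ^ 2 := by
      refine Asymptotics.IsBigO.neg_left (Asymptotics.IsBigO.fun_sum fun π hπ => ?_)
      have hprod : (fun N : ℕ => ∏ B ∈ π.parts,
          if _h : B.card < n then freeCumulant (m N) B.card else 0) =O[atTop]
          fun N : ℕ => ∏ _B ∈ π.parts, 1 / (N : ℝ) := by
        refine Asymptotics.IsBigO.finsetProd fun B hB => ?_
        by_cases h : B.card < n
        · simp only [h, dite_true]
          exact hκ _ (Finset.card_pos.2 (π.nonempty_of_mem_parts hB)) h
        · simp only [h, dite_false]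
          exact Asymptotics.isBigO_zero _ _
      simp_rw [Finset.prod_const] at hprod
      exact hprod.trans (hpow _ (Finset.mem_filter.1 hπ).2)
    refine hsum.congr' ?_ EventuallyEq.rfl
    filter_upwards [hm n hn] with N hN
    rw [freeCumulant, hN]
    ring

lemma isBigO_measureFreeCumulant_rareEventMeasure (hlam : 0 < lam) {n : ℕ} (hn : 1 ≤ n) :
    (fun N : ℕ => measureFreeCumulant (rareEventMeasure lam α N) n - lam / N * α ^ n)
      =O[atTop] fun N : ℕ => 1 / (N : ℝ) ^ 2 := by
  have h := isBigO_freeCumulant_sub (m := fun N => measureMoment (rareEventMeasure lam α N))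
    (c := fun n => lam * α ^ n) (fun n hn => ?_) hn
  · refine h.congr_left fun N => ?_
    rw [measureFreeCumulant, div_mul_eq_mul_div]
  · filter_upwards [eventually_le_natCast lam] with N hN
    rw [measureMoment_rareEventMeasure hlam hN hn, div_mul_eq_mul_div]

lemma one_le_of_le_natCast (hlam : 0 < lam) {N : ℕ} (hN : lam ≤ N) : 1 ≤ N := by
  have : (0 : ℝ) < N := hlam.trans_le hN
  exact_mod_cast this

lemma isCompactProbability_freeConvPow_rareEventMeasure (hlam : 0 < lam) {N : ℕ} (hN : lam ≤ N) :
    IsCompactProbability (freeConvPow (rareEventMeasure lam α N) N) :=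
  isCompactProbability_freeConvPow (isCompactProbability_rareEventMeasure hlam hN)
    (one_le_of_le_natCast hlam hN)

lemma measureFreeCumulant_freeConvPow_rareEventMeasure (hlam : 0 < lam) {N : ℕ} (hN : lam ≤ N)
    {n : ℕ} (hn : 1 ≤ n) : measureFreeCumulant (freeConvPow (rareEventMeasure lam α N) N) n =
      N * measureFreeCumulant (rareEventMeasure lam α N) n :=
  measureFreeCumulant_freeConvPow (isCompactProbability_rareEventMeasure hlam hN)
    (one_le_of_le_natCast hlam hN) hn

lemma isBigO_measureFreeCumulant_freeConvPow (hlam : 0 < lam) {n : ℕ} (hn : 1 ≤ n) :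
    (fun N : ℕ => measureFreeCumulant (freeConvPow (rareEventMeasure lam α N) N) n - lam * α ^ n)
      =O[atTop] fun N : ℕ => 1 / (N : ℝ) := by
  have h := (Asymptotics.isBigO_refl (fun N : ℕ => (N : ℝ)) atTop).mul
    (isBigO_measureFreeCumulant_rareEventMeasure (α := α) hlam hn)
  refine h.congr' ?_ ?_
  · filter_upwards [eventually_le_natCast lam] with N hN
    have hN0 : (N : ℝ) ≠ 0 := (hlam.trans_le hN).ne'
    rw [measureFreeCumulant_freeConvPow_rareEventMeasure hlam hN hn]
    field_simp
  · filter_upwards [eventually_ge_atTop 1] with N hN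
    have hN0 : (N : ℝ) ≠ 0 := by positivity
    field_simp

lemma tendsto_measureFreeCumulant_freeConvPow (hlam : 0 < lam) {n : ℕ} (hn : 1 ≤ n) :
    Tendsto (fun N : ℕ => measureFreeCumulant (freeConvPow (rareEventMeasure lam α N) N) n)
      atTop (𝓝 (lam * α ^ n)) := by
  have h := (isBigO_measureFreeCumulant_freeConvPow (α := α) hlam hn).trans_tendsto
    tendsto_one_div_atTop_nhds_zero_nat
  simpa using h.add_const (lam * α ^ n)

lemma tendsto_measureMoment_freeConvPow (hlam : 0 < lam) (hα : 0 < α) (n : ℕ) :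
    Tendsto (fun N : ℕ => measureMoment (freeConvPow (rareEventMeasure lam α N) N) n)
      atTop (𝓝 (measureMoment (marchenkoPastur lam α) n)) := by
  rcases Nat.eq_zero_or_pos n with rfl | hn
  · rw [(isCompactProbability_marchenkoPastur hlam hα).measureMoment_zero]
    refine tendsto_const_nhds.congr' ?_
    filter_upwards [eventually_le_natCast lam] with N hN
    rw [(isCompactProbability_freeConvPow_rareEventMeasure hlam hN).measureMoment_zero]
  · simp_rw [moment_eq_sum_freeCumulant _ n hn]
    refine tendsto_finsetSum _ fun π _ => tendsto_finsetProd _ fun B hB => ?_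
    have hB1 : 1 ≤ B.card := Finset.card_pos.2 (π.nonempty_of_mem_parts hB)
    have h := tendsto_measureFreeCumulant_freeConvPow (α := α) hlam hB1
    rw [← measureFreeCumulant_marchenkoPastur hlam hα hB1] at h
    exact h

lemma exists_tendsto_probabilityMeasure (hlam : 0 < lam) (hα : 0 < α) :
    ∃ (P : ℕ → ProbabilityMeasure ℝ) (Q : ProbabilityMeasure ℝ),
      (∀ N : ℕ, lam ≤ N → (P N : Measure ℝ) = freeConvPow (rareEventMeasure lam α N) N) ∧
      (Q : Measure ℝ) = marchenkoPastur lam α ∧ Tendsto P atTop (𝓝 Q) := by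
  have hc := isCompactProbability_marchenkoPastur hlam hα
  let Q : ProbabilityMeasure ℝ := ⟨marchenkoPastur lam α, hc.prob⟩
  have hex : ∀ N : ℕ, ∃ p : ProbabilityMeasure ℝ,
      lam ≤ N → (p : Measure ℝ) = freeConvPow (rareEventMeasure lam α N) N := by
    intro N
    by_cases hN : lam ≤ N
    · exact ⟨⟨_, (isCompactProbability_freeConvPow_rareEventMeasure hlam hN).prob⟩, fun _ => rfl⟩
    · exact ⟨Q, fun h => absurd h hN⟩
  choose P hP using hex
  refine ⟨P, Q, hP, rfl, ?_⟩
  rw [ProbabilityMeasure.tendsto_iff_forall_integral_tendsto]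
  intro f
  have h := tendsto_integral_of_tendsto_moments
    ((eventually_le_natCast lam).mono fun N hN =>
      isCompactProbability_freeConvPow_rareEventMeasure (α := α) hlam hN) hc
    (tendsto_measureMoment_freeConvPow hlam hα) f
  refine h.congr' ?_
  filter_upwards [eventually_le_natCast lam] with N hN
  rw [hP N hN]

end RareEvents

theorem mainTheorem7 (lam α : ℝ) (hlam : 0 < lam) (hα : 0 < α) :
    -- the measures `μ_N`, their moments, and their iterated free convolutions, which exist and do
    -- not depend on the realization by free random variables
    (∀ N : ℕ, lam ≤ N →
      IsCompactProbability (rareEventMeasure lam α N) ∧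
      (∀ n : ℕ, 1 ≤ n → measureMoment (rareEventMeasure lam α N) n = lam / N * α ^ n) ∧
      (∀ k : ℕ, 1 ≤ k → ∀ ρ : Measure ℝ,
        IsFreeConvolution (freeConvPow (rareEventMeasure lam α N) k) (rareEventMeasure lam α N) ρ ↔
          ρ = freeConvPow (rareEventMeasure lam α N) (k + 1)) ∧
      IsCompactProbability (freeConvPow (rareEventMeasure lam α N) N) ∧
      (∀ n : ℕ, 1 ≤ n →
        measureFreeCumulant (freeConvPow (rareEventMeasure lam α N) N) n =
          N * measureFreeCumulant (rareEventMeasure lam α N) n)) ∧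
    -- asymptotics of the free cumulants
    (∀ n : ℕ, 1 ≤ n →
      ((fun N : ℕ => measureFreeCumulant (rareEventMeasure lam α N) n - lam / N * α ^ n)
        =O[atTop] fun N : ℕ => 1 / (N : ℝ) ^ 2) ∧
      ((fun N : ℕ => measureFreeCumulant (freeConvPow (rareEventMeasure lam α N) N) n
          - lam * α ^ n) =O[atTop] fun N : ℕ => 1 / (N : ℝ)) ∧
      Tendsto (fun N : ℕ => measureFreeCumulant (freeConvPow (rareEventMeasure lam α N) N) n)
        atTop (𝓝 (lam * α ^ n))) ∧
    -- the Marchenko–Pastur law is the one and only law with free cumulants `lam * α ^ n`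
    (∀ μ : Measure ℝ,
      (IsCompactProbability μ ∧ ∀ n : ℕ, 1 ≤ n → measureFreeCumulant μ n = lam * α ^ n) ↔
        μ = marchenkoPastur lam α) ∧
    -- weak convergence, and convergence of all moments
    (∃ (P : ℕ → ProbabilityMeasure ℝ) (Q : ProbabilityMeasure ℝ),
      (∀ N : ℕ, lam ≤ N → (P N : Measure ℝ) = freeConvPow (rareEventMeasure lam α N) N) ∧
      (Q : Measure ℝ) = marchenkoPastur lam α ∧ Tendsto P atTop (𝓝 Q)) ∧
    (∀ n : ℕ, Tendsto (fun N : ℕ => measureMoment (freeConvPow (rareEventMeasure lam α N) N) n)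
      atTop (𝓝 (measureMoment (marchenkoPastur lam α) n))) ∧
    -- the Voiculescu transform of the limit
    (∀ w : ℂ, w ≠ 0 → ‖w‖ < 1 / α →
      Summable (fun n : ℕ => (measureFreeCumulant (marchenkoPastur lam α) (n + 1) : ℂ) * w ^ n) ∧
      voiculescuTransform (marchenkoPastur lam α) w = 1 / w + lam * α / (1 - α * w)) ∧
    (∀ᶠ z : ℂ in Bornology.cobounded ℂ,
      voiculescuTransform (marchenkoPastur lam α) (cauchyTransform (marchenkoPastur lam α) z)
        = z) ∧
    -- the Cauchy transform of the limit: its equation and its explicit form, where `s` is the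
    -- branch of the square root, off the interval, that makes `G(z)` behave like `1 / z` at infinity
    (∀ z : ℂ, z ≠ 0 → z ∉ Complex.ofReal '' mpInterval lam α →
      cauchyTransform (marchenkoPastur lam α) z ≠ 0 ∧
      1 - α * cauchyTransform (marchenkoPastur lam α) z ≠ 0 ∧
      1 / cauchyTransform (marchenkoPastur lam α) z
        + lam * α / (1 - α * cauchyTransform (marchenkoPastur lam α) z) = z) ∧
    (∃ s : ℂ → ℂ,
      DifferentiableOn ℂ s (Complex.ofReal '' mpInterval lam α)ᶜ ∧
      (∀ z : ℂ, z ∉ Complex.ofReal '' mpInterval lam α →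
        s z ^ 2 = (z - α * (1 + lam)) ^ 2 - 4 * lam * α ^ 2) ∧
      Tendsto (fun z : ℂ => s z / z) (Bornology.cobounded ℂ) (𝓝 1) ∧
      (∀ z : ℂ, z ≠ 0 → z ∉ Complex.ofReal '' mpInterval lam α →
        cauchyTransform (marchenkoPastur lam α) z =
          (z + α * (1 - lam) - s z) / (2 * α * z))) ∧
    Tendsto (fun z : ℂ => z * cauchyTransform (marchenkoPastur lam α) z)
      (Bornology.cobounded ℂ) (𝓝 1) ∧
    -- Stieltjes inversion recovers the density
    (∀ t : ℝ, t ≠ 0 →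
      Tendsto (fun ε : ℝ =>
          -(1 / Real.pi) * (cauchyTransform (marchenkoPastur lam α) (t + ε * Complex.I)).im)
        (𝓝[>] 0) (𝓝 (mpDensity lam α t))) := by
  refine ⟨fun N hN => ⟨isCompactProbability_rareEventMeasure hlam hN,
      fun n hn => measureMoment_rareEventMeasure hlam hN hn,
      fun k hk ρ => isFreeConvolution_freeConvPow_iff
        (isCompactProbability_rareEventMeasure hlam hN) hk ρ,
      isCompactProbability_freeConvPow_rareEventMeasure hlam hN,
      fun n hn => measureFreeCumulant_freeConvPow_rareEventMeasure hlam hN hn⟩,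
    fun n hn => ⟨isBigO_measureFreeCumulant_rareEventMeasure hlam hn,
      isBigO_measureFreeCumulant_freeConvPow hlam hn,
      tendsto_measureFreeCumulant_freeConvPow hlam hn⟩,
    isCompactProbability_and_freeCumulant_eq_iff hlam hα,
    exists_tendsto_probabilityMeasure hlam hα,
    tendsto_measureMoment_freeConvPow hlam hα,
    fun w _ hw => ⟨(hasSum_freeCumulant_marchenkoPastur hlam hα hw).summable,
      voiculescuTransform_marchenkoPastur hlam hα hw⟩,
    voiculescuTransform_cauchyTransform_marchenkoPastur hlam hα,
    fun z hz0 hz => cauchyTransform_marchenkoPastur_equation hlam hα hz0 hz,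
    ⟨mpRoot lam α, differentiableOn_mpRoot hlam hα, fun z hz => mpRoot_sq hlam hα hz,
      tendsto_mpRoot_div hlam hα,
      fun z hz0 hz => cauchyTransform_marchenkoPastur_eq_mpRoot hlam hα hz0 hz⟩,
    tendsto_mul_cauchyTransform_marchenkoPastur hlam hα,
    fun t ht => stieltjes_inversion_marchenkoPastur hlam hα ht⟩
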